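/- **Setting.** All logarithms $\log$ are to base 2. For finite sets $\mathcal X,\mathcal Y,\mathcal A,\mathcal B$ (with $\mathcal X,\mathcal Y\neq\emptyset$), $A=|\mathcal A|$, $B=|\mathcal B|$, a conditional distribution $\mathbf p=p(a,b|x,y)$ is *non-signaling* if $\sum_b p(a,b|x,y)$ does not depend on $y$ and $\sum_a p(a,b|x,y)$ does not depend on $x$. It is *quantum* if $p(a,b|x,y)=\langle\psi|E_a(x)E_b(y)|\psi\rangle$ for a unit vector $\psi$ of a Hilbert space and families of projective measurements $\{E_a(x)\}_a$, $\{E_b(y)\}_b$ (self-adjoint, mutually orthogonal projections that sum to the identity) with $E_a(x)E_b(y)=E_b(y)E_a(x)$. Let $\delta(\mathbf p,\mathbf p')=\max_{x,y,\mathcal E\subseteq\mathcal A\times\mathcal B}|p(\mathcal E|x,y)-p'(\mathcal E|x,y)|$. $Q^{\mathrm{ent}}_\epsilon(\mathbf p)$ is the least number of qubits exchanged by a two-party protocol with arbitrary shared entanglement in which Alice, given $x$, outputs $a$ and Bob, given $y$, outputs $b$, such that the output distribution $\mathbf p'$ satisfies $\delta(\mathbf p,\mathbf p')\le\epsilon$.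 (The private registers of the two players are described by commuting $*$-algebras of operators, tensor products being a special case.) For a Boolean function $f:\{0,1\}^n\times\{0,1\}^n\to\{0,1\}$ put $Q^{\mathrm{ent}}_\epsilon(f)=Q^{\mathrm{ent}}_\epsilon(\mathbf p_f)$, where $\mathbf p_f$ is the distribution on $\{\pm1\}\times\{\pm1\}$ with $p_f(a,b|x,y)=\frac12$ if $a\cdot b=(-1)^{f(x,y)}$ and $0$ otherwise. In the simultaneous-messages model Alice and Bob each send one message to a referee, who does not know the inputs and produces the output; the cost is the total length of the two messages. $R^{\parallel,\mathrm{pub}}$ is the least cost with classical messages when Alice and Bob share random bits, $Q^{\parallel}$ the least cost with quantum messages and no shared resource. A subscript $\delta$ for a function $f$ means that the referee outputs $f(x,y)$ with probability at least $1-\delta$ on every input; a subscript $\eta$ for a distribution $\mathbf p$ means that the distribution of the pair $(a,b)$ output by the referee is within distance $\eta$ of $\mathbf p$ in the above metric. $K_G$ is Grothendieck's constant (real case). The constants implied by $O(\cdot)$ are absolute. **Statement.** Let $0\le\epsilon<\frac12$, $0<\delta<\frac12$, and let $q\ge0$ be an integer. Let $f:\{0,1\}^n\times\{0,1\}^n\to\{0,1\}$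 with $Q^{\mathrm{ent}}_\epsilon(f)\le q$. Then 1. $R_{\delta}^{\parallel,\mathrm{pub}}(f)\le K_G^2\cdot 2^{2q+2}\,\ln\!\left(\frac1\delta\right)\frac1{(1-2\epsilon)^2}$; 2. if $n\ge2$, $\;Q_{\delta}^{\parallel}(f)\le O\!\left(\log(n)\,2^{4q}\ln\!\left(\frac1\delta\right)\frac1{(1-2\epsilon)^4}\right)$. Let $\mathbf p$ be a non-signaling distribution with inputs in $\mathcal X\times\mathcal Y$ and outcomes in $\mathcal A\times\mathcal B$ and $Q^{\mathrm{ent}}_\epsilon(\mathbf p)\le q$. Then 3. $R_{\epsilon+\delta}^{\parallel,\mathrm{pub}}(\mathbf p)\le O\!\left(2^{4q}\frac{(AB)^4}{\delta^2}\ln^2\!\left[\frac{AB}\delta\right]\right)$; 4. if $|\mathcal X\times\mathcal Y|\le2^n$ with $n\ge2$, $\;Q_{\epsilon+\delta}^{\parallel}(\mathbf p)\le O\!\left(2^{8q}\frac{(AB)^9}{\delta^4}\ln\!\left[\frac{AB}\delta\right]\log(n)\right)$. In particular, if $\mathbf p$ is a quantum distribution, then $R_{\delta}^{\parallel,\mathrm{pub}}(\mathbf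 p)\le O\!\left(\frac{(AB)^4}{\delta^2}\ln^2\!\left[\frac{AB}\delta\right]\right)$, which does not depend on the size of the inputs, and, if $|\mathcal X\times\mathcal Y|\le2^n$ with $n\ge2$, $\;Q_{\delta}^{\parallel}(\mathbf p)\le O\!\left(\frac{(AB)^9}{\delta^4}\ln\!\left[\frac{AB}\delta\right]\log(n)\right)$. -/

import Mathlib

noncomputable section

open scoped Kronecker InnerProductSpace ComplexOrder

namespace NonSignaling

universe u₁ u₂ u₃ u₄ w

/-! ### Conditional distributions `p(a,b|x,y)`, written `p x y a b` -/

section Distributions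

variable {X : Type u₁} {Y : Type u₂} {A : Type u₃} {B : Type u₄} [Fintype A] [Fintype B]

/-- `p` is a non-signaling conditional distribution: for all inputs it is a probability
distribution on `A × B`, and neither marginal depends on the other player's input. -/
structure IsNonSignaling (p : X → Y → A → B → ℝ) : Prop where
  nonneg : ∀ x y a b, 0 ≤ p x y a b
  sum_eq_one : ∀ x y, ∑ a, ∑ b, p x y a b = 1
  alice : ∀ a x y y', ∑ b, p x y a b = ∑ b, p x y' a b
  bob : ∀ b x x' y, ∑ a, p x y a b = ∑ a, p x' y a b

/-- Total variation distance: the maximum over all inputs `x, y` and all events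
`S ⊆ A × B` of `|p(S|x,y) - p'(S|x,y)|`. -/
def statDist (p p' : X → Y → A → B → ℝ) : ℝ :=
  ⨆ t : X × Y × Finset (A × B),
    |(∑ c ∈ t.2.2, p t.1 t.2.1 c.1 c.2) - ∑ c ∈ t.2.2, p' t.1 t.2.1 c.1 c.2|

/-- A complete family of mutually orthogonal projections, indexed by the outcomes. -/
structure IsProjectiveMeasurement {R : Type*} [Ring R] [StarRing R] {O : Type*} [Fintype O]
    (E : O → R) : Prop where
  proj : ∀ o, IsStarProjection (E o)
  orth : ∀ o o', o ≠ o' → E o * E o' = 0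
  sum_eq_one : ∑ o, E o = 1

/-- Quantum distributions: `p(a,b|x,y) = ⟨ψ|E_a(x) F_b(y)|ψ⟩` for a state `ψ` of some Hilbert
space and projective measurements of the two players that commute with each other. -/
def IsQuantum (p : X → Y → A → B → ℝ) : Prop :=
  ∃ (H : Type w) (_ : NormedAddCommGroup H) (_ : InnerProductSpace ℂ H) (_ : CompleteSpace H)
    (ψ : H) (E : X → A → (H →L[ℂ] H)) (F : Y → B → (H →L[ℂ] H)),
    ‖ψ‖ = 1 ∧
    (∀ x, IsProjectiveMeasurement (E x)) ∧
    (∀ y, IsProjectiveMeasurement (F y)) ∧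
    (∀ x y a b, E x a * F y b = F y b * E x a) ∧
    ∀ x y a b, (p x y a b : ℂ) = ⟪ψ, (E x a * F y b) ψ⟫_ℂ

end Distributions

/-- The sign matrix of a Boolean function: `0 ↦ +1`, `1 ↦ -1`. -/
def sign (c : Bool) : ℤˣ := if c then -1 else 1

/-- The distribution `p_f` on outcomes in `{±1} × {±1}`: uniform on the two pairs `(a, b)` with
`a * b = C_f(x,y)`, where `C_f` is the sign matrix of `f`. -/
def boolDist {X : Type u₁} {Y : Type u₂} (f : X → Y → Bool) : X → Y → ℤˣ → ℤˣ → ℝ :=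
  fun x y a b => if a * b = sign (f x y) then 1 / 2 else 0

/-! ### Quantum communication with shared entanglement -/

section Entangled

variable (H : Type w) [NormedAddCommGroup H] [InnerProductSpace ℂ H]

/-- Operators on `H ⊗ (ℂ²)^{⊗ q}`, as matrices indexed by `q`-bit strings (the computational
basis of `q` qubits) with entries in the bounded operators on `H`. -/
abbrev QubitOp (q : ℕ) : Type w :=
  Matrix (Fin q → Bool) (Fin q → Bool) (H →L[ℂ] H)

variable {H}

open Classical in
/-- `M` acts through the algebra `𝓐` on `H`, and on the qubits in `S`, only:
`M = N ⊗ 1`, where `N` is an operator on `H` and the qubits in `S` whose entries lie in `𝓐`, and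
`1` is the identity on the qubits outside `S`. -/
def IsLocalOp [CompleteSpace H] {q : ℕ} (𝓐 : StarSubalgebra ℂ (H →L[ℂ] H)) (S : Set (Fin q))
    (M : QubitOp H q) : Prop :=
  ∃ N : Matrix (S → Bool) (S → Bool) (H →L[ℂ] H), (∀ s t, N s t ∈ 𝓐) ∧
    ∀ s t, M s t = if ∀ i, i ∉ S → s i = t i then N (fun i => s i) (fun i => t i) else 0

/-- The two players. -/
inductive Player
  | alice
  | bob

/-- The message qubits that Alice holds before round `t` (counted from `0`): those among the first
`t` that Bob has sent, and those among the others that she is still going to send. Bob holds the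
complement. -/
def aliceHolds {q : ℕ} (sender : Fin q → Player) (t : ℕ) : Set (Fin q) :=
  {i | ((i : ℕ) < t ∧ sender i = Player.bob) ∨ (t ≤ (i : ℕ) ∧ sender i = Player.alice)}

/-- A two-party protocol that exchanges `q` qubits, with shared entanglement.

The players' registers before the communication are described by two commuting `*`-algebras
`algA`, `algB` of operators on `H`, as in the definition of quantum distributions (for
`H = H_A ⊗ H_B` take the operators `S ⊗ 1` and `1 ⊗ T`), and `ψ` is their shared state. There are
`q` message qubits, in the state `|0⟩`, the `i`-th one with the player who sends it in round `i`.
In round `i` both players apply unitaries, depending on their own input only, to their register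
and the message qubits that they hold, and then qubit `i` passes from `sender i` to the other
player. After the last round both measure what they hold. -/
structure EntProtocol (H : Type w) [NormedAddCommGroup H] [InnerProductSpace ℂ H] [CompleteSpace H]
    (X : Type u₁) (Y : Type u₂) (A : Type u₃) (B : Type u₄) [Fintype A] [Fintype B] (q : ℕ) where
  algA : StarSubalgebra ℂ (H →L[ℂ] H)
  algB : StarSubalgebra ℂ (H →L[ℂ] H)
  comm : ∀ S ∈ algA, ∀ T ∈ algB, S * T = T * S
  ψ : H
  norm_ψ : ‖ψ‖ = 1
  sender : Fin q → Player
  U : Fin q → X → QubitOp H q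
  U_unitary : ∀ i x, U i x ∈ unitary (QubitOp H q)
  U_local : ∀ i x, IsLocalOp algA (aliceHolds sender i.val) (U i x)
  V : Fin q → Y → QubitOp H q
  V_unitary : ∀ i y, V i y ∈ unitary (QubitOp H q)
  V_local : ∀ i y, IsLocalOp algB (aliceHolds sender i.val)ᶜ (V i y)
  E : X → A → QubitOp H q
  E_meas : ∀ x, IsProjectiveMeasurement (E x)
  E_local : ∀ x a, IsLocalOp algA (aliceHolds sender q) (E x a)
  F : Y → B → QubitOp H q
  F_meas : ∀ y, IsProjectiveMeasurement (F y)
  F_local : ∀ y b, IsLocalOp algB (aliceHolds sender q)ᶜ (F y b)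

namespace EntProtocol

variable [CompleteSpace H] {X : Type u₁} {Y : Type u₂} {A : Type u₃} {B : Type u₄}
  [Fintype A] [Fintype B] {q : ℕ}

/-- The whole evolution `U_{q-1} V_{q-1} ⋯ U_0 V_0` on inputs `x, y`. -/
def evolution (P : EntProtocol H X Y A B q) (x : X) (y : Y) : QubitOp H q :=
  ((List.ofFn fun i => P.U i x * P.V i y).reverse).prod

/-- The probability that Alice outputs `a` and Bob outputs `b` on inputs `x, y`, that is
`⟨Ψ|E_a(x) F_b(y)|Ψ⟩` for the final state `Ψ = W (ψ ⊗ |0…0⟩)`, `W` being the evolution. -/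
def prob (P : EntProtocol H X Y A B q) (x : X) (y : Y) (a : A) (b : B) : ℝ :=
  (⟪P.ψ, ((star (P.evolution x y) * (P.E x a * P.F y b) * P.evolution x y)
    (fun _ => false) (fun _ => false)) P.ψ⟫_ℂ).re

end EntProtocol

/-- `Q_ε^ent(p)`: the least number of qubits exchanged by an entanglement-assisted protocol whose
output distribution is within total variation distance `ε` of `p`. -/
def entQuantumCost {X : Type u₁} {Y : Type u₂} {A : Type u₃} {B : Type u₄}
    [Fintype A] [Fintype B] (ε : ℝ) (p : X → Y → A → B → ℝ) : ℕ∞ :=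
  ⨅ (q : ℕ) (_ : ∃ (H : Type w) (_ : NormedAddCommGroup H) (_ : InnerProductSpace ℂ H)
    (_ : CompleteSpace H) (P : EntProtocol H X Y A B q), statDist p P.prob ≤ ε), (q : ℕ∞)

end Entangled

/-! ### Simultaneous messages -/

section SMP

/-- A public-coin simultaneous-messages protocol: Alice and Bob share the random value `ω`
(distributed according to `coin`) and send `k` and `l` bits to a referee, who sees nothing but the
two messages and outputs `o` with probability `referee m m' o`. (Private randomness of Alice and
Bob can be made part of `ω`.) -/
structure PubSMP (X : Type u₁) (Y : Type u₂) (O : Type u₃) [Fintype O] (k l : ℕ) where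
  Ω : Type
  fintypeΩ : Fintype Ω
  coin : Ω → ℝ
  coin_mem : coin ∈ stdSimplex ℝ Ω
  msgA : X → Ω → (Fin k → Bool)
  msgB : Y → Ω → (Fin l → Bool)
  referee : (Fin k → Bool) → (Fin l → Bool) → O → ℝ
  referee_mem : ∀ m m', referee m m' ∈ stdSimplex ℝ O

/-- The probability of the output `o` on inputs `x, y`. -/
def PubSMP.prob {X : Type u₁} {Y : Type u₂} {O : Type u₃} [Fintype O] {k l : ℕ}
    (P : PubSMP X Y O k l) (x : X) (y : Y) (o : O) : ℝ :=
  letI := P.fintypeΩ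
  ∑ ω, P.coin ω * P.referee (P.msgA x ω) (P.msgB y ω) o

/-- A quantum simultaneous-messages protocol without shared resources: Alice and Bob send `k` and
`l` qubits, in the (possibly mixed) states `ρ x` and `σ y`, to a referee, who performs a
measurement (a POVM) on the product state to produce the output. -/
structure QuantumSMP (X : Type u₁) (Y : Type u₂) (O : Type u₃) [Fintype O] (k l : ℕ) where
  ρ : X → Matrix (Fin k → Bool) (Fin k → Bool) ℂ
  ρ_pos : ∀ x, (ρ x).PosSemidef
  ρ_trace : ∀ x, (ρ x).trace = 1
  σ : Y → Matrix (Fin l → Bool) (Fin l → Bool) ℂ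
  σ_pos : ∀ y, (σ y).PosSemidef
  σ_trace : ∀ y, (σ y).trace = 1
  povm : O → Matrix ((Fin k → Bool) × (Fin l → Bool)) ((Fin k → Bool) × (Fin l → Bool)) ℂ
  povm_pos : ∀ o, (povm o).PosSemidef
  povm_sum : ∑ o, povm o = 1

/-- The probability of the output `o` on inputs `x, y`. -/
def QuantumSMP.prob {X : Type u₁} {Y : Type u₂} {O : Type u₃} [Fintype O] {k l : ℕ}
    (P : QuantumSMP X Y O k l) (x : X) (y : Y) (o : O) : ℝ :=
  ((P.povm o * (P.ρ x ⊗ₖ P.σ y)).trace).re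

variable {X : Type u₁} {Y : Type u₂}

/-- The least total number of bits sent in a public-coin simultaneous-messages protocol whose
output probabilities satisfy `good`. -/
def pubSMPCost {O : Type u₃} [Fintype O] (good : (X → Y → O → ℝ) → Prop) : ℕ∞ :=
  ⨅ (k : ℕ) (l : ℕ) (_ : ∃ P : PubSMP X Y O k l, good P.prob), ((k + l : ℕ) : ℕ∞)

/-- The least total number of qubits sent in a quantum simultaneous-messages protocol whose
output probabilities satisfy `good`. -/
def quantumSMPCost {O : Type u₃} [Fintype O] (good : (X → Y → O → ℝ) → Prop) : ℕ∞ :=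
  ⨅ (k : ℕ) (l : ℕ) (_ : ∃ P : QuantumSMP X Y O k l, good P.prob), ((k + l : ℕ) : ℕ∞)

/-- The referee outputs `f(x,y)` with probability at least `1 - δ` on all inputs. -/
def Computes (δ : ℝ) (f : X → Y → Bool) (P : X → Y → Bool → ℝ) : Prop :=
  ∀ x y, 1 - δ ≤ P x y (f x y)

/-- The referee outputs a pair `(a,b)` whose distribution is within total variation distance `η`
of `p`. -/
def Simulates {A : Type u₃} {B : Type u₄} [Fintype A] [Fintype B] (η : ℝ)
    (p : X → Y → A → B → ℝ) (P : X → Y → A × B → ℝ) : Prop :=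
  statDist p (fun x y a b => P x y (a, b)) ≤ η

end SMP

/-- Grothendieck's constant (real case): the least `K` such that, for every real matrix `M` with
`|∑ M i j s i t j| ≤ 1` for all signs `s i, t j`, one has `|∑ M i j ⟨u i, v j⟩| ≤ K` for all unit
vectors `u i, v j` of a real Euclidean space. -/
def grothendieckConstant : ℝ :=
  sInf {K : ℝ | ∀ (m n : ℕ) (M : Matrix (Fin m) (Fin n) ℝ),
    (∀ (s : Fin m → ℤˣ) (t : Fin n → ℤˣ),
      |∑ i, ∑ j, M i j * (((s i * t j : ℤˣ) : ℤ) : ℝ)| ≤ 1) →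
    ∀ (d : ℕ) (u : Fin m → EuclideanSpace ℝ (Fin d)) (v : Fin n → EuclideanSpace ℝ (Fin d)),
      (∀ i, ‖u i‖ = 1) → (∀ j, ‖v j‖ = 1) →
      |∑ i, ∑ j, M i j * ⟪u i, v j⟫_ℝ| ≤ K}

end NonSignaling

end

open scoped ENNReal

open NonSignaling

universe u₁ u₂ u₃ u₄ w

/-! A protocol is first turned into geometry. In the Heisenberg picture the measured operator is
pulled back through the rounds. Expanding each exchanged qubit in its four matrix units keeps the
result of the form `∑ₖ Aₖ(x) Bₖ(y)`, with `Aₖ` belonging to Alice and `Bₖ` to Bob, and the bounds on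
`∑ Aₖ Aₖ*` and `∑ Bₖ* Bₖ` grow by a factor 2 per qubit (`hasDecomposition_evolution`). In the
initial state this writes probabilities and correlations as `⟪u x, v y⟫` with squared norms at most
`2 ^ q`. For a quantum distribution the same holds with squared norms at most 1.

Grothendieck's inequality, dualized by Hahn–Banach (`exists_coin_of_inner`), says that `⟪u x, v y⟫ /
(K_G * 2 ^ q)` is the mean of a product of two signs, which the players compute separately from a
shared coin. If both send their sign, the referee holds a coin of exactly this bias. Since `K_G` is
an infimum, one also has to know that some constant works; a truncation of Rademacher sums shows
that 98 does.

A Boolean function is computed by a majority vote over independent copies, each of bias at least `(1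
- 2 * ε) / (K_G * 2 ^ q)` (`majority_correct`). A distribution is simulated with one such coin for
every outcome pair: the referee tosses each coin many times, takes the distribution nearest to the
empirical estimate and samples from it (`exists_estimator`).

Without shared randomness, a Chernoff bound fixes in advance `2 ^ r` coin values whose averages are
right for all inputs at once (`exists_sample`); `r` is logarithmic in `n` and in the precision. Each
player sends the superposition of the signs over these values, on `r + 1` qubits, and a conditional
swap yields a coin of half the bias (`QuantumSMP.exists_fingerprint`). The classical post-processing
is unchanged. -/

noncomputable section

open scoped InnerProductSpace

namespace NonSignaling

/-! ### Rademacher sums on the discrete cube -/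

/-- The real sign of a bit. -/
def bsgn (b : Bool) : ℝ := if b then -1 else 1

@[simp] lemma bsgn_true : bsgn true = -1 := rfl
@[simp] lemma bsgn_false : bsgn false = 1 := rfl

lemma bsgn_mul_self (b : Bool) : bsgn b * bsgn b = 1 := by cases b <;> simp

lemma abs_bsgn (b : Bool) : |bsgn b| = 1 := by cases b <;> simp

lemma bsgn_not (b : Bool) : bsgn (!b) = -bsgn b := by cases b <;> simp

lemma bsgn_xor (a b : Bool) : bsgn (xor a b) = bsgn a * bsgn b := by cases a <;> cases b <;> simp

/-- The Rademacher sum with coefficients `u`. -/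
def rademacher {d : ℕ} (u : Fin d → ℝ) (ω : Fin d → Bool) : ℝ := ∑ i, u i * bsgn (ω i)

lemma sum_cube_succ {d : ℕ} (F : (Fin (d + 1) → Bool) → ℝ) :
    ∑ ω, F ω = ∑ ω : Fin d → Bool, (F (Fin.cons true ω) + F (Fin.cons false ω)) := by
  rw [← (Fin.consEquiv (fun _ : Fin (d + 1) => Bool)).sum_comp F, Fintype.sum_prod_type,
    Fintype.sum_bool, ← Finset.sum_add_distrib]
  rfl

lemma rademacher_cons {d : ℕ} (u : Fin (d + 1) → ℝ) (b : Bool) (ω : Fin d → Bool) :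
    rademacher u (Fin.cons b ω : Fin (d + 1) → Bool) =
      u 0 * bsgn b + rademacher (fun i => u i.succ) ω := by
  simp [rademacher, Fin.sum_univ_succ]

lemma sum_rademacher_mul {d : ℕ} (u v : Fin d → ℝ) :
    ∑ ω, rademacher u ω * rademacher v ω = 2 ^ d * ∑ i, u i * v i := by
  induction d with
  | zero => simp [rademacher]
  | succ d ih =>
    rw [sum_cube_succ]
    simp only [rademacher_cons, bsgn_true, bsgn_false]
    have : ∀ ω : Fin d → Bool,
        (u 0 * -1 + rademacher (fun i => u i.succ) ω) * (v 0 * -1 + rademacher (fun i => v i.succ) ω)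
        + (u 0 * 1 + rademacher (fun i => u i.succ) ω) * (v 0 * 1 + rademacher (fun i => v i.succ) ω)
        = 2 * (u 0 * v 0) + 2 * (rademacher (fun i => u i.succ) ω * rademacher (fun i => v i.succ) ω) := by
      intro ω; ring
    simp only [this, Finset.sum_add_distrib, ← Finset.mul_sum, ih, Fin.sum_univ_succ]
    simp; ring

/-- Khintchine's inequality for the fourth moment. Averaging over the first sign kills the odd
powers, and the mixed term agrees with the one in the square on the right; the induction step only
loses `u 0 ^ 4` against `3 * u 0 ^ 4`. -/
lemma sum_rademacher_pow_four {d : ℕ} (u : Fin d → ℝ) :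
    ∑ ω, rademacher u ω ^ 4 ≤ 2 ^ d * (3 * (∑ i, u i ^ 2) ^ 2) := by
  induction d with
  | zero => simp [rademacher]
  | succ d ih =>
    rw [sum_cube_succ]
    simp only [rademacher_cons, bsgn_true, bsgn_false]
    have h4 : ∀ ω : Fin d → Bool,
        (u 0 * -1 + rademacher (fun i => u i.succ) ω) ^ 4
        + (u 0 * 1 + rademacher (fun i => u i.succ) ω) ^ 4
        = 2 * u 0 ^ 4 + 12 * u 0 ^ 2 * (rademacher (fun i => u i.succ) ω *
            rademacher (fun i => u i.succ) ω) + 2 * rademacher (fun i => u i.succ) ω ^ 4 := by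
      intro ω; ring
    have := ih (fun i => u i.succ)
    simp only [h4, Finset.sum_add_distrib, ← Finset.mul_sum, sum_rademacher_mul, Fin.sum_univ_succ]
    have hc : (Finset.univ : Finset (Fin d → Bool)).card = 2 ^ d := by simp
    rw [Finset.sum_const, hc, nsmul_eq_mul]
    simp only [← pow_two]
    push_cast
    set S := ∑ i : Fin d, u i.succ ^ 2
    have h0 : 0 ≤ (2:ℝ) ^ d * u 0 ^ 4 := by positivity
    have e : (2:ℝ) ^ (d + 1) * (3 * (u 0 ^ 2 + S) ^ 2) = 6 * (2 ^ d * u 0 ^ 4) +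
        12 * u 0 ^ 2 * (2 ^ d * S) + 2 * (2 ^ d * (3 * S ^ 2)) := by ring
    linarith

/-! ### Grothendieck's inequality -/

section Grothendieck

variable {m n : ℕ} {M : Matrix (Fin m) (Fin n) ℝ}

/-- The hypothesis of Grothendieck's inequality. -/
def SignBounded {X Y : Type*} [Fintype X] [Fintype Y] (M : X → Y → ℝ) : Prop :=
  ∀ (s : X → ℤˣ) (t : Y → ℤˣ), |∑ i, ∑ j, M i j * (((s i * t j : ℤˣ) : ℤ) : ℝ)| ≤ 1

lemma exists_sign_mul_eq_abs (r : ℝ) : ∃ s : ℤˣ, ((s : ℤ) : ℝ) * r = |r| := by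
  rcases le_total 0 r with h | h
  · exact ⟨1, by simp [abs_of_nonneg h]⟩
  · exact ⟨-1, by simp [abs_of_nonpos h]⟩

lemma abs_sum_mul_le {X : Type*} [Fintype X] (c a : X → ℝ) {T : ℝ} (ha : ∀ i, |a i| ≤ T) :
    |∑ i, c i * a i| ≤ T * ∑ i, |c i| := by
  rw [Finset.mul_sum]
  refine (Finset.abs_sum_le_sum_abs _ _).trans (Finset.sum_le_sum fun i _ => ?_)
  rw [abs_mul, mul_comm]
  exact mul_le_mul_of_nonneg_right (ha i) (abs_nonneg _)

/-- A bilinear form on a cube is largest at vertices: `b` is replaced by the signs of the column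
sums, then `a` by the signs of the resulting row sums. -/
lemma SignBounded.abs_sum_le {X Y : Type*} [Fintype X] [Fintype Y] {M : X → Y → ℝ}
    (h : SignBounded M) {T : ℝ} (hT : 0 ≤ T) (a : X → ℝ) (b : Y → ℝ)
    (ha : ∀ i, |a i| ≤ T) (hb : ∀ j, |b j| ≤ T) :
    |∑ i, ∑ j, M i j * (a i * b j)| ≤ T ^ 2 := by
  choose t ht using fun j => exists_sign_mul_eq_abs (∑ i, M i j * a i)
  choose s hs using fun i => exists_sign_mul_eq_abs (∑ j, M i j * ((t j : ℤ) : ℝ))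
  have e1 : ∑ i, ∑ j, M i j * (a i * b j) = ∑ j, (∑ i, M i j * a i) * b j := by
    rw [Finset.sum_comm]
    exact Finset.sum_congr rfl fun j _ => by
      rw [Finset.sum_mul]; exact Finset.sum_congr rfl fun i _ => by ring
  have e2 : ∑ j, |∑ i, M i j * a i| = ∑ i, (∑ j, M i j * ((t j : ℤ) : ℝ)) * a i := by
    simp_rw [← ht, Finset.mul_sum, Finset.sum_mul]
    rw [Finset.sum_comm]
    exact Finset.sum_congr rfl fun i _ => Finset.sum_congr rfl fun j _ => by ring
  have e3 : ∑ i, |∑ j, M i j * ((t j : ℤ) : ℝ)|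
      = ∑ i, ∑ j, M i j * (((s i * t j : ℤˣ) : ℤ) : ℝ) := by
    simp_rw [← hs, Finset.mul_sum]
    exact Finset.sum_congr rfl fun i _ => Finset.sum_congr rfl fun j _ => by push_cast; ring
  have h1 := abs_sum_mul_le (fun j => ∑ i, M i j * a i) b hb
  have h2 := abs_sum_mul_le (fun i => ∑ j, M i j * ((t j : ℤ) : ℝ)) a ha
  have h3 := (le_abs_self _).trans (h s t)
  rw [e1]
  rw [← e3] at h3
  have h4 := (le_abs_self _).trans h2
  rw [← e2] at h4
  calc _ ≤ _ := h1
    _ ≤ T * (T * 1) := by gcongr; exact h4.trans (by gcongr)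
    _ = T ^ 2 := by ring

/-- The values `∑ M i j ⟨u i, v j⟩` on the unit balls of finite-dimensional Euclidean spaces. -/
def gramValues (M : Matrix (Fin m) (Fin n) ℝ) : Set ℝ :=
  {r | ∃ (ι : Type) (_ : Fintype ι) (u : Fin m → EuclideanSpace ℝ ι)
    (v : Fin n → EuclideanSpace ℝ ι), (∀ i, ‖u i‖ ≤ 1) ∧ (∀ j, ‖v j‖ ≤ 1) ∧
      r = ∑ i, ∑ j, M i j * ⟪u i, v j⟫_ℝ}

lemma bddAbove_gramValues : BddAbove (gramValues M) := by
  refine ⟨∑ i, ∑ j, |M i j|, ?_⟩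
  rintro r ⟨ι, _, u, v, hu, hv, rfl⟩
  refine Finset.sum_le_sum fun i _ => Finset.sum_le_sum fun j _ => ?_
  refine (le_abs_self _).trans ?_
  rw [abs_mul]
  refine mul_le_of_le_one_right (abs_nonneg _) ?_
  exact (abs_real_inner_le_norm _ _).trans (mul_le_one₀ (hu i) (norm_nonneg _) (hv j))

/-- Homogeneity. It feeds the short vectors left over by the truncation back into the supremum. -/
lemma sum_inner_le_sSup {ι : Type} [Fintype ι] {α β : ℝ} (hα : 0 < α) (hβ : 0 < β)
    (u : Fin m → EuclideanSpace ℝ ι) (v : Fin n → EuclideanSpace ℝ ι)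
    (hu : ∀ i, ‖u i‖ ≤ α) (hv : ∀ j, ‖v j‖ ≤ β) :
    ∑ i, ∑ j, M i j * ⟪u i, v j⟫_ℝ ≤ α * β * sSup (gramValues M) := by
  have hmem : ∑ i, ∑ j, M i j * ⟪α⁻¹ • u i, β⁻¹ • v j⟫_ℝ ∈ gramValues M := by
    refine ⟨ι, inferInstance, fun i => α⁻¹ • u i, fun j => β⁻¹ • v j, fun i => ?_, fun j => ?_, rfl⟩
    · rw [norm_smul, Real.norm_of_nonneg (by positivity)]
      exact (inv_mul_le_iff₀ hα).2 (by simpa using hu i)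
    · rw [norm_smul, Real.norm_of_nonneg (by positivity)]
      exact (inv_mul_le_iff₀ hβ).2 (by simpa using hv j)
  have h := le_csSup bddAbove_gramValues hmem
  have e : ∑ i, ∑ j, M i j * ⟪α⁻¹ • u i, β⁻¹ • v j⟫_ℝ =
      α⁻¹ * β⁻¹ * ∑ i, ∑ j, M i j * ⟪u i, v j⟫_ℝ := by
    simp_rw [Finset.mul_sum, real_inner_smul_left, real_inner_smul_right]
    exact Finset.sum_congr rfl fun i _ => Finset.sum_congr rfl fun j _ => by ring
  rw [e] at h
  calc _ = α * β * (α⁻¹ * β⁻¹ * ∑ i, ∑ j, M i j * ⟪u i, v j⟫_ℝ) := by field_simp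
    _ ≤ _ := by gcongr

/-- Truncation of a Rademacher sum at height `7`. -/
def truncRademacher {d : ℕ} (u : Fin d → ℝ) (ω : Fin d → Bool) : ℝ :=
  if |rademacher u ω| ≤ 7 then rademacher u ω else 0

lemma abs_truncRademacher_le {d : ℕ} (u : Fin d → ℝ) (ω : Fin d → Bool) :
    |truncRademacher u ω| ≤ 7 := by
  unfold truncRademacher; split_ifs with h
  · exact h
  · simp

lemma truncRademacher_sq_le {d : ℕ} (u : Fin d → ℝ) (ω : Fin d → Bool) :
    truncRademacher u ω ^ 2 ≤ rademacher u ω ^ 2 := by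
  unfold truncRademacher; split_ifs with h
  · exact le_rfl
  · simpa using sq_nonneg _

/-- This decides the height 7: with fourth moment at most 3, the remainder has mean square at most
`3 / 49 ≤ 1 / 16`. -/
lemma rademacher_sub_trunc_sq_le {d : ℕ} (u : Fin d → ℝ) (ω : Fin d → Bool) :
    (rademacher u ω - truncRademacher u ω) ^ 2 ≤ rademacher u ω ^ 4 / 49 := by
  unfold truncRademacher; split_ifs with h
  · simp; positivity
  · rw [sub_zero]
    have h1 : (49 : ℝ) ≤ rademacher u ω ^ 2 := by
      rw [← sq_abs]; nlinarith [not_le.1 h]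
    nlinarith [sq_nonneg (rademacher u ω)]

lemma norm_toLp_le {ι : Type*} [Fintype ι] (f : ι → ℝ) {c : ℝ} (hc : 0 ≤ c)
    (h : ∑ i, f i ^ 2 ≤ c ^ 2) : ‖(WithLp.toLp 2 f : EuclideanSpace ℝ ι)‖ ≤ c := by
  rw [EuclideanSpace.norm_eq]
  refine Real.sqrt_le_iff.2 ⟨hc, ?_⟩
  simpa using h

/-- The mean of the product of the Rademacher sums `X`, `Y` of `u i`, `v j` is `⟪u i, v j⟫`. With
truncations `T`, `T'`, write `X Y = T T' + (X - T) Y + T (Y - T')`. The first term is at most `7 ^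
2` pointwise by sign-boundedness; in each of the others one factor has norm at most `1 / 4`, so each
costs a quarter of the supremum. -/
lemma gramValues_le (h : SignBounded M) {d : ℕ} (u : Fin m → EuclideanSpace ℝ (Fin d))
    (v : Fin n → EuclideanSpace ℝ (Fin d)) (hu : ∀ i, ‖u i‖ ≤ 1) (hv : ∀ j, ‖v j‖ ≤ 1) :
    ∑ i, ∑ j, M i j * ⟪u i, v j⟫_ℝ ≤ 49 + sSup (gramValues M) / 2 := by
  set Γ := sSup (gramValues M)
  -- Functions on the cube carry the unnormalized `ℓ²` norm, so `c` plays the role of 1.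
  set c : ℝ := Real.sqrt (2 ^ d) with hcdef
  have hc : 0 < c := by positivity
  have hc2 : c ^ 2 = 2 ^ d := Real.sq_sqrt (by positivity)
  let V : (( Fin d → Bool) → ℝ) → EuclideanSpace ℝ (Fin d → Bool) := fun f => WithLp.toLp 2 f
  have hV : ∀ f g : (Fin d → Bool) → ℝ, ⟪V f, V g⟫_ℝ = ∑ ω, f ω * g ω := by
    intro f g; simp [V, PiLp.inner_apply, mul_comm]
  have hsq : ∀ w : EuclideanSpace ℝ (Fin d), ‖w‖ ≤ 1 → ∑ i, w i ^ 2 ≤ 1 := by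
    intro w hw
    have := EuclideanSpace.real_norm_sq_eq w
    rw [← this]; exact pow_le_one₀ (norm_nonneg _) hw
  have hX : ∀ w : EuclideanSpace ℝ (Fin d), ‖w‖ ≤ 1 → ∑ ω, rademacher w ω ^ 2 ≤ c ^ 2 := by
    intro w hw
    simp only [pow_two]
    rw [sum_rademacher_mul, ← pow_two, hc2]
    refine mul_le_of_le_one_right (by positivity) ?_
    simpa [pow_two] using hsq w hw
  have nX : ∀ w : EuclideanSpace ℝ (Fin d), ‖w‖ ≤ 1 → ‖V (rademacher w)‖ ≤ c :=
    fun w hw => norm_toLp_le _ hc.le (hX w hw)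
  have nT : ∀ w : EuclideanSpace ℝ (Fin d), ‖w‖ ≤ 1 → ‖V (truncRademacher w)‖ ≤ c := by
    intro w hw
    exact norm_toLp_le _ hc.le ((Finset.sum_le_sum fun ω _ => truncRademacher_sq_le _ _).trans (hX w hw))
  have nR : ∀ w : EuclideanSpace ℝ (Fin d), ‖w‖ ≤ 1 →
      ‖V (fun ω => rademacher w ω - truncRademacher w ω)‖ ≤ c / 4 := by
    intro w hw
    refine norm_toLp_le _ (by positivity) ?_
    refine (Finset.sum_le_sum fun ω _ => rademacher_sub_trunc_sq_le _ _).trans ?_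
    rw [← Finset.sum_div, div_pow, hc2]
    have h4 := sum_rademacher_pow_four (w : Fin d → ℝ)
    have h5 : (∑ i, w i ^ 2) ^ 2 ≤ 1 := pow_le_one₀ (by positivity) (hsq w hw)
    have h6 : (2 : ℝ) ^ d * (3 * (∑ i, w i ^ 2) ^ 2) ≤ 2 ^ d * 3 := by
      gcongr; linarith
    rw [div_le_div_iff₀ (by norm_num) (by norm_num)]
    have : (0:ℝ) < 2 ^ d := by positivity
    linarith
  have key : (2 : ℝ) ^ d * ∑ i, ∑ j, M i j * ⟪u i, v j⟫_ℝ =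
      (∑ ω, ∑ i, ∑ j, M i j * (truncRademacher (u i) ω * truncRademacher (v j) ω)) +
      (∑ i, ∑ j, M i j * ⟪V (fun ω => rademacher (u i) ω - truncRademacher (u i) ω),
        V (rademacher (v j))⟫_ℝ) +
      ∑ i, ∑ j, M i j * ⟪V (truncRademacher (u i)),
        V (fun ω => rademacher (v j) ω - truncRademacher (v j) ω)⟫_ℝ := by
    have hcomm : (∑ ω : Fin d → Bool,
        ∑ i, ∑ j, M i j * (truncRademacher (u i) ω * truncRademacher (v j) ω)) =
        ∑ i, ∑ j, ∑ ω, M i j * (truncRademacher (u i) ω * truncRademacher (v j) ω) := by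
      rw [Finset.sum_comm]
      exact Finset.sum_congr rfl fun i _ => Finset.sum_comm
    rw [hcomm, Finset.mul_sum, ← Finset.sum_add_distrib, ← Finset.sum_add_distrib]
    refine Finset.sum_congr rfl fun i _ => ?_
    rw [Finset.mul_sum, ← Finset.sum_add_distrib, ← Finset.sum_add_distrib]
    refine Finset.sum_congr rfl fun j _ => ?_
    have : (2:ℝ) ^ d * ⟪u i, v j⟫_ℝ = ∑ ω, rademacher (u i) ω * rademacher (v j) ω := by
      rw [sum_rademacher_mul]; simp [PiLp.inner_apply, mul_comm]
    rw [mul_left_comm, this, hV, hV, ← Finset.mul_sum, ← mul_add, ← mul_add,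
      ← Finset.sum_add_distrib, ← Finset.sum_add_distrib]
    congr 1
    exact Finset.sum_congr rfl fun ω _ => by ring
  have b1 : (∑ ω : Fin d → Bool, ∑ i, ∑ j, M i j * (truncRademacher (u i) ω * truncRademacher (v j) ω))
      ≤ 2 ^ d * 49 := by
    have : ∀ ω ∈ (Finset.univ : Finset (Fin d → Bool)),
        ∑ i, ∑ j, M i j * (truncRademacher (u i) ω * truncRademacher (v j) ω) ≤ 49 := by
      intro ω _
      refine (le_abs_self _).trans ((h.abs_sum_le (by norm_num : (0:ℝ) ≤ 7) _ _
        (fun i => abs_truncRademacher_le _ _) (fun j => abs_truncRademacher_le _ _)).trans ?_)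
      norm_num
    refine (Finset.sum_le_card_nsmul _ _ _ this).trans ?_
    simp
  have b2 := sum_inner_le_sSup (M := M) (by positivity : 0 < c / 4) hc _ _
    (fun i => nR (u i) (hu i)) (fun j => nX (v j) (hv j))
  have b3 := sum_inner_le_sSup (M := M) hc (by positivity : 0 < c / 4) _ _
    (fun i => nT (u i) (hu i)) (fun j => nR (v j) (hv j))
  have e : c / 4 * c * Γ + c * (c / 4) * Γ = 2 ^ d * (Γ / 2) := by rw [← hc2]; ring
  refine le_of_mul_le_mul_left (?_ : (2 : ℝ) ^ d * _ ≤ 2 ^ d * _) (by positivity)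
  rw [key, mul_add]
  linarith

/-- The supremum `Γ` is finite, so `Γ ≤ 49 + Γ / 2` can be solved for `Γ`. -/
lemma sSup_gramValues_le (h : SignBounded M) : sSup (gramValues M) ≤ 98 := by
  have : sSup (gramValues M) ≤ 49 + sSup (gramValues M) / 2 := by
    refine csSup_le ⟨0, Empty, inferInstance, fun _ => 0, fun _ => 0, by simp, by simp, by simp⟩ ?_
    rintro r ⟨ι, _, u, v, hu, hv, rfl⟩
    let e := LinearIsometryEquiv.piLpCongrLeft 2 ℝ ℝ (Fintype.equivFin ι)
    have := gramValues_le h (fun i => e (u i)) (fun j => e (v j)) (by simpa using hu)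
      (by simpa using hv)
    simpa using this
  linarith

/-- The set whose infimum is Grothendieck's constant. -/
def grothendieckSet : Set ℝ :=
  {K : ℝ | ∀ (m n : ℕ) (M : Matrix (Fin m) (Fin n) ℝ),
    (∀ (s : Fin m → ℤˣ) (t : Fin n → ℤˣ),
      |∑ i, ∑ j, M i j * (((s i * t j : ℤˣ) : ℤ) : ℝ)| ≤ 1) →
    ∀ (d : ℕ) (u : Fin m → EuclideanSpace ℝ (Fin d)) (v : Fin n → EuclideanSpace ℝ (Fin d)),
      (∀ i, ‖u i‖ = 1) → (∀ j, ‖v j‖ = 1) →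
      |∑ i, ∑ j, M i j * ⟪u i, v j⟫_ℝ| ≤ K}

/-- Shows that the infimum is not taken over the empty set. The lower estimate comes from replacing
`u` by `-u`. -/
lemma mem_grothendieckSet : (98 : ℝ) ∈ grothendieckSet := by
  intro m n M h d u v hu hv
  have h1 := sum_inner_le_sSup (M := M) one_pos one_pos u v (fun i => (hu i).le) (fun i => (hv i).le)
  have h2 := sum_inner_le_sSup (M := M) one_pos one_pos (fun i => - u i) v
    (fun i => by simp [hu i]) (fun i => (hv i).le)
  have h3 := sSup_gramValues_le (M := M) h
  simp only [inner_neg_left, mul_neg, Finset.sum_neg_distrib] at h2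
  rw [abs_le]; constructor <;> linarith

lemma one_le_of_mem_grothendieckSet {K : ℝ} (hK : K ∈ grothendieckSet) : 1 ≤ K := by
  have := hK 1 1 (fun _ _ => 1) (fun s t => by
      rcases Int.units_eq_one_or (s 0) with h | h <;> rcases Int.units_eq_one_or (t 0) with h' | h' <;>
      simp [h, h']) 1
    (fun _ => EuclideanSpace.single 0 1) (fun _ => EuclideanSpace.single 0 1) (by simp) (by simp)
  simpa using this

lemma one_le_grothendieckConstant : 1 ≤ grothendieckConstant :=
  le_csInf ⟨98, mem_grothendieckSet⟩ fun _ => one_le_of_mem_grothendieckSet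

/-- The infimum is a minimum, because each value of the form is a lower bound of the set. -/
lemma grothendieckConstant_mem : grothendieckConstant ∈ grothendieckSet := by
  intro m n M h d u v hu hv
  exact le_csInf ⟨98, mem_grothendieckSet⟩ fun K hK => hK m n M h d u v hu hv

end Grothendieck

end NonSignaling

end

noncomputable section

open scoped InnerProductSpace

namespace NonSignaling

/-! ### Rounding vectors to signs -/

section Rounding

variable {X Y V : Type*} [NormedAddCommGroup V] [InnerProductSpace ℝ V]

/-- Vectors of norm at most one become unit vectors after adding two dimensions, without changing
the inner products between the two families. -/
lemma exists_unit_extension (u : X → V) (v : Y → V) (hu : ∀ x, ‖u x‖ ≤ 1) (hv : ∀ y, ‖v y‖ ≤ 1) :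
    ∃ (u' : X → WithLp 2 (V × WithLp 2 (ℝ × ℝ))) (v' : Y → WithLp 2 (V × WithLp 2 (ℝ × ℝ))),
      (∀ x, ‖u' x‖ = 1) ∧ (∀ y, ‖v' y‖ = 1) ∧ ∀ x y, ⟪u' x, v' y⟫_ℝ = ⟪u x, v y⟫_ℝ := by
  have sq : ∀ w : V, ‖w‖ ≤ 1 → √(1 - ‖w‖ ^ 2) ^ 2 = 1 - ‖w‖ ^ 2 := fun w hw =>
    Real.sq_sqrt (sub_nonneg.2 (pow_le_one₀ (norm_nonneg _) hw))
  refine ⟨fun x => WithLp.toLp 2 (u x, WithLp.toLp 2 (√(1 - ‖u x‖ ^ 2), 0)),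
    fun y => WithLp.toLp 2 (v y, WithLp.toLp 2 (0, √(1 - ‖v y‖ ^ 2))), fun x => ?_, fun y => ?_,
    fun x y => ?_⟩
  · rw [← sq_eq_sq₀ (norm_nonneg _) zero_le_one, WithLp.prod_norm_sq_eq_of_L2]
    simp [sq _ (hu x)]
  · rw [← sq_eq_sq₀ (norm_nonneg _) zero_le_one, WithLp.prod_norm_sq_eq_of_L2]
    simp [sq _ (hv y)]
  · simp [WithLp.prod_inner_apply]

variable [Fintype X] [Fintype Y]

/-- The constant is defined through unit vectors of coordinate spaces. Padding makes the norms equal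
to 1, and only the finite-dimensional span of the vectors matters, which has orthonormal
coordinates. -/
lemma SignBounded.abs_sum_inner_le {M : X → Y → ℝ} (h : SignBounded M) (u : X → V) (v : Y → V)
    (hu : ∀ x, ‖u x‖ ≤ 1) (hv : ∀ y, ‖v y‖ ≤ 1) :
    |∑ x, ∑ y, M x y * ⟪u x, v y⟫_ℝ| ≤ grothendieckConstant := by
  obtain ⟨u', v', hu', hv', huv⟩ := exists_unit_extension u v hu hv
  let W := Submodule.span ℝ (Set.range u' ∪ Set.range v')
  have : FiniteDimensional ℝ W :=
    FiniteDimensional.span_of_finite ℝ ((Set.finite_range _).union (Set.finite_range _))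
  let e := (stdOrthonormalBasis ℝ W).repr
  let a : X → W := fun x => ⟨u' x, Submodule.subset_span (Or.inl ⟨x, rfl⟩)⟩
  let b : Y → W := fun y => ⟨v' y, Submodule.subset_span (Or.inr ⟨y, rfl⟩)⟩
  let eX := Fintype.equivFin X
  let eY := Fintype.equivFin Y
  have key := grothendieckConstant_mem (Fintype.card X) (Fintype.card Y)
    (fun i j => M (eX.symm i) (eY.symm j)) (fun s t => by
      have := h (fun x => s (eX x)) (fun y => t (eY y))
      rw [← eX.symm.sum_comp] at this
      simp_rw [← eY.symm.sum_comp (fun y => M _ y * _)] at this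
      simpa using this)
    _ (fun i => e (a (eX.symm i))) (fun j => e (b (eY.symm j)))
    (fun i => by rw [LinearIsometryEquiv.norm_map]; exact hu' _)
    (fun j => by rw [LinearIsometryEquiv.norm_map]; exact hv' _)
  have e1 : ∀ x y, ⟪e (a x), e (b y)⟫_ℝ = ⟪u x, v y⟫_ℝ := fun x y => by
    rw [LinearIsometryEquiv.inner_map_map, ← huv]; rfl
  simp only [e1] at key
  rw [← eX.symm.sum_comp]
  simp_rw [← eY.symm.sum_comp (fun y => M _ y * _)]
  exact key

/-- Grothendieck's inequality, dually: the Gram matrix of two families of vectors is a multiple of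
a convex combination of rank-one sign matrices. -/
theorem exists_coin_of_inner (u : X → V) (v : Y → V) {G : ℝ} (hG : 0 < G)
    (hu : ∀ x, ‖u x‖ ^ 2 ≤ G) (hv : ∀ y, ‖v y‖ ^ 2 ≤ G) :
    ∃ (Ω : Type) (_ : Fintype Ω) (coin : Ω → ℝ) (s : X → Ω → Bool) (t : Y → Ω → Bool),
      coin ∈ stdSimplex ℝ Ω ∧ ∀ x y, ∑ ω, coin ω * (bsgn (s x ω) * bsgn (t y ω)) =
        ⟪u x, v y⟫_ℝ / (grothendieckConstant * G) := by
  have hK : 0 < grothendieckConstant := zero_lt_one.trans_le one_le_grothendieckConstant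
  let S : Set (X × Y → ℝ) := Set.range fun (st : (X → Bool) × (Y → Bool)) =>
    fun xy : X × Y => bsgn (st.1 xy.1) * bsgn (st.2 xy.2)
  let c : X × Y → ℝ := fun xy => ⟪u xy.1, v xy.2⟫_ℝ / (grothendieckConstant * G)
  have hc : c ∈ convexHull ℝ S := by
    by_contra hc
    -- A functional separating `c` from the hull of the sign matrices is a counterexample to
    -- Grothendieck's inequality. The hull is symmetric, as `s` may be negated, so `f / r` is
    -- sign-bounded.
    obtain ⟨f, r, hf, hr⟩ 
      := geometric_hahn_banach_closed_point (convex_convexHull ℝ S)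
      ((Set.finite_range _).isClosed_convexHull ℝ) hc
    have hfS : ∀ (s : X → Bool) (t : Y → Bool), f (fun xy : X × Y => bsgn (s xy.1) * bsgn (t xy.2)) < r := fun s t =>
      hf _ (subset_convexHull ℝ S ⟨(s, t), rfl⟩)
    have hneg : ∀ (s : X → Bool) (t : Y → Bool), - f (fun xy : X × Y => bsgn (s xy.1) * bsgn (t xy.2)) < r := fun s t => by
      have := hfS (fun x => !(s x)) t
      rw [← map_neg]
      convert this using 2
      ext xy; simp [bsgn_not]
    have hr0 : 0 < r := by
      linarith [hfS (fun _ => true) (fun _ => true), hneg (fun _ => true) (fun _ => true)]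
    classical
    let M : X → Y → ℝ := fun x y => f (Pi.single (x, y) 1)
    have hM : ∀ g : X × Y → ℝ, f g = ∑ x, ∑ y, M x y * g (x, y) := by
      intro g
      rw [← Fintype.sum_prod_type' (f := fun x y => M x y * g (x, y))]
      conv_lhs => rw [← Finset.univ_sum_single g, map_sum]
      refine Finset.sum_congr rfl fun xy _ => ?_
      have : (Pi.single xy (g xy) : X × Y → ℝ) = g xy • Pi.single xy 1 := by
        rw [← Pi.single_smul]; simp
      rw [this, map_smul, smul_eq_mul, mul_comm]
    have hB : SignBounded fun x y => M x y / r := by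
      intro s t
      have h1 := hfS (fun x => decide (s x = -1)) (fun y => decide (t y = -1))
      have h2 := hneg (fun x => decide (s x = -1)) (fun y => decide (t y = -1))
      have hs : ∀ z : ℤˣ, bsgn (decide (z = -1)) = ((z : ℤ) : ℝ) := by
        intro z; rcases Int.units_eq_one_or z with h | h <;> subst h <;> simp [bsgn]
      have e : ∑ x, ∑ y, M x y / r * (((s x * t y : ℤˣ) : ℤ) : ℝ) =
          f (fun xy : X × Y => bsgn (decide (s xy.1 = -1)) * bsgn (decide (t xy.2 = -1))) / r := by
        rw [hM, Finset.sum_div]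
        refine Finset.sum_congr rfl fun x _ => ?_
        rw [Finset.sum_div]
        refine Finset.sum_congr rfl fun y _ => ?_
        simp only [hs]; push_cast; ring
      rw [e, abs_div, abs_of_pos hr0, div_le_one hr0, abs_le]
      constructor <;> linarith
    have hsG : 0 < √G := Real.sqrt_pos.2 hG
    have hnorm : ∀ w : V, ‖w‖ ^ 2 ≤ G → ‖(√G)⁻¹ • w‖ ≤ 1 := by
      intro w hw
      rw [norm_smul, Real.norm_of_nonneg (by positivity), inv_mul_le_iff₀ hsG, mul_one]
      exact Real.le_sqrt_of_sq_le hw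
    have h3 := (le_abs_self _).trans (hB.abs_sum_inner_le (fun x => (√G)⁻¹ • u x)
      (fun y => (√G)⁻¹ • v y) (fun x => hnorm _ (hu x)) (fun y => hnorm _ (hv y)))
    have e : ∑ x, ∑ y, M x y / r * ⟪(√G)⁻¹ • u x, (√G)⁻¹ • v y⟫_ℝ =
        grothendieckConstant * (f c / r) := by
      rw [hM, Finset.sum_div, Finset.mul_sum]
      refine Finset.sum_congr rfl fun x _ => ?_
      rw [Finset.sum_div, Finset.mul_sum]
      refine Finset.sum_congr rfl fun y _ => ?_
      rw [real_inner_smul_left, real_inner_smul_right, ← mul_assoc (√G)⁻¹, ← mul_inv,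
        Real.mul_self_sqrt hG.le]
      simp only [c]
      field_simp
    rw [e] at h3
    -- Separation gives `f c > r`, while `h3` says that `K_G * (f c / r) ≤ K_G`.
    have h4 : 1 < f c / r := (one_lt_div hr0).2 hr
    nlinarith
  obtain ⟨Ω, _, coin, z, h0, h1, hz, hsum⟩ := mem_convexHull_iff_exists_fintype.1 hc
  choose st hst using hz
  refine ⟨Ω, inferInstance, coin, fun x ω => (st ω).1 x, fun y ω => (st ω).2 y, ⟨h0, h1⟩,
    fun x y => ?_⟩
  have := congrFun hsum (x, y)
  simp only [Finset.sum_apply, Pi.smul_apply, smul_eq_mul, c] at this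
  rw [← this]
  exact Finset.sum_congr rfl fun ω _ => by rw [← hst ω]

end Rounding

end NonSignaling

end

noncomputable section

open scoped InnerProductSpace

namespace NonSignaling

/-! ### Operators on the shared Hilbert space and the message qubits -/

section QubitOp

variable {H : Type w} [NormedAddCommGroup H] [InnerProductSpace ℂ H] {q : ℕ}

/-- The action of an operator on `H ⊗ (ℂ²)^{⊗ q}`. -/
def act (M : QubitOp H q) (Φ : (Fin q → Bool) → H) : (Fin q → Bool) → H :=
  fun s => ∑ t, M s t (Φ t)

lemma act_mul (M N : QubitOp H q) (Φ : (Fin q → Bool) → H) :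
    act (M * N) Φ = act M (act N Φ) := by
  ext s
  simp only [act, Matrix.mul_apply, sum_apply, map_sum, mul_apply_eq_comp]
  exact Finset.sum_comm

lemma act_one (Φ : (Fin q → Bool) → H) : act (1 : QubitOp H q) Φ = Φ := by
  ext s
  simp only [act]
  rw [Finset.sum_eq_single s (fun t _ ht => by simp [Matrix.one_apply_ne' ht]) (by simp)]
  simp

/-- The quadratic form of an operator. -/
def quad (M : QubitOp H q) (Φ : (Fin q → Bool) → H) : ℝ :=
  (∑ s, ⟪Φ s, act M Φ s⟫_ℂ).re

lemma quad_add (M N : QubitOp H q) (Φ : (Fin q → Bool) → H) :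
    quad (M + N) Φ = quad M Φ + quad N Φ := by
  simp [quad, act, Finset.sum_add_distrib]

/-- The quadratic form, as an additive map in the operator. -/
def quadHom (Φ : (Fin q → Bool) → H) : QubitOp H q →+ ℝ :=
  AddMonoidHom.mk' (fun M => quad M Φ) fun M N => quad_add M N Φ

lemma quad_sum {K : Type*} (s : Finset K) (M : K → QubitOp H q) (Φ : (Fin q → Bool) → H) :
    quad (∑ k ∈ s, M k) Φ = ∑ k ∈ s, quad (M k) Φ :=
  map_sum (quadHom Φ) M s

lemma quad_one (Φ : (Fin q → Bool) → H) : quad 1 Φ = ∑ s, ‖Φ s‖ ^ 2 := by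
  simp only [quad, act_one, Complex.re_sum]
  refine Finset.sum_congr rfl fun s _ => ?_
  exact inner_self_eq_norm_sq (𝕜 := ℂ) _

lemma quad_one_nonneg (Φ : (Fin q → Bool) → H) : 0 ≤ quad 1 Φ := by
  rw [quad_one]; positivity

variable [CompleteSpace H]

lemma sum_inner_act (M : QubitOp H q) (Φ Ψ : (Fin q → Bool) → H) :
    ∑ s, ⟪Φ s, act (star M) Ψ s⟫_ℂ = ∑ s, ⟪act M Φ s, Ψ s⟫_ℂ := by
  simp only [act, inner_sum, sum_inner]
  rw [Finset.sum_comm]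
  refine Finset.sum_congr rfl fun s _ => Finset.sum_congr rfl fun t _ => ?_
  rw [Matrix.star_apply, ContinuousLinearMap.star_eq_adjoint,
    ContinuousLinearMap.adjoint_inner_right]

lemma quad_star_mul (M N : QubitOp H q) (Φ : (Fin q → Bool) → H) :
    quad (star M * N) Φ = (∑ s, ⟪act M Φ s, act N Φ s⟫_ℂ).re := by
  rw [quad, act_mul, sum_inner_act]

lemma quad_conj (M N : QubitOp H q) (Φ : (Fin q → Bool) → H) :
    quad (star N * M * N) Φ = quad M (act N Φ) := by
  rw [mul_assoc, quad_star_mul, act_mul]; rfl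

/-- The family `F` of operators satisfies `∑ Fₖ* Fₖ ≤ β`. -/
def RowBounded {K : Type*} [Fintype K] (β : ℝ) (F : K → QubitOp H q) : Prop :=
  ∀ Φ, quad (∑ k, star (F k) * F k) Φ ≤ β * quad 1 Φ

lemma RowBounded.conj {K : Type*} [Fintype K] {β : ℝ} {F : K → QubitOp H q} (h : RowBounded β F)
    {U : QubitOp H q} (hU : U ∈ unitary (QubitOp H q)) :
    RowBounded β fun k => star U * F k * U := by
  intro Φ
  have e : ∑ k, star (star U * F k * U) * (star U * F k * U) =
      star U * (∑ k, star (F k) * F k) * U := by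
    rw [Finset.mul_sum, Finset.sum_mul]
    refine Finset.sum_congr rfl fun k _ => ?_
    have : U * star U = 1 := hU.2
    calc _ = star U * star (F k) * (U * star U) * F k * U := by simp only [star_mul, star_star]; noncomm_ring
      _ = _ := by rw [this]; noncomm_ring
  have e1 : star U * 1 * U = 1 := by rw [mul_one]; exact hU.1
  rw [e, quad_conj]
  refine (h _).trans_eq ?_
  rw [← quad_conj, e1]

/-! ### Matrix units of a qubit -/

/-- The matrix unit `|b⟩⟨c|` on the `i`-th qubit. -/
def matUnit (i : Fin q) (b c : Bool) : QubitOp H q :=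
  Matrix.of fun s t => if s i = b ∧ t = Function.update s i c then 1 else 0

omit [CompleteSpace H] in
lemma mul_matUnit_apply (M : QubitOp H q) (i : Fin q) (b c : Bool) (s t : Fin q → Bool) :
    (M * matUnit i b c : QubitOp H q) s t = if t i = c then M s (Function.update t i b) else 0 := by
  have key : ∀ r, (r i = b ∧ t = Function.update r i c) ↔ (t i = c ∧ r = Function.update t i b) := by
    intro r
    constructor <;> rintro ⟨rfl, rfl⟩ <;> simp
  simp only [Matrix.mul_apply, matUnit, Matrix.of_apply, key]
  by_cases h : t i = c <;> simp [h]

omit [CompleteSpace H] in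
lemma matUnit_mul_apply (M : QubitOp H q) (i : Fin q) (b c : Bool) (s t : Fin q → Bool) :
    (matUnit i b c * M : QubitOp H q) s t = if s i = b then M (Function.update s i c) t else 0 := by
  simp only [Matrix.mul_apply, matUnit, Matrix.of_apply]
  by_cases h : s i = b <;> simp [h]

lemma star_matUnit (i : Fin q) (b c : Bool) :
    star (matUnit i b c : QubitOp H q) = matUnit i c b := by
  ext1 s t
  have key : (t i = b ∧ s = Function.update t i c) ↔ (s i = c ∧ t = Function.update s i b) := by
    constructor <;> rintro ⟨rfl, rfl⟩ <;> simp
  simp only [Matrix.star_apply, matUnit, Matrix.of_apply, key]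
  split_ifs <;> simp

omit [CompleteSpace H] in
lemma matUnit_mul_matUnit (i : Fin q) (b c c' d : Bool) :
    (matUnit i b c * matUnit i c' d : QubitOp H q) = if c = c' then matUnit i b d else 0 := by
  ext1 s t
  rw [matUnit_mul_apply]
  by_cases h : s i = b <;> by_cases h' : c = c' <;> simp [matUnit, h, h']

omit [CompleteSpace H] in
lemma sum_matUnit_self (i : Fin q) : ∑ b, (matUnit i b b : QubitOp H q) = 1 := by
  ext1 s t
  rw [Fintype.sum_bool]
  by_cases h : s = t
  · subst h
    cases h' : s i <;> simp [matUnit, h', Function.eq_update_self_iff]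
  · have h' : ∀ b, ¬ (s i = b ∧ t = Function.update s i b) := by
      rintro b ⟨rfl, rfl⟩; simp at h
    simp [matUnit, h', Matrix.one_apply_ne h]

omit [CompleteSpace H] in
lemma commute_matUnit {i j : Fin q} (hij : i ≠ j) (b c b' c' : Bool) :
    Commute (matUnit i b c : QubitOp H q) (matUnit j b' c') := by
  ext1 s t
  rw [matUnit_mul_apply, mul_matUnit_apply]
  simp only [matUnit, Matrix.of_apply, Function.update_of_ne hij.symm]
  have key : (s i = b ∧ s j = b' ∧ t = Function.update (Function.update s i c) j c') ↔
      (t i = c ∧ s j = b' ∧ Function.update t i b = Function.update s j c') := by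
    constructor
    · rintro ⟨rfl, rfl, rfl⟩
      refine ⟨by simp [hij], rfl, ?_⟩
      rw [Function.update_comm hij]
      simp [hij]
    · rintro ⟨rfl, rfl, h⟩
      have hi := congrFun h i
      simp only [Function.update_self, Function.update_of_ne hij] at hi
      refine ⟨hi.symm, rfl, ?_⟩
      rw [Function.update_comm hij, ← h]
      simp
  rw [← ite_and, ← ite_and]
  exact if_congr key rfl rfl

/-! ### Local operators -/

/-- A form of locality that is manifestly stable under products: the entries lie in the algebra
and the operator commutes with the matrix units of the qubits outside `S`. -/
structure Loc (𝓐 : StarSubalgebra ℂ (H →L[ℂ] H)) (S : Set (Fin q)) (M : QubitOp H q) : Prop where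
  entry : ∀ s t, M s t ∈ 𝓐
  comm : ∀ i ∉ S, ∀ b c, Commute M (matUnit i b c)

variable {𝓐 𝓑 : StarSubalgebra ℂ (H →L[ℂ] H)} {S S' : Set (Fin q)} {M N : QubitOp H q}

/-- Only this implication is needed: protocols supply `IsLocalOp`, and all further operators are
built inside `Loc`. -/
lemma IsLocalOp.loc (h : IsLocalOp 𝓐 S M) : Loc 𝓐 S M := by
  obtain ⟨N, hN, hM⟩ := h
  refine ⟨fun s t => ?_, fun i hi b c => ?_⟩
  · rw [hM]; split_ifs
    · exact hN _ _
    · exact zero_mem _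
  · have hres : ∀ (s : Fin q → Bool) (b : Bool),
        (fun j : S => Function.update s i b j) = fun j : S => s j := by
      intro s b; ext j
      exact Function.update_of_ne (fun h : (j : Fin q) = i => hi (h ▸ j.2)) _ _
    ext1 s t
    rw [mul_matUnit_apply, matUnit_mul_apply, hM, hM, hres, hres]
    have key : (t i = c ∧ ∀ j ∉ S, s j = Function.update t i b j) ↔
        (s i = b ∧ ∀ j ∉ S, Function.update s i c j = t j) := by
      constructor
      · rintro ⟨rfl, h⟩
        refine ⟨by simpa using h i hi, fun j hj => ?_⟩
        by_cases hji : j = i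
        · subst hji; simp
        · simpa [hji] using h j hj
      · rintro ⟨rfl, h⟩
        refine ⟨by simpa using (h i hi).symm, fun j hj => ?_⟩
        by_cases hji : j = i
        · subst hji; simp
        · simpa [hji] using h j hj
    classical
    rw [← ite_and, ← ite_and]
    exact if_congr key rfl rfl

omit [CompleteSpace H] in
lemma sum_apply_qubitOp {K : Type*} (s : Finset K) (F : K → QubitOp H q) (a b : Fin q → Bool) :
    (∑ k ∈ s, F k) a b = ∑ k ∈ s, F k a b := Matrix.sum_apply a b s F

namespace Loc

lemma mul (hM : Loc 𝓐 S M) (hN : Loc 𝓐 S N) : Loc 𝓐 S (M * N) where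
  entry s t := by
    rw [Matrix.mul_apply]
    exact sum_mem fun r _ => mul_mem (hM.entry _ _) (hN.entry _ _)
  comm i hi b c := (hM.comm i hi b c).mul_left (hN.comm i hi b c)

lemma star (hM : Loc 𝓐 S M) : Loc 𝓐 S (star M) where
  entry s t := by
    rw [Matrix.star_apply]
    exact star_mem (hM.entry _ _)
  comm i hi b c := by
    have := (hM.comm i hi c b).star_star
    rwa [star_matUnit] at this

lemma mono (hM : Loc 𝓐 S M) (hS : S ⊆ S') : Loc 𝓐 S' M :=
  ⟨hM.entry, fun i hi => hM.comm i fun h => hi (hS h)⟩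

lemma matUnit_entry (i : Fin q) (b c : Bool) (s t : Fin q → Bool) :
    (matUnit i b c : QubitOp H q) s t ∈ 𝓐 := by
  simp only [matUnit, Matrix.of_apply]
  split_ifs
  · exact one_mem _
  · exact zero_mem _

lemma matUnit {i : Fin q} (hi : i ∈ S) (b c : Bool) : Loc 𝓐 S (matUnit i b c : QubitOp H q) where
  entry := matUnit_entry i b c
  comm j hj _ _ := commute_matUnit (fun h : i = j => hj (h ▸ hi)) _ _ _ _

/-- Commuting with diagonal matrix units makes `M` block diagonal in qubit `i`; the off-diagonal
units, in `apply_update`, make the two blocks equal. -/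
lemma apply_eq_zero (hM : Loc 𝓐 S M) {s t : Fin q → Bool} {i : Fin q} (hi : i ∉ S)
    (hst : s i ≠ t i) : M s t = 0 := by
  have h := congrFun (congrFun (hM.comm i hi (t i) (t i)) s) t
  rw [mul_matUnit_apply, matUnit_mul_apply] at h
  simpa [hst] using h

lemma apply_update (hM : Loc 𝓐 S M) {s t : Fin q → Bool} {i : Fin q} (hi : i ∉ S)
    (hst : s i = t i) (c : Bool) : M (Function.update s i c) (Function.update t i c) = M s t := by
  have h := congrFun (congrFun (hM.comm i hi (s i) c) s) (Function.update t i c)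
  rw [mul_matUnit_apply, matUnit_mul_apply] at h
  simpa [hst] using h.symm

open Classical in
lemma apply_piecewise (hM : Loc 𝓐 S M) {s t : Fin q → Bool} (hst : ∀ i ∉ S, s i = t i)
    (c : Fin q → Bool) (T : Finset (Fin q)) (hT : ∀ i ∈ T, i ∉ S) :
    M (T.piecewise c s) (T.piecewise c t) = M s t := by
  induction T using Finset.induction_on with
  | empty => simp
  | insert i T hi ih =>
    rw [Finset.piecewise_insert, Finset.piecewise_insert,
      hM.apply_update (hT i (Finset.mem_insert_self _ _)),
      ih fun j hj => hT j (Finset.mem_insert_of_mem hj)]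
    simpa [hi] using hst i (hT i (Finset.mem_insert_self _ _))

/-- Local operators of the two players on complementary sets of qubits commute. -/
theorem commute (hM : Loc 𝓐 S M) (hN : Loc 𝓑 Sᶜ N) (hcomm : ∀ a ∈ 𝓐, ∀ b ∈ 𝓑, a * b = b * a) :
    M * N = N * M := by
  classical
  ext1 s t
  -- `M` does not change the qubits outside `S` and `N` those inside, so a single intermediate
  -- string survives in each product: `r` in `M * N` and `r'` in `N * M`.
  let r : Fin q → Bool := fun i => if i ∈ S then t i else s i
  let r' : Fin q → Bool := fun i => if i ∈ S then s i else t i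
  have h1 : (M * N) s t = M s r * N r t := by
    rw [Matrix.mul_apply, Finset.sum_eq_single r _ (by simp)]
    intro p _ hp
    by_contra hne
    apply hp
    ext i
    by_cases hi : i ∈ S
    · simp only [r, hi, if_true]
      by_contra h
      exact hne (by rw [hN.apply_eq_zero (i := i) (by simpa using hi) h, mul_zero])
    · simp only [r, hi, if_false]
      by_contra h
      exact hne (by rw [hM.apply_eq_zero (i := i) hi (Ne.symm h), zero_mul])
  have h2 : (N * M) s t = N s r' * M r' t := by
    rw [Matrix.mul_apply, Finset.sum_eq_single r' _ (by simp)]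
    intro p _ hp
    by_contra hne
    apply hp
    ext i
    by_cases hi : i ∈ S
    · simp only [r', hi, if_true]
      by_contra h
      exact hne (by rw [hN.apply_eq_zero (i := i) (by simpa using hi) (Ne.symm h), zero_mul])
    · simp only [r', hi, if_false]
      by_contra h
      exact hne (by rw [hM.apply_eq_zero (i := i) hi h, mul_zero])
  -- Both pairs have the same restrictions to `S` and agree outside `S`, where the common values are
  -- irrelevant.
  have h3 : M r' t = M s r := by
    rw [← hM.apply_piecewise (s := s) (t := r) (fun i hi => by simp [r, hi]) t
      (Finset.univ.filter (· ∉ S)) (by simp)]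
    congr 1 <;> ext i <;> by_cases hi : i ∈ S <;> simp [r, r', hi]
  have h4 : N s r' = N r t := by
    rw [← hN.apply_piecewise (s := r) (t := t) (fun i hi => by simp [r, by simpa using hi]) s
      (Finset.univ.filter (· ∈ S)) (by simp)]
    congr 1 <;> ext i <;> by_cases hi : i ∈ S <;> simp [r, r', hi]
  rw [h1, h2, h3, h4]
  exact hcomm _ (hM.entry _ _) _ (hN.entry _ _)

end Loc

/-! ### Splitting off one qubit -/

/-- The `(b, c)` block of an operator with respect to the `i`-th qubit. -/
def block (i : Fin q) (b c : Bool) (M : QubitOp H q) : QubitOp H q :=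
  ∑ r, matUnit i r b * M * matUnit i c r

omit [CompleteSpace H] in
-- Its right-hand side is also that of `block_mul_matUnit`: a block commutes with the matrix units
-- of qubit `i`, which is why `Loc.block` can drop that qubit.
lemma matUnit_mul_block (i : Fin q) (a b c d : Bool) (M : QubitOp H q) :
    matUnit i a d * block i b c M = matUnit i a b * M * matUnit i c d := by
  rw [block, Finset.mul_sum, Finset.sum_eq_single d]
  · rw [← mul_assoc, ← mul_assoc, matUnit_mul_matUnit, if_pos rfl]
  · intro r _ hr
    rw [← mul_assoc, ← mul_assoc, matUnit_mul_matUnit, if_neg hr.symm, zero_mul, zero_mul]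
  · simp

omit [CompleteSpace H] in
lemma block_mul_matUnit (i : Fin q) (a b c d : Bool) (M : QubitOp H q) :
    block i b c M * matUnit i a d = matUnit i a b * M * matUnit i c d := by
  rw [block, Finset.sum_mul, Finset.sum_eq_single a]
  · rw [mul_assoc, matUnit_mul_matUnit, if_pos rfl]
  · intro r _ hr
    rw [mul_assoc, matUnit_mul_matUnit, if_neg hr, mul_zero]
  · simp

lemma star_block (i : Fin q) (b c : Bool) (M : QubitOp H q) :
    star (block i b c M) = block i c b (star M) := by
  simp [block, star_matUnit, mul_assoc]

omit [CompleteSpace H] in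
-- The expansion `M = ∑ |b⟩⟨c| ⊗ M_bc`, which splits each term of a decomposition into four.
lemma sum_matUnit_mul_block (i : Fin q) (M : QubitOp H q) :
    ∑ bc : Bool × Bool, matUnit i bc.1 bc.2 * block i bc.1 bc.2 M = M := by
  simp_rw [matUnit_mul_block]
  rw [Fintype.sum_prod_type]
  simp_rw [← Finset.mul_sum, sum_matUnit_self, mul_one, ← Finset.sum_mul, sum_matUnit_self, one_mul]

omit [CompleteSpace H] in
lemma sum_block_mul_matUnit (i : Fin q) (M : QubitOp H q) :
    ∑ bc : Bool × Bool, block i bc.2 bc.1 M * matUnit i bc.2 bc.1 = M := by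
  simp_rw [block_mul_matUnit]
  rw [Fintype.sum_prod_type, Finset.sum_comm]
  simp_rw [← Finset.mul_sum, sum_matUnit_self, mul_one, ← Finset.sum_mul, sum_matUnit_self, one_mul]

lemma Loc.block {i : Fin q} (hM : Loc 𝓐 (insert i S) M) (b c : Bool) :
    Loc 𝓐 S (block i b c M) where
  entry s t := by
    rw [NonSignaling.block, sum_apply_qubitOp]
    refine sum_mem fun r _ => ?_
    rw [mul_matUnit_apply]
    split_ifs
    · rw [matUnit_mul_apply]
      split_ifs
      · exact hM.entry _ _
      · exact zero_mem _
    · exact zero_mem _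
  comm j hj b' c' := by
    by_cases hji : j = i
    · subst hji
      rw [Commute, SemiconjBy, block_mul_matUnit, matUnit_mul_block]
    · refine Commute.sum_left _ _ _ fun r _ => ?_
      exact ((commute_matUnit (Ne.symm hji) _ _ _ _).mul_left
        (hM.comm j (by simp [hji, hj]) _ _)).mul_left (commute_matUnit (Ne.symm hji) _ _ _ _)

/-- The factor 2 arises because `∑ |b⟩⟨c|c⟩⟨b|` over the four matrix units is twice the identity. -/
lemma RowBounded.matUnit_mul {K : Type*} [Fintype K] {β : ℝ} {F : K → QubitOp H q}
    (h : RowBounded β F) (i : Fin q) :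
    RowBounded (2 * β) fun k : K × Bool × Bool => matUnit i k.2.2 k.2.1 * F k.1 := by
  intro Φ
  have e : ∑ k : K × Bool × Bool, star (matUnit i k.2.2 k.2.1 * F k.1) *
      (matUnit i k.2.2 k.2.1 * F k.1) = ∑ k, star (F k) * F k + ∑ k, star (F k) * F k := by
    rw [Fintype.sum_prod_type, ← Finset.sum_add_distrib]
    refine Finset.sum_congr rfl fun k _ => ?_
    have : ∀ bc : Bool × Bool, star (matUnit i bc.2 bc.1 * F k) * (matUnit i bc.2 bc.1 * F k) =
        star (F k) * matUnit i bc.1 bc.1 * F k := by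
      intro bc
      rw [star_mul, star_matUnit, mul_assoc, ← mul_assoc (matUnit i _ _), matUnit_mul_matUnit,
        if_pos rfl, mul_assoc]
    simp_rw [this]
    rw [Fintype.sum_prod_type, Finset.sum_comm]
    simp_rw [← Finset.sum_mul, ← Finset.mul_sum, sum_matUnit_self, Fintype.sum_bool, mul_add,
      add_mul, mul_one]
  rw [e, quad_add]
  linarith [h Φ]

/-- Summed over `b`, the squares of the blocks with second index `c` give `∑ᵣ |r⟩⟨c| F* F |c⟩⟨r|`.
The quadratic form is thus that of `F* F` on the vectors `|c⟩⟨r| Φ`, whose squared norms add up to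
twice that of `Φ`. -/
lemma RowBounded.block {K : Type*} [Fintype K] {β : ℝ} {F : K → QubitOp H q}
    (h : RowBounded β F) (i : Fin q) :
    RowBounded (2 * β) fun k : K × Bool × Bool => block i k.2.1 k.2.2 (F k.1) := by
  intro Φ
  have e : ∑ k : K × Bool × Bool, star (NonSignaling.block i k.2.1 k.2.2 (F k.1)) *
      NonSignaling.block i k.2.1 k.2.2 (F k.1) =
      ∑ c, ∑ r, star (matUnit i c r) * (∑ k, star (F k) * F k) * matUnit i c r := by
    have h1 : ∀ k : K × Bool × Bool, star (NonSignaling.block i k.2.1 k.2.2 (F k.1)) *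
        NonSignaling.block i k.2.1 k.2.2 (F k.1) = ∑ r, star (matUnit i k.2.2 r) *
          (star (F k.1) * matUnit i k.2.1 k.2.1 * F k.1) * matUnit i k.2.2 r := by
      intro k
      conv_lhs => rw [star_block, NonSignaling.block, Finset.sum_mul]
      refine Finset.sum_congr rfl fun r _ => ?_
      rw [mul_assoc, matUnit_mul_block, star_matUnit]
      noncomm_ring
    simp_rw [h1]
    rw [Fintype.sum_prod_type]
    simp_rw [Fintype.sum_prod_type]
    simp_rw [Finset.mul_sum, Finset.sum_mul]
    have h2 : ∀ k, ∑ b, ∑ c, ∑ r, star (matUnit i c r) * (star (F k) * matUnit i b b * F k) *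
        matUnit i c r = ∑ c, ∑ r, star (matUnit i c r) * (star (F k) * F k) * matUnit i c r := by
      intro k
      rw [Finset.sum_comm]
      refine Finset.sum_congr rfl fun c _ => ?_
      rw [Finset.sum_comm]
      refine Finset.sum_congr rfl fun r _ => ?_
      simp_rw [← Finset.sum_mul, ← Finset.mul_sum, ← Finset.sum_mul, ← Finset.mul_sum,
        sum_matUnit_self, mul_one]
    simp_rw [h2]
    rw [Finset.sum_comm]
    exact Finset.sum_congr rfl fun c _ => Finset.sum_comm
  have e1 : ∑ c, ∑ r, star (matUnit i c r : QubitOp H q) * 1 * matUnit i c r = 1 + 1 := by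
    simp_rw [mul_one, star_matUnit, matUnit_mul_matUnit, if_true, sum_matUnit_self]
    rw [Fintype.sum_bool]
  rw [e]
  calc _ = ∑ c, ∑ r, quad (∑ k, star (F k) * F k) (act (matUnit i c r) Φ) := by
        rw [quad_sum]
        refine Finset.sum_congr rfl fun c _ => ?_
        rw [quad_sum]
        exact Finset.sum_congr rfl fun r _ => quad_conj _ _ _
    _ ≤ ∑ c, ∑ r, β * quad 1 (act (matUnit i c r) Φ) :=
        Finset.sum_le_sum fun c _ => Finset.sum_le_sum fun r _ => h _
    _ = β * quad (1 + 1) Φ := by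
        rw [← e1]
        rw [quad_sum, Finset.mul_sum]
        refine Finset.sum_congr rfl fun c _ => ?_
        rw [quad_sum, Finset.mul_sum]
        exact Finset.sum_congr rfl fun r _ => by rw [quad_conj]
    _ = _ := by rw [quad_add]; ring

end QubitOp

end NonSignaling

end

noncomputable section

open scoped InnerProductSpace

namespace NonSignaling

/-! ### From protocols to vectors -/

section Decomposition

variable {q : ℕ} {sender : Fin q → Player}

/-- A round moves exactly the qubit with the number of the round, so consecutive sets differ in one
element. -/
lemma aliceHolds_of_alice {t : Fin q} (h : sender t = Player.alice) :
    t ∉ aliceHolds sender (t + 1) ∧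
      aliceHolds sender t = insert t (aliceHolds sender (t + 1)) := by
  refine ⟨by simp [aliceHolds, h], ?_⟩
  ext i
  by_cases hi : i = t
  · subst hi; simp [aliceHolds, h]
  · have hne : (i : ℕ) ≠ t := fun e => hi (Fin.ext e)
    have h1 : (i : ℕ) < t + 1 ↔ (i : ℕ) < t := by omega
    have h2 : (t : ℕ) + 1 ≤ i ↔ (t : ℕ) ≤ i := by omega
    simp only [aliceHolds, Set.mem_insert_iff, Set.mem_ofPred_eq, hi, false_or, h1, h2]

lemma aliceHolds_of_bob {t : Fin q} (h : sender t = Player.bob) :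
    t ∉ aliceHolds sender t ∧
      aliceHolds sender (t + 1) = insert t (aliceHolds sender t) := by
  refine ⟨by simp [aliceHolds, h], ?_⟩
  ext i
  by_cases hi : i = t
  · subst hi; simp [aliceHolds, h]
  · have hne : (i : ℕ) ≠ t := fun e => hi (Fin.ext e)
    have h1 : (i : ℕ) < t + 1 ↔ (i : ℕ) < t := by omega
    have h2 : (t : ℕ) + 1 ≤ i ↔ (t : ℕ) ≤ i := by omega
    simp only [aliceHolds, Set.mem_insert_iff, Set.mem_ofPred_eq, hi, false_or, h1, h2]

variable {H : Type w} [NormedAddCommGroup H] [InnerProductSpace ℂ H] [CompleteSpace H]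

/-- The decompositions `O x y = ∑ₖ Aₖ(x) Bₖ(y)` into operators of the two players, Alice holding
the qubits in `S`, with `∑ Aₖ Aₖ*` and `∑ Bₖ* Bₖ` bounded by `β`. -/
def HasDecomposition {X Y : Type*} (𝓐 𝓑 : StarSubalgebra ℂ (H →L[ℂ] H)) (S : Set (Fin q)) (β : ℝ)
    (O : X → Y → QubitOp H q) : Prop :=
  ∃ (K : Type) (_ : Fintype K) (A : X → K → QubitOp H q) (B : Y → K → QubitOp H q),
    (∀ x k, Loc 𝓐 S (A x k)) ∧ (∀ y k, Loc 𝓑 Sᶜ (B y k)) ∧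
    (∀ x, RowBounded β fun k => star (A x k)) ∧ (∀ y, RowBounded β (B y)) ∧
    ∀ x y, O x y = ∑ k, A x k * B y k

variable {X Y : Type*} {𝓐 𝓑 : StarSubalgebra ℂ (H →L[ℂ] H)} {S : Set (Fin q)} {β : ℝ}
  {O : X → Y → QubitOp H q}

/-- Handing over a qubit doubles the bounds (in Heisenberg picture, Bob hands it to Alice). -/
lemma HasDecomposition.insert_qubit (h : HasDecomposition 𝓐 𝓑 S β O) {i : Fin q} (hi : i ∉ S) :
    HasDecomposition 𝓐 𝓑 (insert i S) (2 * β) O := by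
  obtain ⟨K, _, A, B, hA, hB, bA, bB, hO⟩ := h
  have hS : Sᶜ = insert i (insert i S)ᶜ := by
    ext j; by_cases hj : j = i
    · subst hj; simpa using hi
    · simp [hj]
  refine ⟨K × Bool × Bool, inferInstance, fun x k => A x k.1 * matUnit i k.2.1 k.2.2,
    fun y k => block i k.2.1 k.2.2 (B y k.1), fun x k => ?_, fun y k => ?_, fun x => ?_,
    fun y => (bB y).block i, fun x y => ?_⟩
  · exact ((hA x k.1).mono (Set.subset_insert _ _)).mul (Loc.matUnit (Set.mem_insert _ _) _ _)
  · exact Loc.block (by rw [← hS]; exact hB y k.1) _ _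
  · simpa only [star_mul, star_matUnit] using (bA x).matUnit_mul i
  · rw [hO, Fintype.sum_prod_type]
    refine Finset.sum_congr rfl fun k _ => ?_
    conv_lhs => rw [← sum_matUnit_mul_block i (B y k), Finset.mul_sum]
    exact Finset.sum_congr rfl fun bc _ => (mul_assoc _ _ _).symm

/-- The mirror image of `insert_qubit`: Bob's operators absorb the matrix units and Alice keeps the
blocks. -/
lemma HasDecomposition.remove_qubit {i : Fin q} (h : HasDecomposition 𝓐 𝓑 (insert i S) β O)
    (hi : i ∉ S) : HasDecomposition 𝓐 𝓑 S (2 * β) O := by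
  obtain ⟨K, _, A, B, hA, hB, bA, bB, hO⟩ := h
  have hS : (insert i S)ᶜ ⊆ Sᶜ := Set.compl_subset_compl.2 (Set.subset_insert _ _)
  refine ⟨K × Bool × Bool, inferInstance, fun x k => block i k.2.2 k.2.1 (A x k.1),
    fun y k => matUnit i k.2.2 k.2.1 * B y k.1, fun x k => (hA x k.1).block _ _, fun y k => ?_,
    fun x => ?_, fun y => (bB y).matUnit_mul i, fun x y => ?_⟩
  · exact (Loc.matUnit hi _ _).mul ((hB y k.1).mono hS)
  · simpa only [star_block] using (bA x).block i
  · rw [hO, Fintype.sum_prod_type]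
    refine Finset.sum_congr rfl fun k _ => ?_
    conv_lhs => rw [← sum_block_mul_matUnit i (A x k), Finset.sum_mul]
    exact Finset.sum_congr rfl fun bc _ => mul_assoc _ _ _

/-- Local unitaries are free: `U` passes through Bob's operators and `V` through Alice's, so every
factor is conjugated by its owner's unitary alone. -/
lemma HasDecomposition.conj (h : HasDecomposition 𝓐 𝓑 S β O)
    (hcomm : ∀ a ∈ 𝓐, ∀ b ∈ 𝓑, a * b = b * a) {U : X → QubitOp H q} {V : Y → QubitOp H q}
    (hU : ∀ x, Loc 𝓐 S (U x)) (hV : ∀ y, Loc 𝓑 Sᶜ (V y))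
    (uU : ∀ x, U x ∈ unitary (QubitOp H q)) (uV : ∀ y, V y ∈ unitary (QubitOp H q)) :
    HasDecomposition 𝓐 𝓑 S β fun x y => star (U x * V y) * O x y * (U x * V y) := by
  obtain ⟨K, _, A, B, hA, hB, bA, bB, hO⟩ := h
  refine ⟨K, inferInstance, fun x k => star (U x) * A x k * U x,
    fun y k => star (V y) * B y k * V y, fun x k => ((hU x).star.mul (hA x k)).mul (hU x),
    fun y k => ((hV y).star.mul (hB y k)).mul (hV y), fun x => ?_, fun y => (bB y).conj (uV y),
    fun x y => ?_⟩
  · simpa only [star_mul, star_star, mul_assoc] using (bA x).conj (uU x)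
  · beta_reduce
    rw [hO, Finset.mul_sum, Finset.sum_mul]
    refine Finset.sum_congr rfl fun k _ => ?_
    have h1 : U x * B y k = B y k * U x := (hU x).commute (hB y k) hcomm
    have h2 : star (U x) * A x k * U x * star (V y) = star (V y) * (star (U x) * A x k * U x) :=
      (((hU x).star.mul (hA x k)).mul (hU x)).commute (hV y).star hcomm
    calc star (U x * V y) * (A x k * B y k) * (U x * V y)
        = star (V y) * star (U x) * A x k * (B y k * U x) * V y := by
          rw [star_mul]; noncomm_ring
      _ = star (V y) * (star (U x) * A x k * U x) * B y k * V y := by rw [← h1]; noncomm_ring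
      _ = _ := by rw [← h2]; noncomm_ring

variable (U : Fin q → X → QubitOp H q) (V : Fin q → Y → QubitOp H q)

/-- The rounds from `t` on. -/
def evolutionFrom (t : ℕ) (x : X) (y : Y) : QubitOp H q :=
  (((List.ofFn fun i => U i x * V i y).drop t).reverse).prod

omit [CompleteSpace H] in
lemma evolutionFrom_last (x : X) (y : Y) : evolutionFrom U V q x y = 1 := by
  simp [evolutionFrom, List.drop_eq_nil_of_le]

omit [CompleteSpace H] in
lemma evolutionFrom_step (t : Fin q) (x : X) (y : Y) :
    evolutionFrom U V t x y = evolutionFrom U V (t + 1) x y * (U t x * V t y) := by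
  rw [evolutionFrom, List.drop_eq_getElem_cons (by simp), List.reverse_cons, List.prod_append]
  simp [evolutionFrom]

variable {U V}

/-- Backward induction from the final measurement, a single product `E F` with bound 1. Undoing a
round returns its qubit to the sender, which doubles the bound, and then conjugates by local
unitaries; at `t = 0` the bound is `2 ^ q`. -/
theorem hasDecomposition_evolution {E : X → QubitOp H q} {F : Y → QubitOp H q}
    (hcomm : ∀ a ∈ 𝓐, ∀ b ∈ 𝓑, a * b = b * a)
    (hU : ∀ (i : Fin q) x, Loc 𝓐 (aliceHolds sender i) (U i x))
    (hV : ∀ (i : Fin q) y, Loc 𝓑 (aliceHolds sender i)ᶜ (V i y))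
    (uU : ∀ i x, U i x ∈ unitary (QubitOp H q)) (uV : ∀ i y, V i y ∈ unitary (QubitOp H q))
    (hE : ∀ x, Loc 𝓐 (aliceHolds sender q) (E x)) (hF : ∀ y, Loc 𝓑 (aliceHolds sender q)ᶜ (F y))
    (bE : ∀ x Φ, quad (E x * star (E x)) Φ ≤ quad 1 Φ)
    (bF : ∀ y Φ, quad (star (F y) * F y) Φ ≤ quad 1 Φ) {t : ℕ} (ht : t ≤ q) :
    HasDecomposition 𝓐 𝓑 (aliceHolds sender t) (2 ^ (q - t)) fun x y =>
      star (evolutionFrom U V t x y) * (E x * F y) * evolutionFrom U V t x y := by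
  induction ht using Nat.decreasingInduction with
  | self =>
    refine ⟨Unit, inferInstance, fun x _ => E x, fun y _ => F y, fun x _ => hE x, fun y _ => hF y,
      fun x Φ => by simpa using bE x Φ, fun y Φ => by simpa using bF y Φ, fun x y => ?_⟩
    simp [evolutionFrom_last]
  | of_succ t ht ih =>
    have e : ∀ x y, star (evolutionFrom U V t x y) * (E x * F y) * evolutionFrom U V t x y =
        star (U ⟨t, ht⟩ x * V ⟨t, ht⟩ y) * (star (evolutionFrom U V (t + 1) x y) * (E x * F y) *
          evolutionFrom U V (t + 1) x y) * (U ⟨t, ht⟩ x * V ⟨t, ht⟩ y) := by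
      intro x y
      rw [evolutionFrom_step U V ⟨t, ht⟩ x y, star_mul]
      noncomm_ring
    have hpow : (2 : ℝ) ^ (q - t) = 2 * 2 ^ (q - (t + 1)) := by
      rw [← pow_succ']; congr 1; omega
    simp_rw [e, hpow]
    refine HasDecomposition.conj ?_ hcomm (hU ⟨t, ht⟩) (hV ⟨t, ht⟩) (uU _) (uV _)
    -- Time runs backwards: a qubit sent by Alice joins her set here.
    cases hs : sender ⟨t, ht⟩ with
    | alice =>
      obtain ⟨h1, h2⟩ := aliceHolds_of_alice hs
      have := ih.insert_qubit h1
      rwa [← h2] at this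
    | bob =>
      obtain ⟨h1, h2⟩ := aliceHolds_of_bob hs
      simp only at h2
      rw [h2] at ih
      exact ih.remove_qubit h1

/-- The real part of a complex inner product is a real inner product on the same space. -/
lemma exists_real_vectors {X Y : Type*} {W : Type w} [NormedAddCommGroup W]
    [InnerProductSpace ℂ W] {β : ℝ} (u : X → W) (v : Y → W) (hu : ∀ x, ‖u x‖ ^ 2 ≤ β)
    (hv : ∀ y, ‖v y‖ ^ 2 ≤ β) (c : X → Y → ℝ) (hc : ∀ x y, c x y = (⟪u x, v y⟫_ℂ).re) :
    ∃ (W : Type w) (_ : NormedAddCommGroup W) (_ : InnerProductSpace ℝ W) (u : X → W) (v : Y → W),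
      (∀ x, ‖u x‖ ^ 2 ≤ β) ∧ (∀ y, ‖v y‖ ^ 2 ≤ β) ∧ ∀ x y, c x y = ⟪u x, v y⟫_ℝ :=
  ⟨W, inferInstance, InnerProductSpace.rclikeToReal ℂ W, u, v, hu, hv, hc⟩

/-- The vectors `Fₖ Φ`, as one vector of the direct sum. -/
def stackedAct {K : Type} (F : K → QubitOp H q) (Φ : (Fin q → Bool) → H) :
    PiLp 2 fun _ : K × (Fin q → Bool) => H :=
  WithLp.toLp 2 fun p => act (F p.1) Φ p.2

lemma norm_stackedAct_sq_le {K : Type} [Fintype K] {F : K → QubitOp H q} (hF : RowBounded β F)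
    {Φ : (Fin q → Bool) → H} (hΦ : quad 1 Φ = 1) : ‖stackedAct F Φ‖ ^ 2 ≤ β := by
  rw [PiLp.norm_sq_eq_of_L2]
  have := hF Φ
  rw [hΦ, mul_one, quad_sum] at this
  refine Eq.trans_le ?_ this
  rw [Fintype.sum_prod_type]
  refine Finset.sum_congr rfl fun k _ => ?_
  have e := quad_conj 1 (F k) Φ
  rw [mul_one, quad_one] at e
  exact e.symm

lemma re_inner_stackedAct {K : Type} [Fintype K] (A B : K → QubitOp H q)
    (Φ : (Fin q → Bool) → H) : quad (∑ k, A k * B k) Φ =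
      (⟪stackedAct (fun k => star (A k)) Φ, stackedAct B Φ⟫_ℂ).re := by
  rw [PiLp.inner_apply, quad_sum, Fintype.sum_prod_type, Complex.re_sum]
  refine Finset.sum_congr rfl fun k _ => ?_
  have := quad_star_mul (star (A k)) (B k) Φ
  rw [star_star] at this
  exact this

/-- The quadratic forms of a decomposable family of operators are inner products of vectors. -/
lemma HasDecomposition.exists_vectors (h : HasDecomposition 𝓐 𝓑 S β O) (Φ : (Fin q → Bool) → H)
    (hΦ : quad 1 Φ = 1) :
    ∃ (W : Type w) (_ : NormedAddCommGroup W) (_ : InnerProductSpace ℝ W) (u : X → W) (v : Y → W),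
      (∀ x, ‖u x‖ ^ 2 ≤ β) ∧ (∀ y, ‖v y‖ ^ 2 ≤ β) ∧ ∀ x y, quad (O x y) Φ = ⟪u x, v y⟫_ℝ := by
  obtain ⟨K, _, A, B, -, -, bA, bB, hO⟩ := h
  exact exists_real_vectors (fun x => stackedAct (fun k => star (A x k)) Φ)
    (fun y => stackedAct (B y) Φ) (fun x => norm_stackedAct_sq_le (bA x) hΦ)
    (fun y => norm_stackedAct_sq_le (bB y) hΦ) _
    fun x y => by rw [hO, re_inner_stackedAct]

end Decomposition

end NonSignaling

end

noncomputable section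

open scoped InnerProductSpace

namespace NonSignaling

/-! ### The vectors of a protocol and of a quantum distribution -/

section Protocol

variable {H : Type w} [NormedAddCommGroup H] [InnerProductSpace ℂ H] [CompleteSpace H]
  {X : Type u₁} {Y : Type u₂} {A : Type u₃} {B : Type u₄} [Fintype A] [Fintype B] {q : ℕ}

/-- A state of the players' registers together with message qubits in the state `|0…0⟩`. -/
def zeroState (q : ℕ) (ψ : H) : (Fin q → Bool) → H := fun s => if s = fun _ => false then ψ else 0

omit [CompleteSpace H] in
lemma quad_zeroState (M : QubitOp H q) (ψ : H) :
    quad M (zeroState q ψ) = (⟪ψ, M (fun _ => false) (fun _ => false) ψ⟫_ℂ).re := by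
  rw [quad, Finset.sum_eq_single (fun _ => false) (fun s _ hs => by simp [zeroState, hs]) (by simp)]
  rw [act, Finset.sum_eq_single (fun _ => false) (fun s _ hs => by simp [zeroState, hs]) (by simp)]
  simp [zeroState]

omit [CompleteSpace H] in
lemma quad_one_zeroState {ψ : H} (hψ : ‖ψ‖ = 1) : quad 1 (zeroState q ψ) = 1 := by
  rw [quad_one, Finset.sum_eq_single (fun _ => false) (fun s _ hs => by simp [zeroState, hs])
    (by simp)]
  simp [zeroState, hψ]

lemma quad_starProjection_nonneg {M : QubitOp H q} (hM : IsStarProjection M)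
    (Φ : (Fin q → Bool) → H) : 0 ≤ quad M Φ := by
  have : M = star M * 1 * M := by
    rw [mul_one, hM.isSelfAdjoint.star_eq, hM.isIdempotentElem.eq]
  rw [this, quad_conj]
  exact quad_one_nonneg _

lemma IsProjectiveMeasurement.quad_le {O : Type*} [Fintype O] {E : O → QubitOp H q}
    (hE : IsProjectiveMeasurement E) (o : O) (Φ : (Fin q → Bool) → H) :
    quad (E o) Φ ≤ quad 1 Φ := by
  rw [← hE.sum_eq_one, quad_sum]
  exact Finset.single_le_sum (f := fun o => quad (E o) Φ)
    (fun o _ => quad_starProjection_nonneg (hE.proj o) Φ) (Finset.mem_univ o)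

lemma Loc.sub {𝓐 : StarSubalgebra ℂ (H →L[ℂ] H)} {S : Set (Fin q)} {M N : QubitOp H q}
    (hM : Loc 𝓐 S M) (hN : Loc 𝓐 S N) : Loc 𝓐 S (M - N) where
  entry s t := by rw [Matrix.sub_apply]; exact sub_mem (hM.entry s t) (hN.entry s t)
  comm i hi b c := (hM.comm i hi b c).sub_left (hN.comm i hi b c)

lemma sum_intUnits {R : Type*} [AddCommMonoid R] (f : ℤˣ → R) : ∑ a, f a = f 1 + f (-1) := by
  have : (Finset.univ : Finset ℤˣ) = {1, -1} := by decide
  rw [this, Finset.sum_pair (by decide)]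

/-- The `±1`-valued observable of a measurement with outcomes `±1`. -/
def observable (E : ℤˣ → QubitOp H q) : QubitOp H q := E 1 - E (-1)

lemma IsProjectiveMeasurement.star_observable {E : ℤˣ → QubitOp H q}
    (hE : IsProjectiveMeasurement E) : star (observable E) = observable E := by
  simp [observable, (hE.proj _).isSelfAdjoint.star_eq]

lemma IsProjectiveMeasurement.observable_mul_self {E : ℤˣ → QubitOp H q}
    (hE : IsProjectiveMeasurement E) : observable E * observable E = 1 := by
  rw [← hE.sum_eq_one, sum_intUnits, observable, sub_mul, mul_sub, mul_sub,
    (hE.proj 1).isIdempotentElem.eq, (hE.proj (-1)).isIdempotentElem.eq, hE.orth 1 (-1) (by decide),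
    hE.orth (-1) 1 (by decide)]
  simp

namespace EntProtocol

lemma prob_eq_quad (P : EntProtocol H X Y A B q) (x : X) (y : Y) (a : A) (b : B) :
    P.prob x y a b =
      quad (star (P.evolution x y) * (P.E x a * P.F y b) * P.evolution x y) (zeroState q P.ψ) :=
  (quad_zeroState _ _).symm

lemma prob_nonneg (P : EntProtocol H X Y A B q) (x : X) (y : Y) (a : A) (b : B) :
    0 ≤ P.prob x y a b := by
  rw [prob_eq_quad, quad_conj]
  refine quad_starProjection_nonneg ?_ _
  have hc : Commute (P.E x a) (P.F y b) := (P.E_local x a).loc.commute (P.F_local y b).loc P.comm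
  exact ((P.E_meas x).proj a).mul ((P.F_meas y).proj b) hc

lemma evolution_mem_unitary (P : EntProtocol H X Y A B q) (x : X) (y : Y) :
    P.evolution x y ∈ unitary (QubitOp H q) := by
  refine Submonoid.list_prod_mem _ fun M hM => ?_
  rw [List.mem_reverse, List.mem_ofFn] at hM
  obtain ⟨i, rfl⟩ := hM
  exact mul_mem (P.U_unitary i x) (P.V_unitary i y)

lemma sum_prob (P : EntProtocol H X Y A B q) (x : X) (y : Y) :
    ∑ a, ∑ b, P.prob x y a b = 1 := by
  have e : ∑ a, ∑ b, star (P.evolution x y) * (P.E x a * P.F y b) * P.evolution x y = 1 := by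
    simp_rw [← Finset.sum_mul, ← Finset.mul_sum, (P.F_meas y).sum_eq_one, mul_one,
      (P.E_meas x).sum_eq_one, mul_one]
    exact (P.evolution_mem_unitary x y).1
  have h := congrArg (fun M => quad M (zeroState q P.ψ)) e
  simp only [quad_sum, quad_one_zeroState P.norm_ψ] at h
  simpa only [prob_eq_quad] using h

/-- The outcome is treated as part of the input, so each pair `(x, a)` has its own projection and
its own vector. -/
theorem exists_vectors (P : EntProtocol H X Y A B q) :
    ∃ (W : Type w) (_ : NormedAddCommGroup W) (_ : InnerProductSpace ℝ W) (u : X × A → W)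
      (v : Y × B → W), (∀ x, ‖u x‖ ^ 2 ≤ 2 ^ q) ∧ (∀ y, ‖v y‖ ^ 2 ≤ 2 ^ q) ∧
        ∀ x y a b, P.prob x y a b = ⟪u (x, a), v (y, b)⟫_ℝ := by
  have h := hasDecomposition_evolution (sender := P.sender) (U := fun i (x : X × A) => P.U i x.1)
    (V := fun i (y : Y × B) => P.V i y.1) (E := fun x => P.E x.1 x.2) (F := fun y => P.F y.1 y.2)
    P.comm (fun i x => (P.U_local i _).loc) (fun i y => (P.V_local i _).loc)
    (fun i x => P.U_unitary i _) (fun i y => P.V_unitary i _) (fun x => (P.E_local _ _).loc)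
    (fun y => (P.F_local _ _).loc)
    (fun x Φ => by
      have hp := (P.E_meas x.1).proj x.2
      rw [hp.isSelfAdjoint.star_eq, hp.isIdempotentElem.eq]
      exact (P.E_meas x.1).quad_le _ _)
    (fun y Φ => by
      have hp := (P.F_meas y.1).proj y.2
      rw [hp.isSelfAdjoint.star_eq, hp.isIdempotentElem.eq]
      exact (P.F_meas y.1).quad_le _ _) (Nat.zero_le q)
  obtain ⟨W, _, _, u, v, hu, hv, huv⟩ := h.exists_vectors _ (quad_one_zeroState P.norm_ψ)
  refine ⟨W, inferInstance, inferInstance, u, v, hu, hv, fun x y a b => ?_⟩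
  rw [prob_eq_quad, ← huv]
  rfl

/-- The correlation of the outcomes is a Gram matrix of vectors of squared norm at most `2 ^ q`. -/
theorem exists_vectors_corr (P : EntProtocol H X Y ℤˣ ℤˣ q) :
    ∃ (W : Type w) (_ : NormedAddCommGroup W) (_ : InnerProductSpace ℝ W) (u : X → W)
      (v : Y → W), (∀ x, ‖u x‖ ^ 2 ≤ 2 ^ q) ∧ (∀ y, ‖v y‖ ^ 2 ≤ 2 ^ q) ∧
        ∀ x y, P.prob x y 1 1 - P.prob x y 1 (-1) - P.prob x y (-1) 1 + P.prob x y (-1) (-1) =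
          ⟪u x, v y⟫_ℝ := by
  -- Decomposing the `±1`-valued observables, which square to 1, instead of four products of
  -- projections keeps the bound at `2 ^ q`; the explicit constant of the Boolean bound depends on
  -- this.
  have h := hasDecomposition_evolution (sender := P.sender) (U := P.U)
    (V := P.V) (E := fun x => observable (P.E x)) (F := fun y => observable (P.F y))
    P.comm (fun i x => (P.U_local i _).loc) (fun i y => (P.V_local i _).loc)
    P.U_unitary P.V_unitary (fun x => (P.E_local _ _).loc.sub (P.E_local _ _).loc)
    (fun y => (P.F_local _ _).loc.sub (P.F_local _ _).loc)
    (fun x Φ => by rw [(P.E_meas x).star_observable, (P.E_meas x).observable_mul_self])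
    (fun y Φ => by rw [(P.F_meas y).star_observable, (P.F_meas y).observable_mul_self])
    (Nat.zero_le q)
  obtain ⟨W, _, _, u, v, hu, hv, huv⟩ := h.exists_vectors _ (quad_one_zeroState P.norm_ψ)
  refine ⟨W, inferInstance, inferInstance, u, v, hu, hv, fun x y => ?_⟩
  rw [← huv]
  have e : star (P.evolution x y) * (observable (P.E x) * observable (P.F y)) * P.evolution x y
        + star (P.evolution x y) * (P.E x 1 * P.F y (-1)) * P.evolution x y
        + star (P.evolution x y) * (P.E x (-1) * P.F y 1) * P.evolution x y =
      star (P.evolution x y) * (P.E x 1 * P.F y 1) * P.evolution x y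
        + star (P.evolution x y) * (P.E x (-1) * P.F y (-1)) * P.evolution x y := by
    simp only [observable]; noncomm_ring
  have h := congrArg (fun M => quad M (zeroState q P.ψ)) e
  simp only [quad_add, ← prob_eq_quad] at h
  change _ = quad (star (P.evolution x y) * (observable (P.E x) * observable (P.F y)) *
    P.evolution x y) (zeroState q P.ψ)
  linarith

end EntProtocol

lemma inner_mul_apply_of_isSelfAdjoint {S : H →L[ℂ] H} (hS : IsSelfAdjoint S) (T : H →L[ℂ] H)
    (φ ψ : H) : ⟪φ, (S * T) ψ⟫_ℂ = ⟪S φ, T ψ⟫_ℂ := by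
  have h := ContinuousLinearMap.adjoint_inner_right S φ (T ψ)
  rw [← ContinuousLinearMap.star_eq_adjoint, hS.star_eq] at h
  exact h

lemma re_inner_starProjection {T : H →L[ℂ] H} (hT : IsStarProjection T) (ψ : H) :
    (⟪ψ, T ψ⟫_ℂ).re = ‖T ψ‖ ^ 2 := by
  rw [← inner_self_eq_norm_sq (𝕜 := ℂ), ← inner_mul_apply_of_isSelfAdjoint hT.isSelfAdjoint,
    hT.isIdempotentElem.eq]
  rfl

/-- The vectors of a quantum distribution. -/
theorem IsQuantum.exists_vectors {p : X → Y → A → B → ℝ} (hp : IsQuantum.{u₁, u₂, u₃, u₄, w} p) :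
    (∀ x y a b, 0 ≤ p x y a b) ∧ (∀ x y, ∑ a, ∑ b, p x y a b = 1) ∧
    ∃ (W : Type w) (_ : NormedAddCommGroup W) (_ : InnerProductSpace ℝ W) (u : X × A → W)
      (v : Y × B → W), (∀ x, ‖u x‖ ^ 2 ≤ 1) ∧ (∀ y, ‖v y‖ ^ 2 ≤ 1) ∧
        ∀ x y a b, p x y a b = ⟪u (x, a), v (y, b)⟫_ℝ := by
  obtain ⟨H, _, _, _, ψ, E, F, hψ, hE, hF, hcomm, hp⟩ := hp
  have nproj : ∀ T : H →L[ℂ] H, IsStarProjection T → ‖T ψ‖ ^ 2 ≤ 1 := by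
    intro T hT
    -- For a projection the left-hand side is `‖T ψ‖ ^ 2`, which forces `‖T ψ‖ ≤ 1`.
    have h2 : (⟪ψ, T ψ⟫_ℂ).re ≤ ‖T ψ‖ := by
      refine (Complex.re_le_norm _).trans ((norm_inner_le_norm _ _).trans ?_)
      rw [hψ, one_mul]
    rw [re_inner_starProjection hT] at h2
    nlinarith [norm_nonneg (T ψ), sq_nonneg (‖T ψ‖ - 1)]
  have hre : ∀ x y a b, p x y a b = (⟪ψ, (E x a * F y b) ψ⟫_ℂ).re := fun x y a b => by
    rw [← hp]; rfl
  have hEF : ∀ x y a b, p x y a b = (⟪E x a ψ, F y b ψ⟫_ℂ).re := fun x y a b => by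
    rw [hre, inner_mul_apply_of_isSelfAdjoint ((hE x).proj a).isSelfAdjoint]
  refine ⟨fun x y a b => ?_, fun x y => ?_, ?_⟩
  · have hproj : IsStarProjection (E x a * F y b) :=
      ((hE x).proj a).mul ((hF y).proj b) (hcomm x y a b)
    rw [hre, re_inner_starProjection hproj]
    positivity
  · simp_rw [hre, ← Complex.re_sum, ← inner_sum, ← sum_apply, ← Finset.mul_sum,
      ← Finset.sum_mul, (hE x).sum_eq_one, (hF y).sum_eq_one, one_mul]
    have := inner_self_eq_norm_sq (𝕜 := ℂ) ψ
    rw [hψ, one_pow] at this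
    exact this
  · exact ⟨H, inferInstance, InnerProductSpace.rclikeToReal ℂ H, fun xa => E xa.1 xa.2 ψ,
      fun yb => F yb.1 yb.2 ψ, fun xa => nproj _ ((hE _).proj _), fun yb => nproj _ ((hF _).proj _),
      hEF⟩

end Protocol

end NonSignaling

end

noncomputable section

open scoped Kronecker ComplexOrder

namespace NonSignaling

/-! ### Independent repetition with classical post-processing -/

section Product

lemma sum_pi_prod {ι O R : Type*} [Fintype ι] [DecidableEq ι] [Fintype O] [CommSemiring R]
    (f : ι → O → R) : ∑ z : ι → O, ∏ i, f i (z i) = ∏ i, ∑ o, f i o := by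
  rw [Finset.prod_univ_sum, Fintype.piFinset_univ]

lemma sum_pi_prod' {ι R : Type*} {O : ι → Type*} [Fintype ι] [DecidableEq ι] [∀ i, Fintype (O i)]
    [CommSemiring R] (f : ∀ i, O i → R) : ∑ z : ∀ i, O i, ∏ i, f i (z i) = ∏ i, ∑ o, f i o := by
  rw [Finset.prod_univ_sum, Fintype.piFinset_univ]

lemma mix_mem_stdSimplex {Z O : Type*} [Fintype Z] [Fintype O] {w : Z → ℝ} {g : Z → O → ℝ}
    (h0 : ∀ z, 0 ≤ w z) (h1 : ∑ z, w z = 1) (hg : ∀ z, g z ∈ stdSimplex ℝ O) :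
    (fun o => ∑ z, w z * g z o) ∈ stdSimplex ℝ O := by
  refine ⟨fun o => Finset.sum_nonneg fun z _ => mul_nonneg (h0 z) ((hg z).1 o), ?_⟩
  rw [Finset.sum_comm]
  simp_rw [← Finset.mul_sum, (hg _).2, mul_one, h1]

variable {X : Type u₁} {Y : Type u₂} {O O' ι : Type*} [Fintype O] [Fintype O'] [Fintype ι]
  [DecidableEq ι] {k l : ℕ}

/-- Strings of `card ι * k` bits, as families of strings of `k` bits. -/
def blockEquiv (ι : Type*) [Fintype ι] [DecidableEq ι] (k : ℕ) :
    (Fin (Fintype.card ι * k) → Bool) ≃ (ι → Fin k → Bool) :=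
  Fintype.equivOfCardEq (by simp [pow_mul'])

/-- Independent public-coin protocols, followed by a classical channel applied by the referee. -/
theorem PubSMP.exists_product (P : ι → PubSMP X Y O k l) {g : (ι → O) → O' → ℝ}
    (hg : ∀ z, g z ∈ stdSimplex ℝ O') :
    ∃ P' : PubSMP X Y O' (Fintype.card ι * k) (Fintype.card ι * l),
      ∀ x y o, P'.prob x y o = ∑ z, (∏ i, (P i).prob x y (z i)) * g z o := by
  let _ : ∀ i, Fintype (P i).Ω := fun i => (P i).fintypeΩ
  -- The families of coin values live in the universe of `ι`, whereas `Ω` must be a `Type`; hence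
  -- the passage to `Fin`.
  let eΩ := Fintype.equivFin (∀ i, (P i).Ω)
  refine ⟨{ Ω := Fin (Fintype.card (∀ i, (P i).Ω))
            fintypeΩ := inferInstance
            coin := fun ω => ∏ i, (P i).coin (eΩ.symm ω i)
            coin_mem := ⟨fun ω => Finset.prod_nonneg fun i _ => (P i).coin_mem.1 _, ?_⟩
            msgA := fun x ω => (blockEquiv ι k).symm fun i => (P i).msgA x (eΩ.symm ω i)
            msgB := fun y ω => (blockEquiv ι l).symm fun i => (P i).msgB y (eΩ.symm ω i)
            referee := fun m m' o => ∑ z, (∏ i, (P i).referee (blockEquiv ι k m i)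
              (blockEquiv ι l m' i) (z i)) * g z o
            referee_mem := fun m m' => mix_mem_stdSimplex
              (fun z => Finset.prod_nonneg fun i _ => ((P i).referee_mem _ _).1 _) ?_ hg }, ?_⟩
  · rw [eΩ.symm.sum_comp fun ω => ∏ i, (P i).coin (ω i), sum_pi_prod']
    exact Finset.prod_eq_one fun i _ => (P i).coin_mem.2
  · rw [sum_pi_prod]
    exact Finset.prod_eq_one fun i _ => ((P i).referee_mem _ _).2
  · intro x y o
    simp only [PubSMP.prob, Equiv.apply_symm_apply]
    rw [eΩ.symm.sum_comp fun ω => (∏ i, (P i).coin (ω i)) * ∑ z, (∏ i, (P i).referee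
      ((P i).msgA x (ω i)) ((P i).msgB y (ω i)) (z i)) * g z o]
    simp_rw [Finset.mul_sum]
    rw [Finset.sum_comm]
    refine Finset.sum_congr rfl fun z _ => ?_
    rw [← sum_pi_prod', Finset.sum_mul]
    refine Finset.sum_congr rfl fun ω _ => ?_
    rw [Finset.prod_mul_distrib, mul_assoc]

open Matrix

/-- The tensor product of a family of matrices. -/
def piKron {m n : Type*} (M : ι → Matrix m n ℂ) : Matrix (ι → m) (ι → n) ℂ :=
  Matrix.of fun s t => ∏ i, M i (s i) (t i)

omit [DecidableEq ι] in
@[simp] lemma piKron_apply {m n : Type*} (M : ι → Matrix m n ℂ) (s : ι → m) (t : ι → n) :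
    piKron M s t = ∏ i, M i (s i) (t i) := rfl

lemma piKron_mul {m n p : Type*} [Fintype n] (M : ι → Matrix m n ℂ) (N : ι → Matrix n p ℂ) :
    piKron (fun i => M i * N i) = piKron M * piKron N := by
  ext s t
  simp only [piKron_apply, Matrix.mul_apply, ← Finset.prod_mul_distrib]
  exact (sum_pi_prod fun i r => M i (s i) r * N i r (t i)).symm

omit [DecidableEq ι] in
lemma piKron_conjTranspose {m n : Type*} (M : ι → Matrix m n ℂ) :
    piKron (fun i => (M i)ᴴ) = (piKron M)ᴴ := by
  ext s t
  simp

lemma trace_piKron {m : Type*} [Fintype m] (M : ι → Matrix m m ℂ) :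
    (piKron M).trace = ∏ i, (M i).trace := by
  simp only [Matrix.trace, Matrix.diag_apply, piKron_apply]
  exact sum_pi_prod fun i s => M i s s

omit [DecidableEq ι] in
lemma piKron_one {m : Type*} [DecidableEq m] : piKron (fun _ : ι => (1 : Matrix m m ℂ)) = 1 := by
  ext s t
  by_cases h : s = t
  · subst h; simp
  · obtain ⟨i, hi⟩ := Function.ne_iff.1 h
    rw [Matrix.one_apply_ne h]
    exact Finset.prod_eq_zero (Finset.mem_univ i) (Matrix.one_apply_ne hi)

lemma sum_piKron {m n : Type*} (M : ι → O → Matrix m n ℂ) :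
    ∑ z : ι → O, piKron (fun i => M i (z i)) = piKron fun i => ∑ o, M i o := by
  ext s t
  simp only [Matrix.sum_apply, piKron_apply]
  exact sum_pi_prod fun i o => M i o (s i) (t i)

-- Each factor is `B* B`, and tensor products respect products and adjoints.
open scoped MatrixOrder in
lemma piKron_posSemidef {m : Type*} [Fintype m] [DecidableEq m] {M : ι → Matrix m m ℂ}
    (h : ∀ i, (M i).PosSemidef) : (piKron M).PosSemidef := by
  choose B hB using fun i => CStarAlgebra.nonneg_iff_eq_star_mul_self.mp (h i).nonneg
  have : piKron M = (piKron B)ᴴ * piKron B := by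
    rw [← piKron_conjTranspose, ← piKron_mul]
    exact congrArg piKron (funext hB)
  rw [this]
  exact posSemidef_conjTranspose_mul_self _

lemma trace_submatrix_equiv {m n : Type*} [Fintype m] [Fintype n] (e : m ≃ n) (M : Matrix n n ℂ) :
    (M.submatrix e e).trace = M.trace :=
  e.sum_comp fun i => M i i

/-- Nothing is lost in the real part that defines `prob`, as the trace of a product of two Hermitian
matrices is real. Traces of tensor products then give products of probabilities. -/
lemma QuantumSMP.trace_eq (P : QuantumSMP X Y O k l) (x : X) (y : Y) (o : O) :
    (P.povm o * (P.ρ x ⊗ₖ P.σ y)).trace = (P.prob x y o : ℂ) := by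
  have h : star (P.povm o * (P.ρ x ⊗ₖ P.σ y)).trace = (P.povm o * (P.ρ x ⊗ₖ P.σ y)).trace := by
    rw [← Matrix.trace_conjTranspose, Matrix.conjTranspose_mul, Matrix.conjTranspose_kronecker,
      (P.ρ_pos x).isHermitian.eq, (P.σ_pos y).isHermitian.eq, (P.povm_pos o).isHermitian.eq,
      Matrix.trace_mul_comm]
  exact (Complex.conj_eq_iff_re.1 h).symm

/-- Quantum protocols whose messages are systems of dimension a power of two. -/
theorem QuantumSMP.exists_of_equiv {MA MB : Type*} [Fintype MA] [Fintype MB] [DecidableEq MA]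
    [DecidableEq MB] (eA : (Fin k → Bool) ≃ MA) (eB : (Fin l → Bool) ≃ MB)
    {ρ : X → Matrix MA MA ℂ} {σ : Y → Matrix MB MB ℂ} {povm : O → Matrix (MA × MB) (MA × MB) ℂ}
    (hρ : ∀ x, (ρ x).PosSemidef) (tρ : ∀ x, (ρ x).trace = 1)
    (hσ : ∀ y, (σ y).PosSemidef) (tσ : ∀ y, (σ y).trace = 1)
    (hpovm : ∀ o, (povm o).PosSemidef) (sum_povm : ∑ o, povm o = 1) :
    ∃ P : QuantumSMP X Y O k l,
      ∀ x y o, P.prob x y o = ((povm o * (ρ x ⊗ₖ σ y)).trace).re := by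
  let e := eA.prodCongr eB
  refine ⟨{ ρ := fun x => (ρ x).submatrix eA eA
            ρ_pos := fun x => (hρ x).submatrix _
            ρ_trace := fun x => by rw [trace_submatrix_equiv, tρ]
            σ := fun y => (σ y).submatrix eB eB
            σ_pos := fun y => (hσ y).submatrix _
            σ_trace := fun y => by rw [trace_submatrix_equiv, tσ]
            povm := fun o => (povm o).submatrix e e
            povm_pos := fun o => (hpovm o).submatrix _
            povm_sum := ?_ }, fun x y o => ?_⟩
  · have : ∑ o, (povm o).submatrix e e = (∑ o, povm o).submatrix e e := by
      ext s t; simp [Matrix.sum_apply]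
    rw [this, sum_povm, Matrix.submatrix_one_equiv]
  · have : (ρ x).submatrix eA eA ⊗ₖ (σ y).submatrix eB eB = (ρ x ⊗ₖ σ y).submatrix e e := rfl
    simp only [QuantumSMP.prob]
    rw [this, Matrix.submatrix_mul_equiv, trace_submatrix_equiv]

/-- Independent quantum protocols, followed by a classical channel applied by the referee. -/
theorem QuantumSMP.exists_product (P : ι → QuantumSMP X Y O k l) {g : (ι → O) → O' → ℝ}
    (hg : ∀ z, g z ∈ stdSimplex ℝ O') :
    ∃ P' : QuantumSMP X Y O' (Fintype.card ι * k) (Fintype.card ι * l),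
      ∀ x y o, P'.prob x y o = ∑ z, (∏ i, (P i).prob x y (z i)) * g z o := by
  -- The `i`-th measurement acts on the `i`-th blocks of both messages, so the two families of
  -- blocks are regrouped as a family of pairs.
  let e := (Equiv.arrowProdEquivProdArrow ι (fun _ => Fin k → Bool) (fun _ => Fin l → Bool)).symm
  let N : (ι → O) → Matrix ((ι → Fin k → Bool) × (ι → Fin l → Bool))
      ((ι → Fin k → Bool) × (ι → Fin l → Bool)) ℂ := fun z =>
    (piKron fun i => (P i).povm (z i)).submatrix e e
  have hN : ∑ z, N z = 1 := by
    have : ∑ z, N z = (∑ z : ι → O, piKron fun i => (P i).povm (z i)).submatrix e e := by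
      ext s t; simp [N, Matrix.sum_apply]
    rw [this, sum_piKron fun i o => (P i).povm o]
    simp_rw [(P _).povm_sum]
    rw [piKron_one, Matrix.submatrix_one_equiv]
  obtain ⟨P', hP'⟩ := QuantumSMP.exists_of_equiv (blockEquiv ι k) (blockEquiv ι l)
    (ρ := fun x => piKron fun i => (P i).ρ x) (σ := fun y => piKron fun i => (P i).σ y)
    (povm := fun o => ∑ z, ((g z o : ℝ) : ℂ) • N z)
    (fun x => piKron_posSemidef fun i => (P i).ρ_pos x)
    (fun x => by rw [trace_piKron]; exact Finset.prod_eq_one fun i _ => (P i).ρ_trace x)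
    (fun y => piKron_posSemidef fun i => (P i).σ_pos y)
    (fun y => by rw [trace_piKron]; exact Finset.prod_eq_one fun i _ => (P i).σ_trace y)
    (fun o => Matrix.posSemidef_sum _ fun z _ =>
      ((piKron_posSemidef fun i => (P i).povm_pos (z i)).submatrix _).smul
        (by exact_mod_cast (hg z).1 o))
    (by
      rw [Finset.sum_comm]
      simp_rw [← Finset.sum_smul, ← Complex.ofReal_sum, (hg _).2, Complex.ofReal_one, one_smul]
      exact hN)
  refine ⟨P', fun x y o => ?_⟩
  have hkron : (piKron fun i => (P i).ρ x) ⊗ₖ (piKron fun i => (P i).σ y) =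
      (piKron fun i => (P i).ρ x ⊗ₖ (P i).σ y).submatrix e e := by
    ext s t
    simp [e, Matrix.kroneckerMap_apply, Finset.prod_mul_distrib]
  have htr : ∀ z, (N z * ((piKron fun i => (P i).ρ x) ⊗ₖ (piKron fun i => (P i).σ y))).trace =
      ((∏ i, (P i).prob x y (z i) : ℝ) : ℂ) := by
    intro z
    simp only [N]
    rw [hkron, Matrix.submatrix_mul_equiv, trace_submatrix_equiv, ← piKron_mul, trace_piKron,
      Complex.ofReal_prod]
    exact Finset.prod_congr rfl fun i _ => (P i).trace_eq x y (z i)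
  rw [hP', Finset.sum_mul, Matrix.trace_sum, Complex.re_sum]
  refine Finset.sum_congr rfl fun z _ => ?_
  rw [Matrix.smul_mul, Matrix.trace_smul, htr, smul_eq_mul, ← Complex.ofReal_mul,
    Complex.ofReal_re, mul_comm]

end Product

end NonSignaling

end

noncomputable section

open scoped Kronecker ComplexOrder

namespace NonSignaling

/-! ### One-shot protocols with a prescribed bias -/

section Base

variable {X : Type u₁} {Y : Type u₂}

lemma bsgn_indicator (o c : Bool) : (if o = c then (1 : ℝ) else 0) = (1 + bsgn o * bsgn c) / 2 := by
  cases o <;> cases c <;> norm_num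

/-- Each player sends one sign, and the referee outputs their product. -/
theorem PubSMP.exists_xor {Ω : Type} [Fintype Ω] {coin : Ω → ℝ} (hcoin : coin ∈ stdSimplex ℝ Ω)
    (s : X → Ω → Bool) (t : Y → Ω → Bool) :
    ∃ P : PubSMP X Y Bool 1 1, ∀ x y o,
      P.prob x y o = (1 + bsgn o * ∑ ω, coin ω * (bsgn (s x ω) * bsgn (t y ω))) / 2 := by
  refine ⟨{ Ω := Ω
            fintypeΩ := inferInstance
            coin := coin
            coin_mem := hcoin
            msgA := fun x ω _ => s x ω
            msgB := fun y ω _ => t y ω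
            referee := fun m m' o => if o = xor (m 0) (m' 0) then 1 else 0
            referee_mem := fun m m' => ⟨fun o => by dsimp only; split_ifs <;> simp, by simp⟩ }, fun x y o => ?_⟩
  simp only [PubSMP.prob, bsgn_indicator, bsgn_xor]
  have : ∀ ω, coin ω * ((1 + bsgn o * (bsgn (s x ω) * bsgn (t y ω))) / 2) =
      (coin ω + bsgn o * (coin ω * (bsgn (s x ω) * bsgn (t y ω)))) / 2 := fun ω => by ring
  simp_rw [this]
  rw [← Finset.sum_div, Finset.sum_add_distrib, ← Finset.mul_sum, hcoin.2]

/-! ### Fingerprint states and the conditional swap -/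

open Matrix

variable {J : Type} [Fintype J] [DecidableEq J]

/-- The amplitudes, up to normalization, of `(|0⟩ ⊗ ∑ⱼ |j⟩ + |1⟩ ⊗ ∑ⱼ sⱼ |j⟩)`. -/
def amplitude (s : J → Bool) (p : Bool × J) : ℝ := if p.1 then bsgn (s p.2) else 1

omit [Fintype J] [DecidableEq J] in
lemma amplitude_sq (s : J → Bool) (p : Bool × J) : amplitude s p * amplitude s p = 1 := by
  unfold amplitude; split_ifs
  · exact bsgn_mul_self _
  · simp

/-- The fingerprint state of a sign vector. -/
def fingerprint (s : J → Bool) : Matrix (Bool × J) (Bool × J) ℂ :=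
  ((2 * Fintype.card J : ℝ)⁻¹) • vecMulVec (fun p => (amplitude s p : ℂ))
    (star fun p => (amplitude s p : ℂ))

omit [DecidableEq J] in
lemma fingerprint_apply (s : J → Bool) (p p' : Bool × J) : fingerprint s p p' =
    (((2 * Fintype.card J : ℝ)⁻¹ * (amplitude s p * amplitude s p') : ℝ) : ℂ) := by
  simp [fingerprint, vecMulVec_apply]

omit [DecidableEq J] in
lemma fingerprint_posSemidef (s : J → Bool) : (fingerprint s).PosSemidef :=
  (posSemidef_vecMulVec_self_star _).smul (by positivity)

omit [DecidableEq J] in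
lemma trace_fingerprint [Nonempty J] (s : J → Bool) : (fingerprint s).trace = 1 := by
  simp only [Matrix.trace, Matrix.diag_apply, fingerprint_apply, amplitude_sq]
  have : (Fintype.card J : ℂ) ≠ 0 := by exact_mod_cast Fintype.card_ne_zero
  simp
  field_simp

/-- Exchange two fingerprint registers if their leading qubits differ. -/
def condSwap (p : (Bool × J) × (Bool × J)) : (Bool × J) × (Bool × J) :=
  if p.1.1 = p.2.1 then p else p.swap

omit [Fintype J] [DecidableEq J] in
lemma condSwap_condSwap (p : (Bool × J) × (Bool × J)) : condSwap (condSwap p) = p := by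
  unfold condSwap
  by_cases h : p.1.1 = p.2.1
  · simp [h]
  · simp [h, Ne.symm h]

/-- The sign of `condSwapMatrix`. -/
def condSign (p : (Bool × J) × (Bool × J)) : ℝ := if p.1.1 = p.2.1 then bsgn p.1.1 else 1

omit [Fintype J] [DecidableEq J] in
lemma condSign_condSwap (p : (Bool × J) × (Bool × J)) : condSign (condSwap p) = condSign p := by
  unfold condSwap condSign
  by_cases h : p.1.1 = p.2.1
  · simp [h]
  · simp [h, Ne.symm h]

omit [Fintype J] [DecidableEq J] in
lemma condSign_sq (p : (Bool × J) × (Bool × J)) : condSign p * condSign p = 1 := by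
  unfold condSign; split_ifs
  · exact bsgn_mul_self _
  · simp

/-- A self-adjoint unitary whose expectation in a pair of fingerprints is half the inner product of
the two sign vectors. -/
def condSwapMatrix (J : Type) [DecidableEq J] :
    Matrix ((Bool × J) × (Bool × J)) ((Bool × J) × (Bool × J)) ℂ :=
  Matrix.of fun p p' => if p' = condSwap p then (condSign p : ℂ) else 0

omit [Fintype J] in
lemma condSwapMatrix_conjTranspose : (condSwapMatrix J)ᴴ = condSwapMatrix J := by
  ext p p'
  have key : p = condSwap p' ↔ p' = condSwap p := by
    constructor <;> rintro rfl <;> rw [condSwap_condSwap]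
  simp only [conjTranspose_apply, condSwapMatrix, Matrix.of_apply, key]
  split_ifs with h
  · rw [h, condSign_condSwap]; simp
  · simp

lemma condSwapMatrix_mul_self : condSwapMatrix J * condSwapMatrix J = 1 := by
  ext p p'
  simp only [Matrix.mul_apply, condSwapMatrix, Matrix.of_apply]
  rw [Finset.sum_eq_single (condSwap p) (fun r _ hr => by simp [hr]) (by simp)]
  rw [if_pos rfl, condSwap_condSwap, condSign_condSwap]
  by_cases h : p' = p
  · subst h
    rw [if_pos rfl, Matrix.one_apply_eq, ← Complex.ofReal_mul, condSign_sq, Complex.ofReal_one]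
  · simp [h, Matrix.one_apply_ne' h]

/-- The measurement of the referee. -/
def swapPovm (J : Type) [DecidableEq J] (o : Bool) :
    Matrix ((Bool × J) × (Bool × J)) ((Bool × J) × (Bool × J)) ℂ :=
  (2⁻¹ : ℝ) • (1 + bsgn o • condSwapMatrix J)

lemma swapPovm_posSemidef (o : Bool) : (swapPovm J o).PosSemidef := by
  have : swapPovm J o = (swapPovm J o)ᴴ * swapPovm J o := by
    have h : (swapPovm J o)ᴴ = swapPovm J o := by
      simp [swapPovm, condSwapMatrix_conjTranspose]
    rw [h, swapPovm, smul_mul_smul_comm, mul_add, mul_one, add_mul, one_mul,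
      smul_mul_smul_comm, condSwapMatrix_mul_self, bsgn_mul_self, one_smul]
    module
  rw [this]
  exact posSemidef_conjTranspose_mul_self _

omit [Fintype J] in
lemma sum_swapPovm : ∑ o, swapPovm J o = 1 := by
  rw [Fintype.sum_bool]
  simp only [swapPovm, bsgn_true, bsgn_false]
  module

/-- Terms with equal leading qubits are all `+1` for `00` and `-1` for `11` and cancel; this is the
purpose of `condSign`. With different leading qubits the exchange matches a sign of `s` with the
sign of `t` at the same index. This gives `2 |J| ∑ⱼ sⱼ tⱼ`, over the normalization `(2 |J|) ^ 2`. -/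
lemma trace_condSwapMatrix_mul [Nonempty J] (s t : J → Bool) :
    (condSwapMatrix J * (fingerprint s ⊗ₖ fingerprint t)).trace =
      (((∑ j, bsgn (s j) * bsgn (t j)) / Fintype.card J / 2 : ℝ) : ℂ) := by
  have h1 : (condSwapMatrix J * (fingerprint s ⊗ₖ fingerprint t)).trace =
      ∑ p, (((2 * Fintype.card J : ℝ)⁻¹ * (2 * Fintype.card J : ℝ)⁻¹ * (condSign p *
        (amplitude s (condSwap p).1 * amplitude s p.1 *
          (amplitude t (condSwap p).2 * amplitude t p.2))) : ℝ) : ℂ) := by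
    simp only [Matrix.trace, Matrix.diag_apply, Matrix.mul_apply]
    refine Finset.sum_congr rfl fun p _ => ?_
    rw [Finset.sum_eq_single (condSwap p) (fun r _ hr => by simp [condSwapMatrix, hr]) (by simp)]
    simp only [condSwapMatrix, Matrix.of_apply, if_true, kroneckerMap_apply, fingerprint_apply]
    push_cast; ring
  rw [h1, ← Complex.ofReal_sum, ← Finset.mul_sum]
  congr 1
  rw [Fintype.sum_prod_type, Fintype.sum_prod_type, Fintype.sum_bool]
  simp only [Fintype.sum_prod_type, Fintype.sum_bool]
  have hc : (Fintype.card J : ℝ) ≠ 0 := by exact_mod_cast Fintype.card_ne_zero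
  simp [condSwap, condSign, amplitude, bsgn_mul_self, Finset.sum_add_distrib]
  rw [← Finset.mul_sum]
  field_simp
  ring

/-- Fingerprinting: if `2 ^ r` signs are shared in advance, the players send `r + 1` qubits each. -/
theorem QuantumSMP.exists_fingerprint {r : ℕ} (s : X → (Fin r → Bool) → Bool)
    (t : Y → (Fin r → Bool) → Bool) :
    ∃ P : QuantumSMP X Y Bool (r + 1) (r + 1), ∀ x y o,
      P.prob x y o = (1 + bsgn o * ((∑ j, bsgn (s x j) * bsgn (t y j)) / 2 ^ r / 2)) / 2 := by
  let e : (Fin (r + 1) → Bool) ≃ Bool × (Fin r → Bool) :=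
    (Fin.consEquiv fun _ : Fin (r + 1) => Bool).symm
  obtain ⟨P, hP⟩ := QuantumSMP.exists_of_equiv e e (fun x => fingerprint_posSemidef (s x))
    (fun x => trace_fingerprint (s x)) (fun y => fingerprint_posSemidef (t y))
    (fun y => trace_fingerprint (t y)) (swapPovm_posSemidef (J := Fin r → Bool)) sum_swapPovm
  refine ⟨P, fun x y o => ?_⟩
  rw [hP, swapPovm, Matrix.smul_mul, Matrix.trace_smul, add_mul, one_mul, Matrix.trace_add,
    Matrix.trace_kronecker, trace_fingerprint, trace_fingerprint, Matrix.smul_mul,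
    Matrix.trace_smul, trace_condSwapMatrix_mul]
  simp only [Complex.smul_re, Complex.add_re, Complex.ofReal_re, mul_one, Complex.one_re,
    smul_eq_mul]
  simp
  ring

end Base

end NonSignaling

end

noncomputable section

namespace NonSignaling

/-! ### Finite probability -/

section Probability

lemma prod_nonneg_of {ι O : Type*} [Fintype ι] {p : ι → O → ℝ} (h0 : ∀ i o, 0 ≤ p i o)
    (z : ι → O) : 0 ≤ ∏ i, p i (z i) := Finset.prod_nonneg fun i _ => h0 i (z i)

lemma sum_weights {ι O : Type*} [Fintype ι] [DecidableEq ι] [Fintype O] {p : ι → O → ℝ}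
    (h1 : ∀ i, ∑ o, p i o = 1) : ∑ z : ι → O, ∏ i, p i (z i) = 1 := by
  rw [sum_pi_prod]
  exact Finset.prod_eq_one fun i _ => h1 i

/-! #### Majority vote -/

/-- The majority vote, ties being broken by a fair coin. -/
def majority {N : ℕ} (z : Fin N → Bool) (o : Bool) : ℝ :=
  if 0 < bsgn o * ∑ i, bsgn (z i) then 1 else if ∑ i, bsgn (z i) = 0 then 1 / 2 else 0

lemma majority_add_not {N : ℕ} (z : Fin N → Bool) (o : Bool) :
    majority z o + majority z (!o) = 1 := by
  unfold majority
  rcases lt_trichotomy (∑ i, bsgn (z i)) 0 with h | h | h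
  · cases o <;> simp [h, h.not_gt, h.ne]
  · cases o <;> simp [h] <;> norm_num
  · cases o <;> simp [h, h.not_gt, h.ne']

lemma majority_nonneg {N : ℕ} (z : Fin N → Bool) (o : Bool) : 0 ≤ majority z o := by
  unfold majority; split_ifs <;> norm_num

lemma majority_mem {N : ℕ} (z : Fin N → Bool) : majority z ∈ stdSimplex ℝ Bool := by
  refine ⟨majority_nonneg z, ?_⟩
  rw [Fintype.sum_bool]
  exact majority_add_not z true

lemma majority_flip {N : ℕ} (z : Fin N → Bool) (o : Bool) :
    majority (fun i => !(z i)) o = majority z (!o) := by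
  simp [majority, bsgn_not]

/-- The surplus factors `v` lie below the geometric mean of `u` and `v`. -/
lemma pow_mul_pow_le_sqrt {u v : ℝ} (hv : 0 ≤ v) (huv : v ≤ u) {a b : ℕ} (hab : a ≤ b) :
    u ^ a * v ^ b ≤ √(u * v) ^ (a + b) := by
  obtain ⟨c, rfl⟩ := Nat.exists_eq_add_of_le hab
  have hu := hv.trans huv
  have h1 : v ≤ √(u * v) := Real.le_sqrt_of_sq_le (by rw [pow_two]; gcongr)
  have h2 : √(u * v) ^ 2 = u * v := Real.sq_sqrt (by positivity)
  calc u ^ a * v ^ (a + c) = (u * v) ^ a * v ^ c := by rw [pow_add, mul_pow]; ring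
    _ ≤ (√(u * v) ^ 2) ^ a * √(u * v) ^ c := by rw [h2]; gcongr
    _ = _ := by rw [← pow_mul, ← pow_add]; congr 1; ring

lemma prod_bool_eq {N : ℕ} (P : Bool → ℝ) (z : Fin N → Bool) (o : Bool) :
    ∏ i, P (z i) = P o ^ (Finset.univ.filter fun i => z i = o).card *
      P (!o) ^ (Finset.univ.filter fun i => ¬ z i = o).card := by
  rw [← Finset.prod_filter_mul_prod_filter_not Finset.univ (fun i => z i = o)]
  congr 1
  · exact Finset.prod_eq_pow_card fun i hi => by rw [(Finset.mem_filter.1 hi).2]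
  · refine Finset.prod_eq_pow_card fun i hi => ?_
    rw [Bool.eq_not.2 (Finset.mem_filter.1 hi).2]

lemma bsgn_mul_sum {N : ℕ} (z : Fin N → Bool) (o : Bool) :
    bsgn o * ∑ i, bsgn (z i) = (Finset.univ.filter fun i => z i = o).card -
      (Finset.univ.filter fun i => ¬ z i = o).card := by
  rw [Finset.mul_sum, ← Finset.sum_filter_add_sum_filter_not Finset.univ (fun i => z i = o)]
  have h1 : ∑ i ∈ Finset.univ.filter (fun i => z i = o), bsgn o * bsgn (z i) =
      ∑ i ∈ Finset.univ.filter (fun i => z i = o), (1 : ℝ) :=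
    Finset.sum_congr rfl fun i hi => by rw [(Finset.mem_filter.1 hi).2, bsgn_mul_self]
  have h2 : ∑ i ∈ Finset.univ.filter (fun i => ¬ z i = o), bsgn o * bsgn (z i) =
      ∑ i ∈ Finset.univ.filter (fun i => ¬ z i = o), (-1 : ℝ) :=
    Finset.sum_congr rfl fun i hi => by
      rw [Bool.eq_not.2 (Finset.mem_filter.1 hi).2, bsgn_not, mul_neg, bsgn_mul_self]
  rw [h1, h2]
  simp [sub_eq_add_neg]

/-- Each string is paired with its complement. In a pair without a tie only the string with the
wrong majority contributes, and its weight is at most `√(P o * P (!o)) ^ N`; a tied pair obeys the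
same bound. Summing over all strings counts the error twice, hence the factor `1 / 2`. -/
lemma majority_error_le {N : ℕ} {P : Bool → ℝ} (h0 : ∀ o, 0 ≤ P o) {o : Bool}
    (hP : P (!o) ≤ P o) :
    ∑ z : Fin N → Bool, (∏ i, P (z i)) * majority z (!o) ≤ 1 / 2 * (2 * √(P o * P (!o))) ^ N := by
  let flip : (Fin N → Bool) ≃ (Fin N → Bool) := Equiv.piCongrRight fun _ => Equiv.boolNot
  have hflip : ∑ z : Fin N → Bool, (∏ i, P (z i)) * majority z (!o) =
      ∑ z : Fin N → Bool, (∏ i, P (!(z i))) * majority z o := by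
    rw [← flip.sum_comp]
    refine Finset.sum_congr rfl fun z _ => ?_
    change (∏ i, P (!(z i))) * majority (fun i => !(z i)) (!o) = _
    rw [majority_flip, Bool.not_not]
  have hpt : ∀ z : Fin N → Bool,
      (∏ i, P (z i)) * majority z (!o) + (∏ i, P (!(z i))) * majority z o ≤
        √(P o * P (!o)) ^ N := by
    intro z
    set a := (Finset.univ.filter fun i => z i = o).card with ha
    set b := (Finset.univ.filter fun i => ¬ z i = o).card with hb
    have hN : a + b = N := by
      have := Finset.card_filter_add_card_filter_not (s := Finset.univ) (fun i : Fin N => z i = o)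
      simpa using this
    have e1 : ∏ i, P (z i) = P o ^ a * P (!o) ^ b := prod_bool_eq P z o
    have e2 : ∏ i, P (!(z i)) = P o ^ b * P (!o) ^ a := by
      have := prod_bool_eq (fun c => P (!c)) z o
      simp only [Bool.not_not] at this
      rw [this, mul_comm]
    have e3 := bsgn_mul_sum z o
    rw [← ha, ← hb] at e3
    have hsum := majority_add_not z o
    rcases lt_trichotomy a b with h | h | h
    · have hm : majority z o = 0 := by
        have h' : (a : ℝ) < b := by exact_mod_cast h
        have h3 : bsgn o * ∑ i, bsgn (z i) < 0 := by rw [e3]; linarith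
        have h4 : ∑ i, bsgn (z i) ≠ 0 := fun h => by rw [h, mul_zero] at h3; exact lt_irrefl _ h3
        simp [majority, h3.not_gt, h4]
      have : majority z (!o) = 1 := by linarith
      rw [hm, this, e1, mul_one, mul_zero, add_zero, ← hN]
      exact pow_mul_pow_le_sqrt (h0 _) hP h.le
    · rw [e1, e2, h, ← mul_add, add_comm, hsum, mul_one, ← hN, h]
      exact pow_mul_pow_le_sqrt (h0 _) hP le_rfl
    · have hm : majority z o = 1 := by
        have h' : (b : ℝ) < a := by exact_mod_cast h
        have h3 : 0 < bsgn o * ∑ i, bsgn (z i) := by rw [e3]; linarith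
        simp [majority, h3]
      have : majority z (!o) = 0 := by linarith
      rw [hm, this, e2, mul_one, mul_zero, zero_add, ← hN, add_comm]
      exact pow_mul_pow_le_sqrt (h0 _) hP h.le
  have h := Finset.sum_le_sum fun z (_ : z ∈ Finset.univ) => hpt z
  rw [Finset.sum_add_distrib, ← hflip] at h
  simp only [Finset.sum_const, Finset.card_univ, Fintype.card_pi, Fintype.card_bool,
    Finset.prod_const, Fintype.card_fin, nsmul_eq_mul] at h
  rw [mul_pow]
  push_cast at h
  linarith

/-- The majority of independent votes with bias `β` errs with probability at most
`exp (-β² N / 2) / 2`. -/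
theorem majority_correct {N : ℕ} {P : Bool → ℝ} (h0 : ∀ o, 0 ≤ P o) (h1 : ∑ o, P o = 1) {o : Bool}
    {β : ℝ} (hβ : 0 ≤ β) (hP : (1 + β) / 2 ≤ P o) :
    1 - 1 / 2 * Real.exp (-(β ^ 2 / 2 * N)) ≤
      ∑ z : Fin N → Bool, (∏ i, P (z i)) * majority z o := by
  have hsum : P o + P (!o) = 1 := by
    rw [← h1, Fintype.sum_bool]; cases o <;> simp [add_comm]
  have he := majority_error_le (N := N) h0 (o := o) (by linarith)
  have htot : ∑ z : Fin N → Bool, (∏ i, P (z i)) * majority z o +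
      ∑ z : Fin N → Bool, (∏ i, P (z i)) * majority z (!o) = 1 := by
    rw [← Finset.sum_add_distrib]
    simp_rw [← mul_add, majority_add_not, mul_one]
    exact sum_weights (p := fun _ => P) fun _ => h1
  -- The square of the left side is `1 - (2 * P o - 1) ^ 2 ≤ 1 - β ^ 2 ≤ exp (-β ^ 2)`.
  have hs : 2 * √(P o * P (!o)) ≤ Real.exp (-(β ^ 2 / 2)) := by
    have h2 : (2 * √(P o * P (!o))) ^ 2 ≤ Real.exp (-(β ^ 2 / 2)) ^ 2 := by
      rw [mul_pow, Real.sq_sqrt (mul_nonneg (h0 _) (h0 _)), ← Real.exp_nat_mul]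
      have h3 : 2 ^ 2 * (P o * P (!o)) ≤ -β ^ 2 + 1 := by
        have : P (!o) = 1 - P o := by linarith
        rw [this]; nlinarith
      refine h3.trans ((Real.add_one_le_exp _).trans_eq ?_)
      congr 1; push_cast; ring
    exact (sq_le_sq₀ (by positivity) (Real.exp_pos _).le).1 h2
  have hpow : (2 * √(P o * P (!o))) ^ N ≤ Real.exp (-(β ^ 2 / 2 * N)) := by
    refine (pow_le_pow_left₀ (by positivity) hs N).trans_eq ?_
    rw [← Real.exp_nat_mul]; congr 1; ring
  linarith

/-! #### Second moments -/

/-- Centred independent variables are orthogonal, so only the diagonal terms survive. -/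
lemma second_moment {ι O : Type*} [Fintype ι] [DecidableEq ι] [Fintype O] {p w : ι → O → ℝ}
    (h1 : ∀ i, ∑ o, p i o = 1) (hw : ∀ i, ∑ o, p i o * w i o = 0) :
    ∑ z : ι → O, (∏ i, p i (z i)) * (∑ i, w i (z i)) ^ 2 = ∑ i, ∑ o, p i o * w i o ^ 2 := by
  have key : ∀ i j, ∑ z : ι → O, (∏ k, p k (z k)) * (w i (z i) * w j (z j)) =
      if i = j then ∑ o, p i o * w i o ^ 2 else 0 := by
    intro i j
    -- The two factors are spread over the whole product, as functions of single coordinates, so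
    -- that the sum factorizes.
    have e : ∀ z : ι → O, (∏ k, p k (z k)) * (w i (z i) * w j (z j)) =
        ∏ k, p k (z k) * ((if k = i then w k (z k) else 1) * (if k = j then w k (z k) else 1)) := by
      intro z
      rw [Finset.prod_mul_distrib, Finset.prod_mul_distrib]
      simp
    simp_rw [e]
    rw [sum_pi_prod fun k o =>
      p k o * ((if k = i then w k o else 1) * (if k = j then w k o else 1))]
    split_ifs with hij
    · subst hij
      rw [Finset.prod_eq_single i _ (by simp)]
      · simp [pow_two]
      · intro k _ hk; simp [hk, h1]
    · refine Finset.prod_eq_zero (Finset.mem_univ i) ?_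
      simp [hij, hw]
  simp_rw [pow_two, Finset.sum_mul_sum, Finset.mul_sum]
  rw [Finset.sum_comm]
  refine Finset.sum_congr rfl fun i _ => ?_
  rw [Finset.sum_comm]
  simp_rw [key, pow_two]
  simp

/-- The pointwise bound `r ≤ c / 2 + r ^ 2 / (2 * c)` takes the place of Cauchy–Schwarz. -/
lemma first_moment_le {ι O : Type*} [Fintype ι] [DecidableEq ι] [Fintype O] {p w : ι → O → ℝ}
    (h0 : ∀ i o, 0 ≤ p i o) (h1 : ∀ i, ∑ o, p i o = 1) (hw : ∀ i, ∑ o, p i o * w i o = 0)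
    {c : ℝ} (hc : 0 < c) (hV : ∑ i, ∑ o, p i o * w i o ^ 2 ≤ c ^ 2) :
    ∑ z : ι → O, (∏ i, p i (z i)) * |∑ i, w i (z i)| ≤ c := by
  have hpt : ∀ z : ι → O, (∏ i, p i (z i)) * |∑ i, w i (z i)| ≤
      (∏ i, p i (z i)) * (c / 2) + (2 * c)⁻¹ * ((∏ i, p i (z i)) * (∑ i, w i (z i)) ^ 2) := by
    intro z
    have : |∑ i, w i (z i)| ≤ c / 2 + (2 * c)⁻¹ * (∑ i, w i (z i)) ^ 2 := by
      rw [← sq_abs]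
      set r := |∑ i, w i (z i)|
      have : c / 2 + (2 * c)⁻¹ * r ^ 2 - r = (2 * c)⁻¹ * (r - c) ^ 2 := by field_simp; ring
      have h : 0 ≤ (2 * c)⁻¹ * (r - c) ^ 2 := by positivity
      linarith
    calc _ ≤ (∏ i, p i (z i)) * (c / 2 + (2 * c)⁻¹ * (∑ i, w i (z i)) ^ 2) :=
          mul_le_mul_of_nonneg_left this (prod_nonneg_of h0 z)
      _ = _ := by ring
  refine (Finset.sum_le_sum fun z _ => hpt z).trans ?_
  rw [Finset.sum_add_distrib, ← Finset.sum_mul, ← Finset.mul_sum, second_moment h1 hw,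
    sum_weights h1]
  calc _ ≤ 1 * (c / 2) + (2 * c)⁻¹ * c ^ 2 := by gcongr
    _ = c := by field_simp; ring

/-! #### Estimating a distribution -/

/-- The empirical estimates need not form a probability distribution; the referee replaces them by a
nearest one, which depends on the estimates only. -/
lemma exists_nearest {C : Type*} [Fintype C] [Nonempty C] (e : C → ℝ) :
    ∃ g ∈ stdSimplex ℝ C, ∀ p ∈ stdSimplex ℝ C, ∑ a, |g a - e a| ≤ ∑ a, |p a - e a| := by
  classical
  obtain ⟨g, hg, hmin⟩ := (isCompact_stdSimplex ℝ C).exists_isMinOn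
    ⟨_, single_mem_stdSimplex ℝ (Classical.arbitrary C)⟩
    (f := fun p : C → ℝ => ∑ a, |p a - e a|) (by fun_prop)
  exact ⟨g, hg, fun p hp => hmin hp⟩

/-- A distribution whose probabilities are (approximately) `κ` times the biases of given coins can
be sampled by tossing each of the coins `N` times. -/
theorem exists_estimator {C : Type*} [Fintype C] [Nonempty C] [DecidableEq C] (κ : ℝ) (hκ : 0 < κ)
    (N : ℕ) (hN : 0 < N) :
    ∃ g : (C × Fin N → Bool) → C → ℝ, (∀ z, g z ∈ stdSimplex ℝ C) ∧
      ∀ p ∈ stdSimplex ℝ C, ∀ (c : C → ℝ) (η : ℝ), (∀ a, |c a| ≤ 1) → (∀ a, |κ * c a - p a| ≤ η) →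
      ∀ S : Finset C, |∑ a ∈ S, p a - ∑ a ∈ S, ∑ z : C × Fin N → Bool,
        (∏ i, (1 + bsgn (z i) * c i.1) / 2) * g z a| ≤ 2 * Fintype.card C * (η + κ / √N) := by
  let est : (C × Fin N → Bool) → C → ℝ := fun z a => κ / N * ∑ i, bsgn (z (a, i))
  choose g hg hmin using fun z => exists_nearest (est z)
  refine ⟨g, hg, fun p hp c η hc hη S => ?_⟩
  have hN' : (0 : ℝ) < N := by exact_mod_cast hN
  let P : C × Fin N → Bool → ℝ := fun i o => (1 + bsgn o * c i.1) / 2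
  have P0 : ∀ i o, 0 ≤ P i o := by
    intro i o
    have := abs_le.1 (hc i.1)
    cases o <;> simp [P] <;> linarith
  have P1 : ∀ i, ∑ o, P i o = 1 := by
    intro i; rw [Fintype.sum_bool]; simp [P]; ring
  have hest : ∀ a, ∑ z : C × Fin N → Bool, (∏ i, P i (z i)) * |p a - est z a| ≤ η + κ / √N := by
    intro a
    -- The tosses of the coin belonging to `a`, centred; the other coins do not enter.
    let w : C × Fin N → Bool → ℝ := fun i o => if i.1 = a then bsgn o - c a else 0
    have hw : ∀ i, ∑ o, P i o * w i o = 0 := by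
      rintro ⟨a', i⟩
      by_cases h : a' = a
      · subst h; rw [Fintype.sum_bool]; simp [P, w]; ring
      · simp [w, h]
    have hV : ∑ i, ∑ o, P i o * w i o ^ 2 ≤ √N ^ 2 := by
      rw [Real.sq_sqrt hN'.le, Fintype.sum_prod_type, Finset.sum_eq_single a _ (by simp)]
      · have : ∀ i : Fin N, ∑ o, P (a, i) o * w (a, i) o ^ 2 ≤ 1 := by
          intro i
          rw [Fintype.sum_bool]
          have : P (a, i) true * w (a, i) true ^ 2 + P (a, i) false * w (a, i) false ^ 2 =
              1 - c a ^ 2 := by simp [P, w]; ring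
          rw [this]; nlinarith [sq_nonneg (c a)]
        refine (Finset.sum_le_sum fun i _ => this i).trans ?_
        simp
      · intro a' _ h
        simp [w, h]
    have hF := first_moment_le P0 P1 hw (Real.sqrt_pos.2 hN') hV
    have hsum : ∀ z : C × Fin N → Bool, ∑ i, w i (z i) = ∑ i, bsgn (z (a, i)) - N * c a := by
      intro z
      rw [Fintype.sum_prod_type, Finset.sum_eq_single a _ (by simp)]
      · simp [w]
      · intro a' _ h
        simp [w, h]
    have hpt : ∀ z : C × Fin N → Bool, |p a - est z a| ≤ η + κ / N * |∑ i, w i (z i)| := by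
      intro z
      have e : p a - est z a = -(κ * c a - p a) + -(κ / N * ∑ i, w i (z i)) := by
        rw [hsum]; simp only [est]; field_simp; ring
      rw [e]
      refine (abs_add_le _ _).trans (add_le_add ?_ ?_)
      · rw [abs_neg]; exact hη a
      · rw [abs_neg, abs_mul, abs_of_pos (by positivity)]
    calc _ ≤ ∑ z : C × Fin N → Bool, ((∏ i, P i (z i)) * η +
            κ / N * ((∏ i, P i (z i)) * |∑ i, w i (z i)|)) := by
          refine Finset.sum_le_sum fun z _ => ?_
          refine (mul_le_mul_of_nonneg_left (hpt z) (prod_nonneg_of P0 z)).trans_eq ?_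
          ring
      _ ≤ 1 * η + κ / N * √N := by
          rw [Finset.sum_add_distrib, ← Finset.sum_mul, ← Finset.mul_sum, sum_weights P1]
          gcongr
      _ = η + κ / √N := by
          have h2 : (N : ℝ) = √N * √N := (Real.mul_self_sqrt hN'.le).symm
          have h3 : √(N : ℝ) ≠ 0 := (Real.sqrt_pos.2 hN').ne'
          rw [one_mul]; congr 1
          conv_lhs => rw [h2]
          simp only [Real.sqrt_mul_self (Real.sqrt_nonneg _)]
          field_simp
  have hS : ∑ a ∈ S, p a - ∑ a ∈ S, ∑ z, (∏ i, P i (z i)) * g z a =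
      ∑ z, (∏ i, P i (z i)) * ∑ a ∈ S, (p a - g z a) := by
    simp_rw [Finset.sum_sub_distrib, mul_sub]
    rw [Finset.sum_sub_distrib, ← Finset.sum_mul, sum_weights P1, one_mul, Finset.sum_comm]
    simp_rw [Finset.mul_sum]
  change |∑ a ∈ S, p a - ∑ a ∈ S, ∑ z, (∏ i, P i (z i)) * g z a| ≤ _
  rw [hS]
  calc _ ≤ ∑ z, (∏ i, P i (z i)) * (2 * ∑ a, |p a - est z a|) := by
        refine (Finset.abs_sum_le_sum_abs _ _).trans (Finset.sum_le_sum fun z _ => ?_)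
        rw [abs_mul, abs_of_nonneg (prod_nonneg_of P0 z)]
        refine mul_le_mul_of_nonneg_left ?_ (prod_nonneg_of P0 z)
        refine (Finset.abs_sum_le_sum_abs _ _).trans ?_
        refine (Finset.sum_le_sum_of_subset_of_nonneg (Finset.subset_univ S)
          fun a _ _ => abs_nonneg _).trans ?_
        -- Since `p` competes in the minimization, `g z` is at most as far from the estimate as `p`
        -- is; this is the factor 2 in the bound.
        have : ∑ a, |p a - g z a| ≤ ∑ a, |p a - est z a| + ∑ a, |g z a - est z a| := by
          rw [← Finset.sum_add_distrib]
          refine Finset.sum_le_sum fun a _ => ?_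
          rw [abs_sub_comm (g z a)]
          exact abs_sub_le _ _ _
        linarith [hmin z p hp]
    _ = 2 * ∑ a, ∑ z, (∏ i, P i (z i)) * |p a - est z a| := by
        rw [Finset.sum_comm, Finset.mul_sum]
        refine Finset.sum_congr rfl fun z _ => ?_
        rw [← Finset.mul_sum]; ring
    _ ≤ 2 * ∑ _a : C, (η + κ / √N) := by
        gcongr with a
        exact hest a
    _ = _ := by simp; ring

/-! #### Sampling -/

/-- From `exp x ≤ 1 + x + x ^ 2` for `|x| ≤ 1`: the linear term averages to 0 and the variance is at
most 1. Centring doubles the range of `f`, hence the restriction `|t| ≤ 1 / 2`. -/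
lemma exp_moment_le {Ω : Type*} [Fintype Ω] {coin : Ω → ℝ} (hcoin : coin ∈ stdSimplex ℝ Ω)
    {f : Ω → ℝ} (hf : ∀ ω, |f ω| ≤ 1) {t : ℝ} (ht : |t| ≤ 1 / 2) :
    ∑ ω, coin ω * Real.exp (t * (f ω - ∑ ω', coin ω' * f ω')) ≤ Real.exp (t ^ 2) := by
  set μ := ∑ ω', coin ω' * f ω' with hμdef
  have hμ : |μ| ≤ 1 := by
    refine (Finset.abs_sum_le_sum_abs _ _).trans ?_
    rw [← hcoin.2]
    refine Finset.sum_le_sum fun ω _ => ?_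
    rw [abs_mul, abs_of_nonneg (hcoin.1 ω)]
    exact mul_le_of_le_one_right (hcoin.1 ω) (hf ω)
  have hpt : ∀ ω, Real.exp (t * (f ω - μ)) ≤ 1 + t * (f ω - μ) + t ^ 2 * (f ω - μ) ^ 2 := by
    intro ω
    have h1 : |t * (f ω - μ)| ≤ 1 := by
      rw [abs_mul]
      have : |f ω - μ| ≤ 2 := (abs_sub _ _).trans (by linarith [hf ω])
      calc |t| * |f ω - μ| ≤ 1 / 2 * 2 := by gcongr
        _ = 1 := by norm_num
    have := (abs_le.1 (Real.abs_exp_sub_one_sub_id_le h1)).2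
    rw [mul_pow] at this
    linarith
  have hpt2 : ∀ ω, coin ω * Real.exp (t * (f ω - μ)) ≤
      coin ω * (1 + t ^ 2 - t * μ - t ^ 2 * μ ^ 2 + 2 * t ^ 2 * μ ^ 2) +
        coin ω * f ω * (t - 2 * t ^ 2 * μ) := by
    intro ω
    have hf2 : f ω ^ 2 ≤ 1 := by
      rw [← sq_abs]; exact pow_le_one₀ (abs_nonneg _) (hf ω)
    have h3 : 1 + t * (f ω - μ) + t ^ 2 * (f ω - μ) ^ 2 ≤
        1 + t ^ 2 - t * μ - t ^ 2 * μ ^ 2 + 2 * t ^ 2 * μ ^ 2 + f ω * (t - 2 * t ^ 2 * μ) := by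
      nlinarith [mul_le_mul_of_nonneg_left hf2 (sq_nonneg t)]
    calc _ ≤ coin ω * (1 + t ^ 2 - t * μ - t ^ 2 * μ ^ 2 + 2 * t ^ 2 * μ ^ 2 +
          f ω * (t - 2 * t ^ 2 * μ)) :=
          mul_le_mul_of_nonneg_left ((hpt ω).trans h3) (hcoin.1 ω)
      _ = _ := by ring
  refine (Finset.sum_le_sum fun ω _ => hpt2 ω).trans ?_
  rw [Finset.sum_add_distrib, ← Finset.sum_mul, ← Finset.sum_mul, hcoin.2, ← hμdef]
  have := Real.add_one_le_exp (t ^ 2)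
  nlinarith [mul_nonneg (sq_nonneg t) (sq_nonneg μ)]

/-- Finitely many averages of bounded functions are simultaneously approximated by averages over
a small sample. -/
theorem exists_sample {Ω I J : Type*} [Fintype Ω] [Fintype I] [Nonempty I] [Fintype J] [Nonempty J]
    {coin : Ω → ℝ} (hcoin : coin ∈ stdSimplex ℝ Ω) {f : I → Ω → ℝ} (hf : ∀ i ω, |f i ω| ≤ 1)
    {η : ℝ} (hη : 0 < η) (hη1 : η ≤ 1)
    (hJ : 4 * Real.log (2 * Fintype.card I) ≤ η ^ 2 * Fintype.card J) :
    ∃ σ : J → Ω, ∀ i, |(∑ j, f i (σ j)) / Fintype.card J - ∑ ω, coin ω * f i ω| ≤ η := by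
  classical
  let μ : I → ℝ := fun i => ∑ ω, coin ω * f i ω
  obtain ⟨R, hR⟩ : ∃ R : ℝ, R = (Fintype.card J : ℝ) := ⟨_, rfl⟩
  rw [← hR] at hJ ⊢
  have hR0 : 0 < R := by rw [hR]; exact_mod_cast Fintype.card_pos
  have hI0 : (0 : ℝ) < Fintype.card I := by exact_mod_cast Fintype.card_pos
  -- Chernoff with exponent `η / 2` and a union bound over indices and signs of the deviation: some
  -- sample keeps the sum of all exponentials at or below the bound on its mean.
  let Z : (J → Ω) → I × Bool → ℝ := fun σ p =>
    Real.exp (∑ j, bsgn p.2 * (η / 2) * (f p.1 (σ j) - μ p.1))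
  have hZ : ∀ p, ∑ σ : J → Ω, (∏ j, coin (σ j)) * Z σ p ≤ Real.exp ((η / 2) ^ 2 * R) := by
    intro p
    have e : ∀ σ : J → Ω, (∏ j, coin (σ j)) * Z σ p =
        ∏ j, coin (σ j) * Real.exp (bsgn p.2 * (η / 2) * (f p.1 (σ j) - μ p.1)) := by
      intro σ
      rw [Finset.prod_mul_distrib, ← Real.exp_sum]
    simp_rw [e]
    rw [sum_pi_prod fun (_ : J) ω => coin ω * Real.exp (bsgn p.2 * (η / 2) * (f p.1 ω - μ p.1)),
      Finset.prod_const, Finset.card_univ]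
    have hb : |bsgn p.2 * (η / 2)| ≤ 1 / 2 := by
      rw [abs_mul, abs_bsgn, abs_of_pos (by positivity)]; linarith
    refine (pow_le_pow_left₀ (Finset.sum_nonneg fun ω _ =>
      mul_nonneg (hcoin.1 ω) (Real.exp_pos _).le) (exp_moment_le hcoin (hf p.1) hb) _).trans_eq ?_
    rw [← Real.exp_nat_mul, mul_pow, pow_two (bsgn p.2), bsgn_mul_self, one_mul, ← hR, mul_comm]
  have htot : ∑ σ : J → Ω, (∏ j, coin (σ j)) * ∑ p, Z σ p ≤
      ∑ σ : J → Ω, (∏ j, coin (σ j)) * (2 * Fintype.card I * Real.exp ((η / 2) ^ 2 * R)) := by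
    rw [← Finset.sum_mul, sum_weights (p := fun _ : J => coin) fun _ => hcoin.2, one_mul]
    simp_rw [Finset.mul_sum]
    rw [Finset.sum_comm]
    refine (Finset.sum_le_card_nsmul _ _ _ fun p _ => hZ p).trans_eq ?_
    simp; ring
  have hex : ∃ σ : J → Ω, 0 < ∏ j, coin (σ j) ∧
      ∑ p, Z σ p ≤ 2 * Fintype.card I * Real.exp ((η / 2) ^ 2 * R) := by
    by_contra! hno
    have h0 : ∀ σ : J → Ω, 0 ≤ ∏ j, coin (σ j) := fun σ => Finset.prod_nonneg fun j _ => hcoin.1 _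
    refine htot.not_gt (Finset.sum_lt_sum (fun σ _ => ?_) ?_)
    · rcases (h0 σ).eq_or_lt with h | h
      · rw [← h]; simp
      · exact mul_le_mul_of_nonneg_left (hno σ h).le (h0 σ)
    · have h1 := sum_weights (p := fun _ : J => coin) fun _ => hcoin.2
      obtain ⟨σ, -, hσ⟩ := Finset.exists_ne_zero_of_sum_ne_zero (h1.trans_ne one_ne_zero)
      have hpos := lt_of_le_of_ne (h0 σ) (Ne.symm hσ)
      exact ⟨σ, Finset.mem_univ _, mul_lt_mul_of_pos_left (hno σ hpos) hpos⟩
  obtain ⟨σ, -, hσ⟩ := hex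
  refine ⟨σ, fun i => ?_⟩
  have hb : ∀ b, bsgn b * ((∑ j, f i (σ j)) / R - μ i) ≤ η := by
    intro b
    have h1 : Z σ (i, b) ≤ 2 * Fintype.card I * Real.exp ((η / 2) ^ 2 * R) :=
      (Finset.single_le_sum (f := Z σ) (fun p _ => (Real.exp_pos _).le) (Finset.mem_univ (i, b))).trans hσ
    have h2 := Real.log_le_log (Real.exp_pos _) h1
    rw [Real.log_exp, Real.log_mul (by positivity) (Real.exp_pos _).ne', Real.log_exp,
      ← Finset.mul_sum, Finset.sum_sub_distrib] at h2
    simp only [Finset.sum_const, Finset.card_univ, nsmul_eq_mul, ← hR] at h2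
    have h3 : bsgn b * (η / 2) * (∑ j, f i (σ j) - R * μ i) =
        (η / 2 * R) * (bsgn b * ((∑ j, f i (σ j)) / R - μ i)) := by field_simp
    rw [h3] at h2
    -- By `hJ` the logarithm is at most `η ^ 2 * R / 4`, as large as the moment term; together they
    -- make `η / 2 * R * η`.
    have h4 : (η / 2 * R) * (bsgn b * ((∑ j, f i (σ j)) / R - μ i)) ≤ (η / 2 * R) * η := by
      nlinarith
    exact le_of_mul_le_mul_left h4 (by positivity)
  have ht := hb true
  have hf' := hb false
  simp only [bsgn_true, bsgn_false] at ht hf'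
  rw [abs_le]
  constructor <;> linarith

end Probability

end NonSignaling

end

noncomputable section

open scoped InnerProductSpace ENNReal

namespace NonSignaling

/-! ### Costs and distances -/

section Costs

variable {X : Type u₁} {Y : Type u₂} {A : Type u₃} {B : Type u₄} [Fintype A] [Fintype B]

/-- An infimum of natural numbers: if all good protocols used more than `q` qubits, it would be at
least `q + 1`. -/
lemma exists_protocol_of_entQuantumCost_le {ε : ℝ} {p : X → Y → A → B → ℝ} {q : ℕ}
    (h : entQuantumCost.{u₁, u₂, u₃, u₄, w} ε p ≤ q) :
    ∃ q' ≤ q, ∃ (H : Type w) (_ : NormedAddCommGroup H) (_ : InnerProductSpace ℂ H)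
      (_ : CompleteSpace H) (P : EntProtocol H X Y A B q'), statDist p P.prob ≤ ε := by
  by_contra! hno
  have h1 : ((q + 1 : ℕ) : ℕ∞) ≤ entQuantumCost.{u₁, u₂, u₃, u₄, w} ε p := by
    refine le_iInf fun q' => le_iInf fun ⟨H, i1, i2, i3, P, hP⟩ => ?_
    by_contra hlt
    have hq : q' ≤ q := by
      have : q' < q + 1 := by exact_mod_cast not_le.1 hlt
      omega
    exact absurd hP (hno q' hq H i1 i2 i3 P).not_ge
  have h2 : ((q + 1 : ℕ) : ℕ∞) ≤ (q : ℕ∞) := h1.trans h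
  have : q + 1 ≤ q := by exact_mod_cast h2
  omega

/-- Finiteness of the inputs makes the supremum a bounded one. -/
lemma abs_sub_le_of_statDist_le [Finite X] [Finite Y] {p p' : X → Y → A → B → ℝ} {ε : ℝ}
    (h : statDist p p' ≤ ε) (x : X) (y : Y) (S : Finset (A × B)) :
    |(∑ c ∈ S, p x y c.1 c.2) - ∑ c ∈ S, p' x y c.1 c.2| ≤ ε :=
  (le_ciSup (f := fun t : X × Y × Finset (A × B) =>
    |(∑ c ∈ t.2.2, p t.1 t.2.1 c.1 c.2) - ∑ c ∈ t.2.2, p' t.1 t.2.1 c.1 c.2|)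
    (Set.finite_range _).bddAbove (x, y, S)).trans h

omit [Fintype A] [Fintype B] in
lemma statDist_le [Nonempty X] [Nonempty Y] {p p' : X → Y → A → B → ℝ} {ε : ℝ}
    (h : ∀ x y (S : Finset (A × B)),
      |(∑ c ∈ S, p x y c.1 c.2) - ∑ c ∈ S, p' x y c.1 c.2| ≤ ε) : statDist p p' ≤ ε :=
  ciSup_le fun t => h t.1 t.2.1 t.2.2

lemma toENNReal_le_ofReal {c : ℕ∞} {m : ℕ} {r : ℝ} (h : c ≤ (m : ℕ∞)) (hr : (m : ℝ) ≤ r) :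
    (c : ℝ≥0∞) ≤ ENNReal.ofReal r := by
  refine (ENat.toENNReal_le.2 h).trans ?_
  rw [ENat.toENNReal_coe, ← ENNReal.ofReal_natCast]
  exact ENNReal.ofReal_le_ofReal hr

lemma pubSMPCost_le {O : Type u₃} [Fintype O] {good : (X → Y → O → ℝ) → Prop} {k l : ℕ}
    (P : PubSMP X Y O k l) (hP : good P.prob) {r : ℝ} (hr : ((k + l : ℕ) : ℝ) ≤ r) :
    (pubSMPCost good : ℝ≥0∞) ≤ ENNReal.ofReal r :=
  toENNReal_le_ofReal (iInf_le_of_le k (iInf_le_of_le l (iInf_le_of_le ⟨P, hP⟩ le_rfl))) hr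

lemma quantumSMPCost_le {O : Type u₃} [Fintype O] {good : (X → Y → O → ℝ) → Prop} {k l : ℕ}
    (P : QuantumSMP X Y O k l) (hP : good P.prob) {r : ℝ} (hr : ((k + l : ℕ) : ℝ) ≤ r) :
    (quantumSMPCost good : ℝ≥0∞) ≤ ENNReal.ofReal r :=
  toENNReal_le_ofReal (iInf_le_of_le k (iInf_le_of_le l (iInf_le_of_le ⟨P, hP⟩ le_rfl))) hr

/-- The correlation is the probability of equal outcomes minus that of different ones, and each of
these two events moves by at most `ε`. -/
lemma corr_of_statDist_le [Finite X] [Finite Y] {f : X → Y → Bool} {p : X → Y → ℤˣ → ℤˣ → ℝ}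
    {ε : ℝ} (h : statDist (boolDist f) p ≤ ε) (x : X) (y : Y) :
    1 - 2 * ε ≤ bsgn (f x y) * (p x y 1 1 - p x y 1 (-1) - p x y (-1) 1 + p x y (-1) (-1)) := by
  have h1 := abs_le.1 (abs_sub_le_of_statDist_le h x y {(1, 1), (-1, -1)})
  have h2 := abs_le.1 (abs_sub_le_of_statDist_le h x y {(1, -1), (-1, 1)})
  have n1 : ((1 : ℤˣ), (1 : ℤˣ)) ≠ (-1, -1) := by decide
  have n2 : ((1 : ℤˣ), (-1 : ℤˣ)) ≠ (-1, 1) := by decide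
  have n3 : (1 : ℤˣ) ≠ -1 := by decide
  have n4 : (-1 : ℤˣ) ≠ 1 := by decide
  rw [Finset.sum_pair n1, Finset.sum_pair n1] at h1
  rw [Finset.sum_pair n2, Finset.sum_pair n2] at h2
  cases hf : f x y <;> simp [boolDist, sign, hf, n3, n4] at h1 h2 ⊢ <;> linarith [h1.1, h1.2, h2.1, h2.2]

end Costs

/-! ### Boolean functions -/

section Boolean

variable {X : Type} {Y : Type} [Fintype X] [Fintype Y] {f : X → Y → Bool}
  {V : Type w} [NormedAddCommGroup V] [InnerProductSpace ℝ V] {u : X → V} {v : Y → V}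
  {G γ δ : ℝ}

lemma prob_bool_nonneg {c : ℝ} (hc : |c| ≤ 1) (o : Bool) : 0 ≤ (1 + bsgn o * c) / 2 := by
  have := abs_le.1 hc
  cases o <;> simp <;> linarith

lemma sum_prob_bool (c : ℝ) : ∑ o, (1 + bsgn o * c) / 2 = 1 := by
  rw [Fintype.sum_bool]; simp; ring

lemma abs_signMean_le {Ω : Type*} [Fintype Ω] {coin : Ω → ℝ} (hcoin : coin ∈ stdSimplex ℝ Ω)
    (s t : Ω → Bool) : |∑ ω, coin ω * (bsgn (s ω) * bsgn (t ω))| ≤ 1 := by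
  refine (Finset.abs_sum_le_sum_abs _ _).trans_eq ?_
  simp_rw [abs_mul, abs_bsgn, mul_one, abs_of_nonneg (hcoin.1 _)]
  exact hcoin.2

lemma grothendieckConstant_pos : 0 < grothendieckConstant :=
  zero_lt_one.trans_le one_le_grothendieckConstant

theorem exists_pubSMP_computes (hG : 1 ≤ G) (hγ : 0 < γ)
    (hu : ∀ x, ‖u x‖ ^ 2 ≤ G) (hv : ∀ y, ‖v y‖ ^ 2 ≤ G)
    (huv : ∀ x y, γ ≤ bsgn (f x y) * ⟪u x, v y⟫_ℝ) (N : ℕ)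
    (hN : 1 / 2 * Real.exp (-((γ / (grothendieckConstant * G)) ^ 2 / 2 * N)) ≤ δ) :
    ∃ (k l : ℕ) (P : PubSMP X Y Bool k l), k + l = 2 * N ∧ Computes δ f P.prob := by
  have hK := grothendieckConstant_pos
  obtain ⟨Ω, _, coin, s, t, hcoin, hst⟩ := exists_coin_of_inner u v (zero_lt_one.trans_le hG) hu hv
  obtain ⟨P₀, hP₀⟩ := PubSMP.exists_xor hcoin s t
  obtain ⟨P, hP⟩ := PubSMP.exists_product (fun _ : Fin N => P₀) (g := majority) majority_mem
  refine ⟨_, _, P, by simp; ring, fun x y => ?_⟩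
  rw [hP]
  simp_rw [hP₀]
  refine le_trans ?_ (majority_correct (prob_bool_nonneg (abs_signMean_le hcoin _ _))
    (sum_prob_bool _) (o := f x y) (β := γ / (grothendieckConstant * G)) (by positivity) ?_)
  · linarith
  · rw [hst]
    have : γ / (grothendieckConstant * G) ≤
        bsgn (f x y) * (⟪u x, v y⟫_ℝ / (grothendieckConstant * G)) := by
      rw [← mul_div_assoc]
      have := huv x y
      gcongr
    linarith

theorem pubSMPCost_computes_le (hG : 1 ≤ G) (hγ : 0 < γ) (hγ1 : γ ≤ 1)
    (hu : ∀ x, ‖u x‖ ^ 2 ≤ G) (hv : ∀ y, ‖v y‖ ^ 2 ≤ G)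
    (huv : ∀ x y, γ ≤ bsgn (f x y) * ⟪u x, v y⟫_ℝ) (hδ : 0 < δ) (hδ1 : δ < 1 / 2) :
    (pubSMPCost (Computes δ f) : ℝ≥0∞) ≤
      ENNReal.ofReal (4 * (grothendieckConstant * G / γ) ^ 2 * Real.log (1 / δ)) := by
  have hK := grothendieckConstant_pos
  set K := grothendieckConstant with hKdef
  have hΛ : 1 ≤ K * G / γ := by
    rw [le_div_iff₀ hγ, one_mul]
    exact hγ1.trans (one_le_mul_of_one_le_of_one_le one_le_grothendieckConstant hG)
  set Λ := K * G / γ with hΛdef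
  have hL : 0 < Real.log (1 / δ) := Real.log_pos (by rw [lt_div_iff₀ hδ]; linarith)
  set L := Real.log (1 / δ) with hLdef
  -- Rounding down keeps the cost `2 * N` within the bound. It loses at most `1 / 2` in the
  -- exponent, and `exp (1 / 2) ≤ 2` is absorbed by the factor `1 / 2` in `majority_correct`.
  let N := ⌊2 * Λ ^ 2 * L⌋₊
  have hN1 : (N : ℝ) ≤ 2 * Λ ^ 2 * L := Nat.floor_le (by positivity)
  have hN2 : 2 * Λ ^ 2 * L - 1 ≤ N := by linarith [Nat.lt_floor_add_one (2 * Λ ^ 2 * L)]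
  have hN : 1 / 2 * Real.exp (-((γ / (K * G)) ^ 2 / 2 * N)) ≤ δ := by
    have e : γ / (K * G) = Λ⁻¹ := by rw [hΛdef, inv_div]
    have h1 : -(Λ⁻¹ ^ 2 / 2 * N) ≤ -L + 1 / 2 := by
      have h2 : Λ⁻¹ ^ 2 / 2 * (2 * Λ ^ 2 * L - 1) ≤ Λ⁻¹ ^ 2 / 2 * N := by gcongr
      have h3 : Λ⁻¹ ^ 2 / 2 * (2 * Λ ^ 2 * L - 1) = L - Λ⁻¹ ^ 2 / 2 := by field_simp
      have h4 : Λ⁻¹ ^ 2 ≤ 1 := pow_le_one₀ (by positivity) (inv_le_one_of_one_le₀ hΛ)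
      linarith
    have h5 : Real.exp (1 / 2) ≤ 2 := by
      have h6 : Real.exp (1 / 2) ^ 2 ≤ 2 ^ 2 := by
        rw [← Real.exp_nat_mul]
        have : ((2 : ℕ) : ℝ) * (1 / 2) = 1 := by norm_num
        rw [this]; linarith [Real.exp_one_lt_d9]
      exact (sq_le_sq₀ (Real.exp_pos _).le (by norm_num)).1 h6
    rw [e]
    calc _ ≤ 1 / 2 * Real.exp (-L + 1 / 2) := by gcongr
      _ = 1 / 2 * (δ * Real.exp (1 / 2)) := by
        rw [Real.exp_add, hLdef, one_div δ, Real.log_inv, neg_neg, Real.exp_log hδ]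
      _ ≤ 1 / 2 * (δ * 2) := by gcongr
      _ = δ := by ring
  obtain ⟨k, l, P, hkl, hP⟩ := exists_pubSMP_computes hG hγ hu hv huv N hN
  refine pubSMPCost_le P hP ?_
  rw [hkl]; push_cast; linarith

end Boolean

/-! ### Fingerprints -/

section Fingerprints

lemma logb_two_le_self {t : ℝ} (ht : 0 < t) : Real.logb 2 t ≤ t := by
  have h1 := Real.log_le_sub_one_of_pos (half_pos ht)
  rw [Real.log_div ht.ne' (by norm_num)] at h1
  rw [Real.logb, div_le_iff₀ (Real.log_pos (by norm_num))]
  nlinarith [Real.log_two_gt_d9, Real.log_two_lt_d9]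

/-- The number of qubits needed for fingerprints of precision `η` for `4 ^ n` pairs of inputs. -/
lemma exists_fingerprint_length {n : ℕ} (hn : 2 ≤ n) {η : ℝ} (hη : 0 < η) (hη1 : η ≤ 1) :
    ∃ r : ℕ, ((r + 1 : ℕ) : ℝ) ≤ 8 * Real.logb 2 n / η ∧
      4 * Real.log (2 * 4 ^ n) ≤ η ^ 2 * 2 ^ r := by
  have hn' : (2 : ℝ) ≤ n := by exact_mod_cast hn
  have hℓ : 1 ≤ Real.logb 2 n := by
    rw [Real.le_logb_iff_rpow_le (by norm_num) (by linarith), Real.rpow_one]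
    exact hn'
  -- Below, `r` is `log₂ T` rounded up. `T` is chosen so that `η ^ 2 * T = 8 * n`, which exceeds `4
  -- * log (2 * 4 ^ n)` for `n ≥ 2`. The length bound uses that `ℓ` and `η⁻¹` are at least 1.
  set ℓ := Real.logb 2 n with hℓdef
  set T : ℝ := 8 * n / η ^ 2 with hT
  have hT0 : 0 < T := by positivity
  have hlogT : Real.logb 2 T = 3 + ℓ + 2 * Real.logb 2 η⁻¹ := by
    have e : T = 2 ^ (3 : ℕ) * (n * (η⁻¹) ^ 2) := by rw [hT]; field_simp; norm_num
    rw [e, Real.logb_mul (by norm_num) (by positivity), Real.logb_mul (by positivity)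
      (by positivity), Real.logb_pow, Real.logb_pow, Real.logb_self_eq_one (by norm_num), ← hℓdef]
    push_cast; ring
  have hη2 : 1 ≤ η⁻¹ := (one_le_inv₀ hη).2 hη1
  have hlogη : 0 ≤ Real.logb 2 η⁻¹ := Real.logb_nonneg (by norm_num) hη2
  have hlogη2 : Real.logb 2 η⁻¹ ≤ η⁻¹ := logb_two_le_self (by positivity)
  refine ⟨⌈Real.logb 2 T⌉₊, ?_, ?_⟩
  · have h1 := Nat.ceil_lt_add_one (a := Real.logb 2 T) (by rw [hlogT]; linarith)
    push_cast
    have h2 : (5 : ℝ) + ℓ + 2 * η⁻¹ ≤ 8 * ℓ / η := by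
      rw [div_eq_mul_inv]
      nlinarith [mul_nonneg (sub_nonneg.2 hℓ) (sub_nonneg.2 hη2)]
    linarith
  · have h1 : T ≤ 2 ^ ⌈Real.logb 2 T⌉₊ := by
      rw [← Real.rpow_natCast, ← Real.logb_le_iff_le_rpow (by norm_num) hT0]
      exact Nat.le_ceil _
    have h2 : 4 * Real.log (2 * 4 ^ n) ≤ 8 * n := by
      have e : (2 : ℝ) * 4 ^ n = 2 ^ (2 * n + 1) := by rw [pow_succ, pow_mul]; norm_num [mul_comm]
      rw [e, Real.log_pow]
      push_cast
      have := Real.log_two_lt_d9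
      nlinarith
    calc _ ≤ η ^ 2 * T := by rw [hT]; field_simp; linarith
      _ ≤ _ := by gcongr

/-- Fingerprint protocols realize the correlations of shared randomness, up to a factor `2` and an
arbitrary precision. -/
theorem exists_fingerprint_protocol {X : Type u₁} {Y : Type u₂} [Fintype X] [Fintype Y] [Nonempty X]
    [Nonempty Y] {n r : ℕ} (hXY : Fintype.card (X × Y) ≤ 4 ^ n) {η : ℝ} (hη : 0 < η) (hη1 : η ≤ 1)
    (hr : 4 * Real.log (2 * 4 ^ n) ≤ η ^ 2 * 2 ^ r) {Ω : Type} [Fintype Ω] {coin : Ω → ℝ}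
    (hcoin : coin ∈ stdSimplex ℝ Ω) (s : X → Ω → Bool) (t : Y → Ω → Bool) :
    ∃ (P : QuantumSMP X Y Bool (r + 1) (r + 1)) (c : X → Y → ℝ),
      (∀ x y, |c x y| ≤ 1) ∧
      (∀ x y, |c x y - ∑ ω, coin ω * (bsgn (s x ω) * bsgn (t y ω))| ≤ η) ∧
      ∀ x y o, P.prob x y o = (1 + bsgn o * (c x y / 2)) / 2 := by
  have hcard : (Fintype.card (Fin r → Bool) : ℝ) = 2 ^ r := by simp
  obtain ⟨σ, hσ⟩ := exists_sample (I := X × Y) (J := Fin r → Bool) hcoin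
    (f := fun xy ω => bsgn (s xy.1 ω) * bsgn (t xy.2 ω))
    (fun xy ω => by rw [abs_mul, abs_bsgn, abs_bsgn, one_mul]) hη hη1 (by
      rw [hcard]
      refine le_trans ?_ hr
      have h1 : (0 : ℝ) < Fintype.card (X × Y) := by exact_mod_cast Fintype.card_pos
      have h2 : (Fintype.card (X × Y) : ℝ) ≤ 4 ^ n := by exact_mod_cast hXY
      gcongr)
  obtain ⟨P, hP⟩ := QuantumSMP.exists_fingerprint (fun x j => s x (σ j)) (fun y j => t y (σ j))
  refine ⟨P, fun x y => (∑ j, bsgn (s x (σ j)) * bsgn (t y (σ j))) / 2 ^ r, fun x y => ?_,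
    fun x y => by simpa only [hcard] using hσ (x, y), hP⟩
  rw [abs_div, abs_of_pos (by positivity : (0 : ℝ) < 2 ^ r), div_le_one (by positivity), ← hcard]
  refine (Finset.abs_sum_le_sum_abs _ _).trans_eq ?_
  simp_rw [abs_mul, abs_bsgn]
  simp

end Fingerprints

/-! ### Boolean functions, quantum messages -/

section BooleanQuantum

variable {X : Type} {Y : Type} [Fintype X] [Fintype Y] [Nonempty X] [Nonempty Y] {f : X → Y → Bool}
  {V : Type w} [NormedAddCommGroup V] [InnerProductSpace ℝ V] {u : X → V} {v : Y → V}
  {G γ δ : ℝ}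

lemma half_le_log {t : ℝ} (ht : 2 ≤ t) : 1 / 2 ≤ Real.log t := by
  have h1 := Real.log_le_log (by norm_num) ht
  linarith [Real.log_two_gt_d9]

theorem quantumSMPCost_computes_le {n : ℕ} (hn : 2 ≤ n) (hXY : Fintype.card (X × Y) ≤ 4 ^ n)
    (hG : 1 ≤ G) (hγ : 0 < γ) (hγ1 : γ ≤ 1)
    (hu : ∀ x, ‖u x‖ ^ 2 ≤ G) (hv : ∀ y, ‖v y‖ ^ 2 ≤ G)
    (huv : ∀ x y, γ ≤ bsgn (f x y) * ⟪u x, v y⟫_ℝ) (hδ : 0 < δ) (hδ1 : δ < 1 / 2) :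
    (quantumSMPCost (Computes δ f) : ℝ≥0∞) ≤
      ENNReal.ofReal (1088 * (grothendieckConstant * G / γ) ^ 4 *
        (Real.logb 2 n * Real.log (1 / δ))) := by
  have hK := grothendieckConstant_pos
  have hΛ : 1 ≤ grothendieckConstant * G / γ := by
    rw [le_div_iff₀ hγ, one_mul]
    exact hγ1.trans (one_le_mul_of_one_le_of_one_le one_le_grothendieckConstant hG)
  set Λ := grothendieckConstant * G / γ with hΛdef
  have hL : 1 / 2 ≤ Real.log (1 / δ) := half_le_log (by rw [le_div_iff₀ hδ]; linarith)
  set L := Real.log (1 / δ) with hLdef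
  have hℓ : 0 ≤ Real.logb 2 n := Real.logb_nonneg (by norm_num) (by exact_mod_cast (by omega : 1 ≤ n))
  obtain ⟨r, hr1, hr2⟩ := exists_fingerprint_length hn (η := Λ⁻¹ / 2) (by positivity)
    (by linarith [inv_le_one_of_one_le₀ hΛ])
  obtain ⟨Ω, _, coin, s, t, hcoin, hst⟩ := exists_coin_of_inner u v (zero_lt_one.trans_le hG) hu hv
  obtain ⟨P₀, c, hc1, hc2, hP₀⟩ := exists_fingerprint_protocol hXY (by positivity)
    (by linarith [inv_le_one_of_one_le₀ hΛ]) hr2 hcoin s t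
  -- Of the bias `Λ⁻¹`, sampling to precision `Λ⁻¹ / 2` leaves one half and the swap measurement
  -- halves it again. With bias `Λ⁻¹ / 4`, `32 * Λ ^ 2 * L` votes give error at most `exp (-L) = δ`.
  let N := ⌈32 * Λ ^ 2 * L⌉₊
  have hN1 : 32 * Λ ^ 2 * L ≤ N := Nat.le_ceil _
  have hN2 : (N : ℝ) ≤ 34 * Λ ^ 2 * L := by
    have h1 := Nat.ceil_lt_add_one (a := 32 * Λ ^ 2 * L) (by positivity)
    have h2 : 1 ≤ Λ ^ 2 := one_le_pow₀ hΛ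
    have h3 : 1 * (1 / 2) ≤ Λ ^ 2 * L := by gcongr
    linarith
  obtain ⟨P, hP⟩ := QuantumSMP.exists_product (fun _ : Fin N => P₀) (g := majority) majority_mem
  refine quantumSMPCost_le P (fun x y => ?_) ?_
  · rw [hP]
    simp_rw [hP₀]
    refine le_trans ?_ (majority_correct (prob_bool_nonneg ?_)
      (sum_prob_bool _) (o := f x y) (β := Λ⁻¹ / 4) (by positivity) ?_)
    · have h1 : L ≤ (Λ⁻¹ / 4) ^ 2 / 2 * N := by
        calc L = (Λ⁻¹ / 4) ^ 2 / 2 * (32 * Λ ^ 2 * L) := by field_simp; norm_num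
          _ ≤ _ := by gcongr
      have h2 : Real.exp (-((Λ⁻¹ / 4) ^ 2 / 2 * N)) ≤ δ := by
        calc _ ≤ Real.exp (-L) := by gcongr
          _ = δ := by rw [hLdef, one_div, Real.log_inv, neg_neg, Real.exp_log hδ]
      linarith
    · rw [abs_div, abs_two]; linarith [hc1 x y]
    · have h1 := abs_le.1 (hc2 x y)
      have h2 : Λ⁻¹ ≤ bsgn (f x y) * ∑ ω, coin ω * (bsgn (s x ω) * bsgn (t y ω)) := by
        rw [hst, hΛdef, inv_div, ← mul_div_assoc]
        have := huv x y
        gcongr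
      have h3 : Λ⁻¹ / 2 ≤ bsgn (f x y) * c x y := by
        cases hf : f x y <;> simp only [hf, bsgn_true, bsgn_false] at h2 ⊢ <;> linarith [h1.1, h1.2]
      linarith
  · simp only [Fintype.card_fin]
    push_cast at hr1 ⊢
    calc (N : ℝ) * (r + 1) + N * (r + 1) = 2 * (N * (r + 1)) := by ring
      _ ≤ 2 * ((34 * Λ ^ 2 * L) * (8 * Real.logb 2 n / (Λ⁻¹ / 2))) := by gcongr
      _ = 1088 * Λ ^ 3 * (Real.logb 2 n * L) := by field_simp; ring
      _ ≤ _ := by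
        have : Λ ^ 3 ≤ Λ ^ 4 := pow_le_pow_right₀ hΛ (by norm_num)
        gcongr

end BooleanQuantum

/-! ### Distributions -/

section Distribution

variable {X : Type u₁} {Y : Type u₂} {A : Type u₃} {B : Type u₄} [Fintype X] [Fintype Y]
  [Fintype A] [Fintype B] [Nonempty X] [Nonempty Y] {p p' : X → Y → A → B → ℝ}
  {V : Type w} [NormedAddCommGroup V] [InnerProductSpace ℝ V] {u : X × A → V} {v : Y × B → V}
  {G ε δ : ℝ}

omit [Fintype X] [Fintype Y] [Nonempty X] [Nonempty Y] in
lemma pair_mem_stdSimplex (h0 : ∀ x y a b, 0 ≤ p' x y a b)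
    (h1 : ∀ x y, ∑ a, ∑ b, p' x y a b = 1) (x : X) (y : Y) :
    (fun c : A × B => p' x y c.1 c.2) ∈ stdSimplex ℝ (A × B) :=
  ⟨fun c => h0 x y c.1 c.2, by rw [Fintype.sum_prod_type]; exact h1 x y⟩

lemma simulates_of_close {P : X → Y → A × B → ℝ} (hp : statDist p p' ≤ ε)
    (h : ∀ x y (S : Finset (A × B)), |∑ c ∈ S, p' x y c.1 c.2 - ∑ c ∈ S, P x y c| ≤ δ) :
    Simulates (ε + δ) p P :=
  statDist_le fun x y S => (abs_sub_le _ _ _).trans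
    (add_le_add (abs_sub_le_of_statDist_le hp x y S) (h x y S))

omit [Fintype X] [Fintype Y] in
lemma nonempty_outcomes (h1 : ∀ x y, ∑ a, ∑ b, p' x y a b = 1) : Nonempty (A × B) := by
  obtain ⟨x⟩ := ‹Nonempty X›
  obtain ⟨y⟩ := ‹Nonempty Y›
  have h := h1 x y
  rw [← Fintype.sum_prod_type' (f := p' x y)] at h
  obtain ⟨c, -, -⟩ := Finset.exists_ne_zero_of_sum_ne_zero (h.trans_ne one_ne_zero)
  exact ⟨c⟩

/-- The coin of the pair `(a, b)` has bias exactly `p' x y a b / (K * G)`, so the estimator is used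
with systematic error 0. -/
theorem pubSMPCost_simulates_le (h0 : ∀ x y a b, 0 ≤ p' x y a b)
    (h1 : ∀ x y, ∑ a, ∑ b, p' x y a b = 1) (hG : 1 ≤ G)
    (hu : ∀ x, ‖u x‖ ^ 2 ≤ G) (hv : ∀ y, ‖v y‖ ^ 2 ≤ G)
    (huv : ∀ x y a b, p' x y a b = ⟪u (x, a), v (y, b)⟫_ℝ) (hp : statDist p p' ≤ ε)
    (hδ : 0 < δ) (hδ1 : δ < 1 / 2) :
    (pubSMPCost (Simulates (ε + δ) p) : ℝ≥0∞) ≤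
      ENNReal.ofReal (64 * grothendieckConstant ^ 2 * (G ^ 4 *
        (((Fintype.card A : ℝ) * Fintype.card B) ^ 4 / δ ^ 2) *
          Real.log ((Fintype.card A : ℝ) * Fintype.card B / δ) ^ 2)) := by
  classical
  have hK := grothendieckConstant_pos
  have hK1 := one_le_grothendieckConstant
  have := nonempty_outcomes h1
  have hG0 := zero_lt_one.trans_le hG
  have hD : (1 : ℝ) ≤ (Fintype.card A : ℝ) * Fintype.card B := by
    rw [← Nat.cast_mul, ← Fintype.card_prod]; exact_mod_cast Fintype.card_pos
  have hcard : (Fintype.card (A × B) : ℝ) = (Fintype.card A : ℝ) * Fintype.card B := by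
    rw [Fintype.card_prod, Nat.cast_mul]
  set D := (Fintype.card A : ℝ) * Fintype.card B
  set K := grothendieckConstant
  obtain ⟨Ω, _, coin, s, t, hcoin, hst⟩ := exists_coin_of_inner u v hG0 hu hv
  choose P₀ hP₀ using fun c : A × B =>
    PubSMP.exists_xor hcoin (fun x : X => s (x, c.1)) (fun y : Y => t (y, c.2))
  -- The estimator's error is `2 * D * (K * G) / √N`, so `√N ≥ M` suffices.
  let M : ℝ := 2 * D * (K * G) / δ
  have hM : 1 ≤ M := by
    simp only [M]
    rw [le_div_iff₀ hδ]
    have h2 : 1 * (1 * 1) ≤ D * (K * G) := by gcongr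
    linarith
  let N := ⌈M ^ 2⌉₊
  have hN1 : M ^ 2 ≤ N := Nat.le_ceil _
  have hN2 : (N : ℝ) ≤ 2 * M ^ 2 := by
    have h1 := Nat.ceil_lt_add_one (a := M ^ 2) (by positivity)
    have h2 : 1 ≤ M ^ 2 := one_le_pow₀ hM
    linarith
  have hN0 : 0 < N := Nat.ceil_pos.2 (by positivity)
  obtain ⟨g, hg, hest⟩ := exists_estimator (C := A × B) (K * G) (by positivity) N hN0
  obtain ⟨P, hP⟩ := PubSMP.exists_product (fun i : (A × B) × Fin N => P₀ i.1) hg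
  refine pubSMPCost_le P (simulates_of_close hp fun x y S => ?_) ?_
  · simp_rw [hP, hP₀]
    refine (hest _ (pair_mem_stdSimplex h0 h1 x y)
      (fun c => ∑ ω, coin ω * (bsgn (s (x, c.1) ω) * bsgn (t (y, c.2) ω))) 0
      (fun c => abs_signMean_le hcoin _ _) (fun c => ?_) S).trans ?_
    · rw [hst, huv, mul_div_cancel₀ _ (by positivity), sub_self, abs_zero]
    · have h2 : M ≤ √N := Real.le_sqrt_of_sq_le hN1
      rw [hcard, zero_add]
      calc 2 * D * (K * G / √N) ≤ 2 * D * (K * G / M) := by gcongr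
        _ = δ := by simp only [M]; field_simp
  -- The protocol needs no logarithmic factor; the lower bound on the logarithm serves to compare
  -- its cost with the stated bound.
  · have hlog : 1 / 2 ≤ Real.log (D / δ) := half_le_log (by rw [le_div_iff₀ hδ]; linarith)
    have hlog2 : (1 / 2) ^ 2 ≤ Real.log (D / δ) ^ 2 := by gcongr
    rw [Fintype.card_prod, Fintype.card_fin]
    push_cast
    rw [hcard, mul_one]
    have hpow1 : D ^ 3 ≤ D ^ 4 := pow_le_pow_right₀ hD (by norm_num)
    have hpow2 : G ^ 2 ≤ G ^ 4 := pow_le_pow_right₀ hG (by norm_num)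
    calc D * N + D * N = 2 * D * N := by ring
      _ ≤ 2 * D * (2 * M ^ 2) := by gcongr
      _ = 64 * K ^ 2 * (G ^ 2 * (D ^ 3 / δ ^ 2) * (1 / 2) ^ 2) := by
        simp only [M]; field_simp; ring
      _ ≤ _ := by gcongr

theorem quantumSMPCost_simulates_le {n : ℕ} (hn : 2 ≤ n) (hXY : Fintype.card (X × Y) ≤ 2 ^ n)
    (h0 : ∀ x y a b, 0 ≤ p' x y a b)
    (h1 : ∀ x y, ∑ a, ∑ b, p' x y a b = 1) (hG : 1 ≤ G)
    (hu : ∀ x, ‖u x‖ ^ 2 ≤ G) (hv : ∀ y, ‖v y‖ ^ 2 ≤ G)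
    (huv : ∀ x y a b, p' x y a b = ⟪u (x, a), v (y, b)⟫_ℝ) (hp : statDist p p' ≤ ε)
    (hδ : 0 < δ) (hδ1 : δ < 1 / 2) :
    (quantumSMPCost (Simulates (ε + δ) p) : ℝ≥0∞) ≤
      ENNReal.ofReal (16384 * grothendieckConstant ^ 3 * (G ^ 8 *
        (((Fintype.card A : ℝ) * Fintype.card B) ^ 9 / δ ^ 4) *
          Real.log ((Fintype.card A : ℝ) * Fintype.card B / δ) * Real.logb 2 n)) := by
  classical
  have hK := grothendieckConstant_pos
  have hK1 := one_le_grothendieckConstant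
  have := nonempty_outcomes h1
  have hG0 := zero_lt_one.trans_le hG
  have hℓ : 0 ≤ Real.logb 2 n := Real.logb_nonneg (by norm_num) (by exact_mod_cast (by omega : 1 ≤ n))
  have hD : (1 : ℝ) ≤ (Fintype.card A : ℝ) * Fintype.card B := by
    rw [← Nat.cast_mul, ← Fintype.card_prod]; exact_mod_cast Fintype.card_pos
  have hcard : (Fintype.card (A × B) : ℝ) = (Fintype.card A : ℝ) * Fintype.card B := by
    rw [Fintype.card_prod, Nat.cast_mul]
  set D := (Fintype.card A : ℝ) * Fintype.card B
  set K := grothendieckConstant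
  -- Half of `δ` goes to the sampling precision `(4 * m)⁻¹` and half to the `(8 * m) ^ 2` tosses.
  let m : ℝ := D * (K * G) / δ
  have hm : 1 ≤ m := by
    simp only [m]
    rw [le_div_iff₀ hδ]
    have h2 : 1 * (1 * 1) ≤ D * (K * G) := by gcongr
    linarith
  have hη : 0 < (4 * m)⁻¹ := by positivity
  have hη1 : (4 * m)⁻¹ ≤ 1 := inv_le_one_of_one_le₀ (by linarith)
  obtain ⟨r, hr1, hr2⟩ := exists_fingerprint_length hn hη hη1
  obtain ⟨Ω, _, coin, s, t, hcoin, hst⟩ := exists_coin_of_inner u v hG0 hu hv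
  choose P₀ c hc1 hc2 hP₀ using fun c : A × B => exists_fingerprint_protocol
    (hXY.trans (Nat.pow_le_pow_left (by norm_num) n)) hη hη1 hr2 hcoin
    (fun x : X => s (x, c.1)) (fun y : Y => t (y, c.2))
  let N := ⌈(8 * m) ^ 2⌉₊
  have hN1 : (8 * m) ^ 2 ≤ N := Nat.le_ceil _
  have hN2 : (N : ℝ) ≤ 128 * m ^ 2 := by
    have h1 := Nat.ceil_lt_add_one (a := (8 * m) ^ 2) (by positivity)
    have h2 : 1 ≤ m ^ 2 := one_le_pow₀ hm
    have h3 : (⌈(8 * m) ^ 2⌉₊ : ℝ) < 64 * m ^ 2 + 1 := h1.trans_eq (by ring)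
    change (⌈(8 * m) ^ 2⌉₊ : ℝ) ≤ _
    linarith
  have hN0 : 0 < N := Nat.ceil_pos.2 (by positivity)
  -- The additional factor 2 undoes the halving of the bias by the swap measurement.
  obtain ⟨g, hg, hest⟩ := exists_estimator (C := A × B) (2 * (K * G)) (by positivity) N hN0
  obtain ⟨P, hP⟩ := QuantumSMP.exists_product (fun i : (A × B) × Fin N => P₀ i.1) hg
  refine quantumSMPCost_le P (simulates_of_close hp fun x y S => ?_) ?_
  · simp_rw [hP, hP₀]
    refine (hest _ (pair_mem_stdSimplex h0 h1 x y)
      (fun e => c e x y / 2) (K * G * (4 * m)⁻¹)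
      (fun e => ?_) (fun e => ?_) S).trans ?_
    · rw [abs_div, abs_two]; linarith [hc1 e x y]
    · have h2 := hc2 e x y
      rw [hst] at h2
      have h3 : 2 * (K * G) * (c e x y / 2) - p' x y e.1 e.2 =
          K * G * (c e x y - ⟪u (x, e.1), v (y, e.2)⟫_ℝ / (K * G)) := by
        rw [huv]; field_simp
      rw [h3, abs_mul, abs_of_pos (by positivity)]
      gcongr
    · have h2 : 8 * m ≤ √N := Real.le_sqrt_of_sq_le hN1
      rw [hcard]
      calc 2 * D * (K * G * (4 * m)⁻¹ + 2 * (K * G) / √N)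
          ≤ 2 * D * (K * G * (4 * m)⁻¹ + 2 * (K * G) / (8 * m)) := by gcongr
        _ = δ := by simp only [m]; field_simp; ring
  · have hlog : 1 / 2 ≤ Real.log (D / δ) := half_le_log (by rw [le_div_iff₀ hδ]; linarith)
    rw [Fintype.card_prod, Fintype.card_fin]
    push_cast at hr1 ⊢
    rw [hcard]
    have hpow1 : D ^ 4 ≤ D ^ 9 := pow_le_pow_right₀ hD (by norm_num)
    have hpow2 : G ^ 3 ≤ G ^ 8 := pow_le_pow_right₀ hG (by norm_num)
    have hpow3 : δ ^ 4 ≤ δ ^ 3 := pow_le_pow_of_le_one hδ.le (by linarith) (by norm_num)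
    calc D * N * (r + 1) + D * N * (r + 1) = 2 * D * N * (r + 1) := by ring
      _ ≤ 2 * D * (128 * m ^ 2) * (8 * Real.logb 2 n / (4 * m)⁻¹) := by gcongr
      _ = 16384 * K ^ 3 * (G ^ 3 * (D ^ 4 / δ ^ 3) * (1 / 2) * Real.logb 2 n) := by
        simp only [m]; field_simp; ring
      _ ≤ _ := by gcongr

end Distribution

end NonSignaling

end

/-! ### Assembly of the six bounds -/

theorem mainTheorem7 :
    -- Boolean functions, public-coin simultaneous messages
    (∀ (n : ℕ) (f : (Fin n → Bool) → (Fin n → Bool) → Bool) (ε δ : ℝ) (q : ℕ),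
      0 ≤ ε → ε < 1 / 2 → 0 < δ → δ < 1 / 2 →
      entQuantumCost.{0, 0, 0, 0, w} ε (boolDist f) ≤ q →
      (pubSMPCost (Computes δ f) : ℝ≥0∞) ≤
        ENNReal.ofReal (grothendieckConstant ^ 2 * 2 ^ (2 * q + 2) * Real.log (1 / δ) *
          (1 / (1 - 2 * ε) ^ 2))) ∧
    -- Boolean functions, quantum simultaneous messages
    (∃ K : ℝ, 0 < K ∧
      ∀ (n : ℕ) (f : (Fin n → Bool) → (Fin n → Bool) → Bool) (ε δ : ℝ) (q : ℕ),
      2 ≤ n → 0 ≤ ε → ε < 1 / 2 → 0 < δ → δ < 1 / 2 →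
      entQuantumCost.{0, 0, 0, 0, w} ε (boolDist f) ≤ q →
      (quantumSMPCost (Computes δ f) : ℝ≥0∞) ≤
        ENNReal.ofReal (K * (Real.logb 2 n * 2 ^ (4 * q) * Real.log (1 / δ) *
          (1 / (1 - 2 * ε) ^ 4)))) ∧
    -- non-signaling distributions, public-coin simultaneous messages
    (∃ K : ℝ, 0 < K ∧
      ∀ (X : Type u₁) (Y : Type u₂) (A : Type u₃) (B : Type u₄)
        [Fintype X] [Fintype Y] [Fintype A] [Fintype B] [Nonempty X] [Nonempty Y]
        (p : X → Y → A → B → ℝ) (ε δ : ℝ) (q : ℕ),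
      IsNonSignaling p → 0 ≤ ε → ε < 1 / 2 → 0 < δ → δ < 1 / 2 →
      entQuantumCost.{u₁, u₂, u₃, u₄, w} ε p ≤ q →
      (pubSMPCost (Simulates (ε + δ) p) : ℝ≥0∞) ≤
        ENNReal.ofReal (K * (2 ^ (4 * q) *
          (((Fintype.card A : ℝ) * Fintype.card B) ^ 4 / δ ^ 2) *
          Real.log ((Fintype.card A : ℝ) * Fintype.card B / δ) ^ 2))) ∧
    -- non-signaling distributions, quantum simultaneous messages
    (∃ K : ℝ, 0 < K ∧
      ∀ (X : Type u₁) (Y : Type u₂) (A : Type u₃) (B : Type u₄)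
        [Fintype X] [Fintype Y] [Fintype A] [Fintype B] [Nonempty X] [Nonempty Y]
        (p : X → Y → A → B → ℝ) (n : ℕ) (ε δ : ℝ) (q : ℕ),
      IsNonSignaling p → 2 ≤ n → Fintype.card (X × Y) ≤ 2 ^ n →
      0 ≤ ε → ε < 1 / 2 → 0 < δ → δ < 1 / 2 →
      entQuantumCost.{u₁, u₂, u₃, u₄, w} ε p ≤ q →
      (quantumSMPCost (Simulates (ε + δ) p) : ℝ≥0∞) ≤
        ENNReal.ofReal (K * (2 ^ (8 * q) *
          (((Fintype.card A : ℝ) * Fintype.card B) ^ 9 / δ ^ 4) *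
          Real.log ((Fintype.card A : ℝ) * Fintype.card B / δ) * Real.logb 2 n))) ∧
    -- quantum distributions, public-coin simultaneous messages
    (∃ K : ℝ, 0 < K ∧
      ∀ (X : Type u₁) (Y : Type u₂) (A : Type u₃) (B : Type u₄)
        [Fintype X] [Fintype Y] [Fintype A] [Fintype B] [Nonempty X] [Nonempty Y]
        (p : X → Y → A → B → ℝ) (δ : ℝ),
      IsQuantum.{u₁, u₂, u₃, u₄, w} p → 0 < δ → δ < 1 / 2 →
      (pubSMPCost (Simulates δ p) : ℝ≥0∞) ≤
        ENNReal.ofReal (K * ((((Fintype.card A : ℝ) * Fintype.card B) ^ 4 / δ ^ 2) *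
          Real.log ((Fintype.card A : ℝ) * Fintype.card B / δ) ^ 2))) ∧
    -- quantum distributions, quantum simultaneous messages
    (∃ K : ℝ, 0 < K ∧
      ∀ (X : Type u₁) (Y : Type u₂) (A : Type u₃) (B : Type u₄)
        [Fintype X] [Fintype Y] [Fintype A] [Fintype B] [Nonempty X] [Nonempty Y]
        (p : X → Y → A → B → ℝ) (n : ℕ) (δ : ℝ),
      IsQuantum.{u₁, u₂, u₃, u₄, w} p → 2 ≤ n → Fintype.card (X × Y) ≤ 2 ^ n →
      0 < δ → δ < 1 / 2 →
      (quantumSMPCost (Simulates δ p) : ℝ≥0∞) ≤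
        ENNReal.ofReal (K * ((((Fintype.card A : ℝ) * Fintype.card B) ^ 9 / δ ^ 4) *
          Real.log ((Fintype.card A : ℝ) * Fintype.card B / δ) * Real.logb 2 n))) := by
  have hK := grothendieckConstant_pos
  refine ⟨fun n f ε δ q hε0 hε hδ hδ1 h => ?_, ⟨1088 * grothendieckConstant ^ 4, by positivity,
    fun n f ε δ q hn hε0 hε hδ hδ1 h => ?_⟩, ⟨64 * grothendieckConstant ^ 2, by positivity, ?_⟩,
    ⟨16384 * grothendieckConstant ^ 3, by positivity, ?_⟩,
    ⟨64 * grothendieckConstant ^ 2, by positivity, ?_⟩,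
    ⟨16384 * grothendieckConstant ^ 3, by positivity, ?_⟩⟩
  · obtain ⟨q', hq, H, _, _, _, P, hP⟩ := exists_protocol_of_entQuantumCost_le h
    obtain ⟨W, _, _, u, v, hu, hv, huv⟩ := P.exists_vectors_corr
    have hpow : (2 : ℝ) ^ q' ≤ 2 ^ q := pow_le_pow_right₀ (by norm_num) hq
    refine (pubSMPCost_computes_le (G := 2 ^ q) (γ := 1 - 2 * ε) (one_le_pow₀ (by norm_num))
      (by linarith) (by linarith) (fun x => (hu x).trans hpow) (fun y => (hv y).trans hpow)
      (fun x y => by rw [← huv]; exact corr_of_statDist_le hP x y) hδ hδ1).trans_eq ?_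
    congr 1
    rw [pow_add, pow_mul, ← pow_mul, mul_comm 2 q, pow_mul]
    field_simp
    norm_num
  · obtain ⟨q', hq, H, _, _, _, P, hP⟩ := exists_protocol_of_entQuantumCost_le h
    obtain ⟨W, _, _, u, v, hu, hv, huv⟩ := P.exists_vectors_corr
    have hpow : (2 : ℝ) ^ q' ≤ 2 ^ q := pow_le_pow_right₀ (by norm_num) hq
    refine (quantumSMPCost_computes_le (G := 2 ^ q) (γ := 1 - 2 * ε) hn
      (by simp [← mul_pow]) (one_le_pow₀ (by norm_num))
      (by linarith) (by linarith) (fun x => (hu x).trans hpow) (fun y => (hv y).trans hpow)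
      (fun x y => by rw [← huv]; exact corr_of_statDist_le hP x y) hδ hδ1).trans_eq ?_
    congr 1
    rw [mul_comm 4 q, pow_mul]
    field_simp
  · intro X Y A B _ _ _ _ _ _ p ε δ q _ hε0 hε hδ hδ1 h
    obtain ⟨q', hq, H, _, _, _, P, hP⟩ := exists_protocol_of_entQuantumCost_le h
    obtain ⟨W, _, _, u, v, hu, hv, huv⟩ := P.exists_vectors
    have hpow : (2 : ℝ) ^ q' ≤ 2 ^ q := pow_le_pow_right₀ (by norm_num) hq
    refine (pubSMPCost_simulates_le (G := 2 ^ q) P.prob_nonneg P.sum_prob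
      (one_le_pow₀ (by norm_num)) (fun x => (hu x).trans hpow) (fun y => (hv y).trans hpow) huv hP
      hδ hδ1).trans_eq ?_
    rw [mul_comm 4 q, pow_mul]
  · intro X Y A B _ _ _ _ _ _ p n ε δ q _ hn hXY hε0 hε hδ hδ1 h
    obtain ⟨q', hq, H, _, _, _, P, hP⟩ := exists_protocol_of_entQuantumCost_le h
    obtain ⟨W, _, _, u, v, hu, hv, huv⟩ := P.exists_vectors
    have hpow : (2 : ℝ) ^ q' ≤ 2 ^ q := pow_le_pow_right₀ (by norm_num) hq
    refine (quantumSMPCost_simulates_le (G := 2 ^ q) hn hXY P.prob_nonneg P.sum_prob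
      (one_le_pow₀ (by norm_num)) (fun x => (hu x).trans hpow) (fun y => (hv y).trans hpow) huv hP
      hδ hδ1).trans_eq ?_
    rw [mul_comm 8 q, pow_mul]
  · intro X Y A B _ _ _ _ _ _ p δ hp hδ hδ1
    obtain ⟨h0, h1, W, _, _, u, v, hu, hv, huv⟩ := hp.exists_vectors
    -- A quantum distribution has vectors of its own, so it is compared with itself, with `ε = 0`
    -- and `G = 1`.
    have hpp : statDist p p ≤ 0 := statDist_le fun x y S => by simp
    have := pubSMPCost_simulates_le h0 h1 le_rfl hu hv huv hpp hδ hδ1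
    simpa using this
  · intro X Y A B _ _ _ _ _ _ p n δ hp hn hXY hδ hδ1
    obtain ⟨h0, h1, W, _, _, u, v, hu, hv, huv⟩ := hp.exists_vectors
    have hpp : statDist p p ≤ 0 := statDist_le fun x y S => by simp
    have := quantumSMPCost_simulates_le hn hXY h0 h1 le_rfl hu hv huv hpp hδ hδ1
    simpa using this
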